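/- **Setting.** Let $\Sigma$ be a compact connected oriented surface with non-empty boundary, $\mathcal M$ a finite set of marked points on $\partial\Sigma$ meeting every boundary component, and $\mathcal P$ a finite non-empty set of punctures in the interior of $\Sigma$, such that $(\Sigma,\mathcal M,\mathcal P)$ is not a once-punctured monogon. Let $\tau$ be an ideal triangulation of $(\Sigma,\mathcal M,\mathcal P)$ in which every puncture $P$ is enclosed by a self-folded triangle, with folded side $i_P$, and in which no triangle shares a side with two self-folded triangles. Let $\widetilde\Sigma$ be the surface obtained by cutting $\Sigma$ open along all $i_P$ and gluing two copies of the result crosswise along the cuts: each of the two sides of the cut along $i_P$ in one copy is glued, point by point over $i_P$, to the other side in the other copy. Let $p:\widetilde\Sigma\to\Sigma$ be the projection and $\sigma:\widetilde\Sigma\to\widetilde\Sigma$ the involution exchanging the copies. Let $\pi_1^{\rm orb}(\Sigma)$ be the quotient of the fundamental groupoid of $\Sigma\setminus\mathcal P$ by the congruence generated by $c=c^{-1}$ for every loop $c$ running once along the boundary circle of an embedded closed disc whose only puncture is its centre. For a groupoid $G$, let $G^{\rm free}$ be the set of classes $[a]$ of loops $a\in G(x,x)$ ($x$ any object), where $a\in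 G(x,x)$ and $b\in G(y,y)$ are equivalent if $b=\gamma a\gamma^{-1}$ for some morphism $\gamma:x\to y$. Write $\pi_1^{\rm free}(\widetilde\Sigma)$ and $\pi_1^{\rm orb,free}(\Sigma)$ for the sets obtained from the fundamental groupoid of $\widetilde\Sigma$ and from $\pi_1^{\rm orb}(\Sigma)$; $\sigma$ acts on $\pi_1^{\rm free}(\widetilde\Sigma)$. An element of a group is *primitive* if it has infinite order and generates the largest cyclic subgroup containing it; a free class is primitive if it is represented by a primitive loop. **Statement.** There is a unique functor $\Phi$, from the fundamental groupoid of $\widetilde\Sigma$ with base points in $\widetilde\Sigma\setminus p^{-1}(\mathcal P)$ to $\pi_1^{\rm orb}(\Sigma)$, sending the class of each path $\gamma$ in $\widetilde\Sigma\setminus p^{-1}(\mathcal P)$ to the class of $p\circ\gamma$; likewise there is a unique map $\Psi:\pi_1^{\rm free}(\widetilde\Sigma)\to\pi_1^{\rm orb,free}(\Sigma)$ sending the free class of each loop $\gamma$ in $\widetilde\Sigma\setminus p^{-1}(\mathcal P)$ to that of $p\circ\gamma$. Let $\tilde x_0\in\widetilde\Sigma\setminus p^{-1}(\mathcal P)$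 and $x_0=p(\tilde x_0)$. 1. If $\widetilde\gamma\in\pi_1(\widetilde\Sigma,\tilde x_0)$ is primitive and $\sigma[\widetilde\gamma]=[\widetilde\gamma]$, then $\Psi([\widetilde\gamma])=[\alpha^2]$ for some primitive $\alpha\in\pi_1^{\rm orb}(\Sigma,x_0)$. 2. For $\widetilde\gamma\in\pi_1(\widetilde\Sigma,\tilde x_0)$, $\sigma[\widetilde\gamma]=[\widetilde\gamma^{-1}]$ if and only if $[\Phi(\widetilde\gamma)]=[\Phi(\widetilde\gamma)^{-1}]$; in this case $\widetilde\gamma$ is primitive if and only if $\Phi(\widetilde\gamma)$ is. 3. If $\gamma\in\pi_1^{\rm orb}(\Sigma,x_0)$ is primitive, then $[\gamma]\notin\operatorname{Im}\Psi$ if and only if $[\gamma^2]=\Psi([\widetilde\delta])$ for some primitive $\widetilde\delta\in\pi_1(\widetilde\Sigma,\tilde x_0)$ with $\sigma[\widetilde\delta]=[\widetilde\delta]$. 4. If $\gamma\in\pi_1^{\rm orb}(\Sigma,x_0)$ is primitive and $[\gamma]=[\gamma^{-1}]$, then $[\gamma]=\Psi([\widetilde\gamma])$ for some $\widetilde\gamma\in\pi_1(\widetilde\Sigma,\tilde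 x_0)$ with $\sigma[\widetilde\gamma]=[\widetilde\gamma^{-1}]$. Moreover: * (i) $\Psi$ induces a bijection $\{[\widetilde\gamma],\sigma[\widetilde\gamma]\}\mapsto\Psi([\widetilde\gamma])$ from the set of pairs $\{[\widetilde\gamma],\sigma[\widetilde\gamma]\}$ with $[\widetilde\gamma]\in\pi_1^{\rm free}(\widetilde\Sigma)$ primitive and $\sigma[\widetilde\gamma]\neq[\widetilde\gamma],[\widetilde\gamma^{-1}]$ to the set of primitive $[\gamma]\in\operatorname{Im}\Psi$ with $[\gamma]\neq[\gamma^{-1}]$. * (ii) $\Psi$ induces in the same way a bijection from the set of pairs $\{[\widetilde\gamma],\sigma[\widetilde\gamma]\}$ with $[\widetilde\gamma]$ primitive and $\sigma[\widetilde\gamma]=[\widetilde\gamma^{-1}]$ to the set of primitive $[\gamma]\in\pi_1^{\rm orb,free}(\Sigma)$ with $[\gamma]=[\gamma^{-1}]$. * (iii) Let $k$ be an algebraically closed field of characteristic different from $2$, and for each $\lambda\in k^*$ choose $\lambda'\in k^*$ with $(\lambda')^2=\lambda$. There is a bijection $$\{[\widetilde\gamma]\in\pi_1^{\rm free}(\widetilde\Sigma)\text{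 primitive},\ \sigma[\widetilde\gamma]=[\widetilde\gamma]\}\times k^*\times\mathbb Z/2\mathbb Z\longrightarrow\{[\alpha]\in\pi_1^{\rm orb,free}(\Sigma)\text{ primitive},\ [\alpha]\notin\operatorname{Im}\Psi\}\times k^*$$ sending $([\widetilde\gamma],\lambda,\varepsilon)$ to $([\alpha],(-1)^\varepsilon\lambda')$ with $[\alpha^2]=\Psi([\widetilde\gamma])$. -/

import Mathlib

open CategoryTheory

/-! ## Free classes of loops in a groupoid -/

/-- A loop of the groupoid `C`, based anywhere. -/
abbrev GroupoidLoop (C : Type*) [Groupoid C] := Σ x : C, End x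

/-- Two loops are conjugate if some morphism `γ : x ⟶ y` carries one to the other. -/
def GroupoidLoop.IsConj {C : Type*} [Groupoid C] (a b : GroupoidLoop C) : Prop :=
  ∃ γ : a.1 ⟶ b.1, (a.2 : a.1 ⟶ a.1) ≫ γ = γ ≫ (b.2 : b.1 ⟶ b.1)

/-- `C^free`: the conjugacy classes of all vertex groups of `C`, those at `x` and at `y` being
identified along the morphisms `x ⟶ y`. -/
def FreeClass (C : Type*) [Groupoid C] := Quot (GroupoidLoop.IsConj (C := C))

namespace FreeClass

variable {C : Type*} [Groupoid C] {D : Type*} [Groupoid D]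

/-- The free class `[a]` of a loop `a` at `x`. -/
def mk {x : C} (a : End x) : FreeClass C := Quot.mk _ ⟨x, a⟩

/-- The map on free classes induced by a functor. -/
def map (F : C ⥤ D) : FreeClass C → FreeClass D :=
  Quot.map (fun a => ⟨F.obj a.1, F.map a.2⟩) (by
    rintro ⟨x, a⟩ ⟨y, b⟩ ⟨γ, h⟩
    exact ⟨F.map γ, by
      have := congrArg F.map h
      simpa only [F.map_comp] using this⟩)

/-- `[a] ↦ [a⁻¹]`. -/
def inv : FreeClass C → FreeClass C :=
  Quot.map (fun a => ⟨a.1, a.2⁻¹⟩) (by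
    rintro ⟨x, a⟩ ⟨y, b⟩ ⟨γ, h⟩
    refine ⟨γ, ?_⟩
    change Groupoid.inv (X := x) (Y := x) a ≫ γ = γ ≫ Groupoid.inv (X := y) (Y := y) b
    change (a : x ⟶ x) ≫ γ = γ ≫ (b : y ⟶ y) at h
    have h2 := congrArg (fun t => Groupoid.inv (X := x) (Y := x) a ≫ t ≫ Groupoid.inv (X := y) (Y := y) b) h
    simpa using h2.symm)

/-- `[a] ↦ [a ^ 2]`. -/
def sq : FreeClass C → FreeClass C :=
  Quot.map (fun a => ⟨a.1, a.2 ^ 2⟩) (by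
    rintro ⟨x, a⟩ ⟨y, b⟩ ⟨γ, h⟩
    refine ⟨γ, ?_⟩
    change (a : x ⟶ x) ≫ γ = γ ≫ (b : y ⟶ y) at h
    simp only [pow_two]
    change ((a : x ⟶ x) ≫ (a : x ⟶ x)) ≫ γ = γ ≫ (b : y ⟶ y) ≫ (b : y ⟶ y)
    rw [Category.assoc, h, ← Category.assoc, h, Category.assoc])

end FreeClass

/-- `g` is primitive if it has infinite order and generates the largest cyclic subgroup
containing it. -/
def IsPrimitiveElt {G : Type*} [Group G] (g : G) : Prop :=
  ¬ IsOfFinOrder g ∧ ∀ h : G, g ∈ Subgroup.zpowers h → Subgroup.zpowers h ≤ Subgroup.zpowers g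

/-- A free class is primitive if it is represented by a primitive loop. -/
def FreeClass.IsPrimitive {C : Type*} [Groupoid C] (c : FreeClass C) : Prop :=
  ∃ (x : C) (a : End x), IsPrimitiveElt a ∧ FreeClass.mk a = c

/-! ## Marked surfaces and their ideal triangulations -/

open scoped Manifold in
/-- The space `S`, a topological surface with boundary, with marked points `M` on its boundary and
punctures `P` in its interior, is a marked surface with nonempty boundary and at least one
puncture, and is not a once-punctured monogon. -/
structure IsMarkedSurface {S : Type*} [TopologicalSpace S]
    [ChartedSpace (EuclideanHalfSpace 2) S] (M P : Set S) : Prop where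
  t2 : T2Space S
  compact : CompactSpace S
  connected : ConnectedSpace S
  boundary_nonempty : ((𝓡∂ 2).boundary S).Nonempty
  finite_marked : M.Finite
  finite_punctures : P.Finite
  marked_subset : M ⊆ (𝓡∂ 2).boundary S
  punctures_subset : P ⊆ (𝓡∂ 2).interior S
  marked_component : ∀ x ∈ (𝓡∂ 2).boundary S,
    (connectedComponentIn ((𝓡∂ 2).boundary S) x ∩ M).Nonempty
  punctures_nonempty : P.Nonempty
  not_monogon : ¬ (Nonempty (S ≃ₜ Metric.closedBall (0 : EuclideanSpace ℝ (Fin 2)) 1) ∧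
    M.ncard = 1 ∧ P.ncard = 1)

/-- The closed triangle, in barycentric coordinates. Its side `i` is `x i = 0`; it joins the
vertices `i + 1` and `i + 2` and is opposite to the vertex `i`. -/
abbrev ClosedTriangle := stdSimplex ℝ (Fin 3)

/-- The vertex `i` of the closed triangle. -/
def triangleVertex (i : Fin 3) : ClosedTriangle := ⟨Pi.single i 1, single_mem_stdSimplex ℝ i⟩

/-- The point `x` of side `i` of a triangle is matched with the point `y` of side `j` of a
triangle by the affine identification of the two sides that reverses their orientations (as is
needed for the orientations of the two triangles to agree). -/
def SideMatch (i j : Fin 3) (x y : ClosedTriangle) : Prop :=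
  x.1 i = 0 ∧ y.1 j = 0 ∧ x.1 (i + 1) = y.1 (j + 2) ∧ x.1 (i + 2) = y.1 (j + 1)

/-- The gluing of points of a disjoint union of triangles prescribed by an involution `pair` of
their sides. A side fixed by `pair` is not glued. -/
def SideGlue {T : Type*} (pair : T × Fin 3 → T × Fin 3) (a b : Σ _ : T, ClosedTriangle) : Prop :=
  ∃ i j : Fin 3, pair (a.1, i) = (b.1, j) ∧ (a.1, i) ≠ (b.1, j) ∧ SideMatch i j a.2 b.2

open scoped Manifold in
/-- An ideal triangulation of the oriented surface `S` with vertices `M ∪ P`: a presentation of `S`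
as a finite set of oriented triangles glued along sides. The glued sides are the arcs and the
remaining ones are the boundary segments. Two sides of the same triangle may be glued. -/
structure IdealTriangulation {S : Type*} [TopologicalSpace S]
    [ChartedSpace (EuclideanHalfSpace 2) S] (M P : Set S) where
  /-- The set of triangles. -/
  Tri : Type
  finite_tri : Finite Tri
  /-- The pairing of sides; its fixed points are the boundary segments. -/
  pair : Tri × Fin 3 → Tri × Fin 3
  pair_pair : Function.Involutive pair
  /-- The characteristic maps of the triangles. -/
  chart : Tri → ClosedTriangle → S
  continuous_chart : ∀ t, Continuous (chart t)
  chart_surjective : ∀ s : S, ∃ t x, chart t x = s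
  chart_eq_iff : ∀ a b : Σ _ : Tri, ClosedTriangle,
    chart a.1 a.2 = chart b.1 b.2 ↔ Relation.EqvGen (SideGlue pair) a b
  vertices : {s | ∃ t i, chart t (triangleVertex i) = s} = M ∪ P
  boundary_segments :
    {s | ∃ t i x, pair (t, i) = (t, i) ∧ x.1 i = 0 ∧ chart t x = s} = (𝓡∂ 2).boundary S

/-! ## The orbifold fundamental groupoid -/

/-- A closed disc embedded in `S` that contains a single point of `P`, its centre. -/
structure PunctureDisc {S : Type*} [TopologicalSpace S] (P : Set S) where
  /-- The embedding, of interest on the closed unit disc only. -/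
  toFun : ℂ → S
  continuousOn : ContinuousOn toFun (Metric.closedBall 0 1)
  injOn : Set.InjOn toFun (Metric.closedBall 0 1)
  center_mem : toFun 0 ∈ P
  only_center : ∀ z ∈ Metric.closedBall (0 : ℂ) 1, toFun z ∈ P → z = 0

namespace PunctureDisc

variable {S : Type*} [TopologicalSpace S] {P : Set S}

theorem notMem (d : PunctureDisc P) (z : Circle) : d.toFun z ∈ Pᶜ := fun h =>
  z.coe_ne_zero (d.only_center z (by simp [Circle.norm_coe]) h)

/-- The loop that runs once along the boundary circle of the disc. -/
noncomputable def loop (d : PunctureDisc P) :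
    Path (X := ↥(Pᶜ)) ⟨d.toFun (1 : Circle), d.notMem 1⟩ ⟨d.toFun (1 : Circle), d.notMem 1⟩ where
  toFun t := ⟨d.toFun (Circle.exp (2 * Real.pi * (t : ℝ))), d.notMem _⟩
  continuous_toFun := by
    refine Continuous.subtype_mk ?_ _
    refine d.continuousOn.comp_continuous (by fun_prop) (fun t => by
      rw [mem_closedBall_zero_iff, Circle.norm_coe])
  source' := by simp
  target' := by simp

end PunctureDisc

/-- The relation `c = c⁻¹`, for every loop `c` that runs once around a single puncture. -/
inductive OrbRel {S : Type*} [TopologicalSpace S] (P : Set S) :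
    ∀ ⦃x y : FundamentalGroupoid ↥(Pᶜ)⦄, (x ⟶ y) → (x ⟶ y) → Prop
  | around (d : PunctureDisc P) :
      OrbRel P (FundamentalGroupoid.fromPath (Path.Homotopic.Quotient.mk d.loop))
        (FundamentalGroupoid.fromPath (Path.Homotopic.Quotient.mk d.loop.symm))

/-- `OrbRel P` as a relation on the morphisms of the fundamental groupoid of `S ∖ P`. -/
def orbHomRel {S : Type*} [TopologicalSpace S] (P : Set S) :
    HomRel (FundamentalGroupoid ↥(Pᶜ)) := fun _ _ f g => OrbRel P f g

/-- The orbifold fundamental groupoid `π₁^orb(S, S ∖ P)`: the quotient of the fundamental groupoid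
of `S ∖ P` by the congruence generated by `OrbRel`. -/
abbrev OrbGroupoid {S : Type*} [TopologicalSpace S] (P : Set S) :=
  CategoryTheory.Quotient (orbHomRel P)

/-! ## The double cover attached to a triangulation -/

namespace IdealTriangulation

variable {S : Type*} [TopologicalSpace S] [ChartedSpace (EuclideanHalfSpace 2) S] {M P : Set S}

/-- A triangle is self-folded if two of its sides are glued together. -/
def SelfFolded (τ : IdealTriangulation M P) (t : τ.Tri) : Prop :=
  ∃ i j : Fin 3, i ≠ j ∧ τ.pair (t, i) = (t, j)

/-- Every puncture is the vertex enclosed by a self-folded triangle, and no triangle shares a side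
with two self-folded triangles. -/
structure IsSkewedGentle (τ : IdealTriangulation M P) : Prop where
  puncture_enclosed : ∀ p ∈ P, ∃ (t : τ.Tri) (i : Fin 3),
    τ.pair (t, i + 1) = (t, i + 2) ∧ τ.chart t (triangleVertex i) = p
  at_most_one : ∀ t t₁ t₂ : τ.Tri, τ.SelfFolded t₁ → τ.SelfFolded t₂ → t ≠ t₁ → t ≠ t₂ →
    (∃ i, (τ.pair (t, i)).1 = t₁) → (∃ j, (τ.pair (t, j)).1 = t₂) → t₁ = t₂

open Classical in
/-- The gluing that defines the cover, on two copies (sheets `true` and `false`) of the triangles.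
Sides of different triangles are glued as in `S`, within each sheet. If two sides of the same
triangle are glued in `S` (they are the two copies of the folded side `i_p` along which `S` is cut
open), each is glued to the other one in the opposite sheet. -/
def CoverGlue (τ : IdealTriangulation M P) (a b : Σ _ : τ.Tri × Bool, ClosedTriangle) : Prop :=
  SideGlue τ.pair ⟨a.1.1, a.2⟩ ⟨b.1.1, b.2⟩ ∧ b.1.2 = if a.1.1 = b.1.1 then !a.1.2 else a.1.2

/-- The surface obtained by cutting `S` along all folded sides and gluing two copies of the result
crosswise along the cuts. -/
def Cover (τ : IdealTriangulation M P) : Type := Quot τ.CoverGlue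

instance (τ : IdealTriangulation M P) : TopologicalSpace τ.Cover :=
  inferInstanceAs (TopologicalSpace (Quot τ.CoverGlue))

/-- The projection of the cover onto `S`. -/
def proj (τ : IdealTriangulation M P) : C(τ.Cover, S) where
  toFun := Quot.lift (fun a => τ.chart a.1.1 a.2) (fun a b h =>
    (τ.chart_eq_iff ⟨a.1.1, a.2⟩ ⟨b.1.1, b.2⟩).2 (Relation.EqvGen.rel _ _ h.1))
  continuous_toFun := continuous_quot_lift _ (by
    refine continuous_sigma (fun i => ?_)
    exact τ.continuous_chart i.1)

/-- The involution of the cover that exchanges the two sheets. -/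
def swap (τ : IdealTriangulation M P) : C(τ.Cover, τ.Cover) where
  toFun := Quot.map (fun a => ⟨(a.1.1, !a.1.2), a.2⟩) (fun a b h => ⟨h.1, by
    have h2 := h.2
    by_cases e : a.1.1 = b.1.1 <;> simp_all⟩)
  continuous_toFun := by
    refine continuous_quot_lift _ (continuous_quot_mk.comp ?_)
    refine continuous_sigma (fun i => ?_)
    exact continuous_sigmaMk (σ := fun _ : τ.Tri × Bool => ClosedTriangle) (i := (i.1, !i.2))

/-- The cover without the points over the punctures. -/
abbrev PuncturedCover (τ : IdealTriangulation M P) := {x : τ.Cover // τ.proj x ∈ Pᶜ}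

/-- The functor from the fundamental groupoid of the punctured cover to that of the cover. -/
noncomputable def fill (τ : IdealTriangulation M P) :
    FundamentalGroupoid τ.PuncturedCover ⥤ FundamentalGroupoid τ.Cover :=
  FundamentalGroupoid.map ⟨Subtype.val, continuous_subtype_val⟩

/-- The functor from the fundamental groupoid of the punctured cover to the orbifold fundamental
groupoid of `S` that sends the class of a path `γ` to the class of its projection. -/
noncomputable def down (τ : IdealTriangulation M P) :
    FundamentalGroupoid τ.PuncturedCover ⥤ OrbGroupoid P :=
  FundamentalGroupoid.map (X := τ.PuncturedCover) (Y := ↥(Pᶜ))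
    ⟨fun x => ⟨τ.proj x.1, x.2⟩, by fun_prop⟩ ⋙ CategoryTheory.Quotient.functor (orbHomRel P)

/-- `Φ` is the functor induced by the projection, from the fundamental groupoid of the cover with
base points not over punctures (given by its action on morphisms) to the orbifold fundamental
groupoid of `S`: the class of a path that avoids the points over punctures is sent to the class of
its projection. -/
structure IsInducedFunctor (τ : IdealTriangulation M P)
    (Φ : ∀ x y : FundamentalGroupoid τ.PuncturedCover,
      (τ.fill.obj x ⟶ τ.fill.obj y) → (τ.down.obj x ⟶ τ.down.obj y)) : Prop where
  map_id : ∀ x, Φ x x (𝟙 _) = 𝟙 _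
  map_comp : ∀ x y z f g, Φ x z (f ≫ g) = Φ x y f ≫ Φ y z g
  map_fill : ∀ x y (g : x ⟶ y), Φ x y (τ.fill.map g) = τ.down.map g

/-- `Ψ` is the map on free classes induced by the projection: the class of a loop that avoids the
points over punctures is sent to the class of its projection. -/
def IsInducedFree (τ : IdealTriangulation M P)
    (Ψ : FreeClass (FundamentalGroupoid τ.Cover) → FreeClass (OrbGroupoid P)) : Prop :=
  ∀ (x : FundamentalGroupoid τ.PuncturedCover) (g : End x),
    Ψ (FreeClass.mk (x := τ.fill.obj x) (τ.fill.map g)) =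
      FreeClass.mk (x := τ.down.obj x) (τ.down.map g)

/-- The action of the sheet exchange on the free homotopy classes of loops of the cover. -/
noncomputable def swapFree (τ : IdealTriangulation M P) :
    FreeClass (FundamentalGroupoid τ.Cover) → FreeClass (FundamentalGroupoid τ.Cover) :=
  FreeClass.map (FundamentalGroupoid.map τ.swap)

end IdealTriangulation

/-! ## Free groups -/

namespace FreeGroup

/-! Loops are recorded by the sides of triangles that they cross. Let F be the free group on two
copies of the set of sides, and let θ be the involution exchanging the copies; `SwapGroup` is the
semidirect product of F and ⟨θ⟩. Crossing a folded side is labelled θ. Crossing any other side σ is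
labelled σ(pr σ)⁻¹ in the first copy, so that crossing back gives the inverse and no orientation of
the arcs has to be chosen.

Multiplying labels along paths is well defined on the fundamental groupoid of the punctured surface.
A potential that jumps by the labels exists because the corners at a marked point form a finite fan
and not a cycle, and it defines a flat bundle whose monodromy is the holonomy (`nonempty_holonomy`).
A small circle around a puncture meets only a folded side, so its holonomy is conjugate to 1 or θ
and has trivial square. The holonomy therefore descends to the orbifold groupoid.

There it is faithful. Up to segments at the ends, a morphism is a sequence of crossings.
Backtracking cancels, and so do two successive crossings of a fold, because the orbifold relation
makes its two directions equal. What remains spells a reduced word, since each θ moves the later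
letters to the other copy; the word is trivial only for the empty sequence
(`eq_nil_of_prod_sideLabel`, `IsOver.injective`). The filled cover has a holonomy with the same
labels up to a sheet correction. It is faithful for the same reason, as the two directions across a
fold are homotopic through the point over the puncture.

The holonomy of a path of the cover equals that of its projection (`orbHol_down`). Paths of the
cover can be pushed off the points over punctures, so faithfulness on both sides makes Φ well
defined, unique and injective on vertex groups. Its image consists of the loops with holonomy in F,
a subgroup of index two (`mem_range_inducedHom`), and σ acts on free classes as conjugation by
elements outside that image (`swapFree_mk_eq_iff`).

The rest is group theory (`IsOrbifoldPair`). In F roots are unique and commuting elements have a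
common root. An involution outside F is conjugate to θ and centralises nothing in F except 1,
because θ fixes no nonempty reduced word. Hence a primitive element of the subgroup centralised from
outside is the square of a primitive outside element, and a nontrivial element of the subgroup can
be conjugated to its inverse only from outside. `IsOrbifoldCover` turns this into the statements on
free classes; the last bijection only adds the choice of a sign of a square root. -/

theorem eq_of_commute_of {α : Type*} {a b : α} (h : Commute (of a) (of b)) : a = b := by
  classical
  have h1 : mk [(a, true), (b, true)] = mk [(b, true), (a, true)] := h
  have h2 : ∀ c d : α, IsReduced [(c, true), (d, true)] := fun c d => by
    simp [IsReduced]
  have h3 := reduce.sound h1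
  rw [(h2 a b).reduce_eq, (h2 b a).reduce_eq] at h3
  simp only [List.cons.injEq, Prod.mk.injEq, and_true] at h3
  exact h3.1

/-- Commuting elements of a free group are powers of a common element. -/
theorem exists_mem_zpowers_of_commute {α : Type*} {x y : FreeGroup α} (h : Commute x y) :
    ∃ u ∈ Subgroup.closure {x, y}, x ∈ Subgroup.zpowers u ∧ y ∈ Subgroup.zpowers u := by
  set A := Subgroup.closure ({x, y} : Set (FreeGroup α))
  have hc : ∀ a b : A, a * b = b * a := by
    have : IsMulCommutative A := Subgroup.isMulCommutative_closure (by
      rintro a (rfl | rfl) b (rfl | rfl) <;> first | rfl | exact h | exact h.symm)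
    exact mul_comm'
  -- By Nielsen–Schreier the commutative subgroup `A` is free. Distinct free generators do not
  -- commute, so its rank is at most one.
  let e := IsFreeGroup.toFreeGroup A
  have hs : Subsingleton (IsFreeGroup.Generators A) := ⟨fun a b => eq_of_commute_of (by
    have := congrArg e (hc (e.symm (of a)) (e.symm (of b)))
    rwa [_root_.map_mul, _root_.map_mul, e.apply_symm_apply, e.apply_symm_apply] at this)⟩
  have hu : ∃ u : FreeGroup (IsFreeGroup.Generators A), ∀ z, z ∈ Subgroup.zpowers u := by
    rcases isEmpty_or_nonempty (IsFreeGroup.Generators A) with h0 | ⟨⟨g⟩⟩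
    · exact ⟨1, fun z => by rw [Subsingleton.elim z 1]; exact one_mem _⟩
    · refine ⟨of g, fun z => ?_⟩
      induction z using FreeGroup.induction_on with
      | C1 => exact one_mem _
      | of a => rw [Subsingleton.elim a g]; exact Subgroup.mem_zpowers _
      | inv_of a ha => exact inv_mem ha
      | mul a b ha hb => exact mul_mem ha hb
  obtain ⟨u, hu⟩ := hu
  have key : ∀ z : A, (z : FreeGroup α) ∈ Subgroup.zpowers (e.symm u : FreeGroup α) := fun z => by
    obtain ⟨n, hn⟩ := Subgroup.mem_zpowers_iff.1 (hu (e z))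
    refine Subgroup.mem_zpowers_iff.2 ⟨n, ?_⟩
    rw [← Subgroup.coe_zpow, ← map_zpow, hn, e.symm_apply_apply]
  exact ⟨(e.symm u : FreeGroup α), (e.symm u).2, key ⟨x, Subgroup.subset_closure (by simp)⟩,
    key ⟨y, Subgroup.subset_closure (by simp)⟩⟩

end FreeGroup

/-! ## The holomorph of a free group on two copies of a set -/

section SwapGroup

variable (A : Type*)

/-- The automorphism of the free group on `A × Bool` exchanging the two copies of `A`. -/
def flipAut : MulAut (FreeGroup (A × Bool)) :=
  FreeGroup.freeGroupCongr ((Equiv.refl A).prodCongr Equiv.boolNot)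

theorem flipAut_of (a : A) (s : Bool) :
    flipAut A (FreeGroup.of (a, s)) = FreeGroup.of (a, !s) := by
  simp [flipAut]

theorem flipAut_mk (L : List ((A × Bool) × Bool)) :
    flipAut A (FreeGroup.mk L) = FreeGroup.mk (L.map fun x => ((x.1.1, !x.1.2), x.2)) := by
  simp [flipAut, FreeGroup.map.mk]
  rfl

theorem flipAut_mul_self : flipAut A * flipAut A = 1 := by
  ext x
  obtain ⟨L, rfl⟩ := Quot.exists_rep x
  change flipAut A (flipAut A (FreeGroup.mk L)) = FreeGroup.mk L
  rw [flipAut_mk, flipAut_mk, List.map_map]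
  congr 1
  conv_rhs => rw [← List.map_id L]
  congr 1
  ext x <;> simp

theorem flipAut_ne_one [Nonempty A] : flipAut A ≠ 1 := by
  intro h
  obtain ⟨a⟩ := ‹Nonempty A›
  have := congrArg (fun f => f (FreeGroup.of (a, true))) h
  simp only [flipAut_of, MulAut.one_apply] at this
  have := FreeGroup.of_injective this
  simp at this

/-- The semidirect product of the free group on two copies of `A` with the group of order two
generated by the exchange of the copies. -/
abbrev SwapGroup := FreeGroup (A × Bool) ⋊[(Subgroup.zpowers (flipAut A)).subtype]
  Subgroup.zpowers (flipAut A)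

variable {A}

/-- The generator of the group of order two. -/
def flipGen : Subgroup.zpowers (flipAut A) := ⟨flipAut A, Subgroup.mem_zpowers _⟩

theorem flipGen_mul_self : (flipGen : Subgroup.zpowers (flipAut A)) * flipGen = 1 :=
  Subtype.ext (flipAut_mul_self A)

theorem flipGen_ne_one [Nonempty A] : (flipGen : Subgroup.zpowers (flipAut A)) ≠ 1 := fun h =>
  flipAut_ne_one A (congrArg Subtype.val h)

theorem eq_one_or_flipGen (g : Subgroup.zpowers (flipAut A)) : g = 1 ∨ g = flipGen := by
  obtain ⟨g, n, rfl⟩ := g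
  rcases Int.even_or_odd' n with ⟨m, rfl | rfl⟩
  · left; ext1
    simp [zpow_mul, pow_two, flipAut_mul_self, zpow_ofNat]
  · right; ext1
    simp [zpow_add, zpow_mul, pow_two, flipAut_mul_self, flipGen, zpow_ofNat]

/-- The exchange of the copies as an element of the semidirect product. -/
def theta : SwapGroup A := SemidirectProduct.inr flipGen

theorem theta_mul_self : (theta : SwapGroup A) * theta = 1 := by
  rw [theta, ← map_mul, flipGen_mul_self, map_one]

theorem right_mul_of_ne {x y : SwapGroup A} (hx : x.right ≠ 1) (hy : y.right ≠ 1) :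
    (x * y).right = 1 := by
  rw [SemidirectProduct.mul_right, (eq_one_or_flipGen _).resolve_left hx,
    (eq_one_or_flipGen _).resolve_left hy, flipGen_mul_self]

/-- An element of the form `w = v * flip(v)⁻¹`. -/
theorem exists_eq_mul_flip_inv {w : FreeGroup (A × Bool)} (h : w * flipAut A w = 1) :
    ∃ v, w = v * (flipAut A v)⁻¹ := by
  classical
  set W := w.toWord with hW
  have hw : w = FreeGroup.mk W := FreeGroup.mk_toWord.symm
  set f : (A × Bool) × Bool → (A × Bool) × Bool := fun x => ((x.1.1, !x.1.2), x.2) with hf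
  have hfi : Function.Injective f := by
    rintro ⟨⟨a, b⟩, c⟩ ⟨⟨a', b'⟩, c'⟩; simp [hf]
  have h1 : W.map f = FreeGroup.invRev W := by
    have h2 : flipAut A w = w⁻¹ := eq_inv_of_mul_eq_one_right h
    have h3 : FreeGroup.mk (W.map f) = FreeGroup.mk (FreeGroup.invRev W) := by
      rw [← flipAut_mk, ← FreeGroup.inv_mk, ← hw, h2]
    have h4 := FreeGroup.reduce.sound h3
    have h5 : FreeGroup.IsReduced W := FreeGroup.isReduced_toWord
    have h6 : FreeGroup.IsReduced (W.map f) := by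
      unfold FreeGroup.IsReduced at h5 ⊢
      rw [List.isChain_map]
      refine h5.imp ?_
      rintro ⟨⟨a, b⟩, c⟩ ⟨⟨a', b'⟩, c'⟩; simp [hf]
    rw [h6.reduce_eq, FreeGroup.reduce_invRev, h5.reduce_eq] at h4
    exact h4
  have hinv : FreeGroup.invRev W = (W.map fun x => (x.1, !x.2)).reverse := rfl
  -- In odd length the middle letter would have to equal, after the exchange, its own inverse; but
  -- the exchange keeps exponents.
  have heven : Even W.length := by
    by_contra hodd
    obtain ⟨m, hm⟩ := Nat.not_even_iff_odd.1 hodd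
    have h2 := congrArg (fun L : List _ => L[m]?) (h1.trans hinv)
    simp only [List.getElem?_map] at h2
    rw [List.getElem?_reverse (by simp; omega)] at h2
    simp only [List.length_map, hm, List.getElem?_map] at h2
    rw [show 2 * m + 1 - 1 - m = m by omega, List.getElem?_eq_getElem (by omega)] at h2
    simp [hf, Prod.ext_iff] at h2
  obtain ⟨m, hm⟩ := heven
  obtain ⟨P, Q, hPQ, hP⟩ : ∃ P Q, W = P ++ Q ∧ P.length = m :=
    ⟨W.take m, W.drop m, (List.take_append_drop m W).symm, by simp; omega⟩
  have hQ : Q.length = m := by have := congrArg List.length hPQ; simp at this; omega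
  rw [hinv, hPQ] at h1
  simp only [List.map_append, List.reverse_append] at h1
  -- Comparing second halves shows that `Q` is the exchanged inverse of `P`, so `P` spells the
  -- required `v`.
  obtain ⟨-, h3⟩ := List.append_inj h1 (by simp [hP, hQ])
  refine ⟨FreeGroup.mk P, ?_⟩
  rw [hw, hPQ, ← FreeGroup.mul_mk, flipAut_mk, FreeGroup.inv_mk]
  congr 1
  have h4 : FreeGroup.invRev (P.map f) = (Q.map f |>.map f) := by
    rw [h3]
    simp [FreeGroup.invRev, Function.comp_def, hf]
  rw [show (P.map fun x => ((x.1.1, !x.1.2), x.2)) = P.map f from rfl, h4, List.map_map]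
  congr 1
  conv_lhs => rw [← List.map_id Q]
  congr 1
  ext x <;> simp [hf]

/-- The exchange maps reduced words to reduced words and alters every letter, so a fixed reduced
word has no first letter. -/
theorem eq_one_of_flip_eq {f : FreeGroup (A × Bool)} (h : flipAut A f = f) : f = 1 := by
  classical
  have hw : f = FreeGroup.mk f.toWord := FreeGroup.mk_toWord.symm
  rw [hw, flipAut_mk] at h
  have h4 := FreeGroup.reduce.sound h
  have h5 : FreeGroup.IsReduced f.toWord := FreeGroup.isReduced_toWord
  have h6 : FreeGroup.IsReduced (f.toWord.map fun x => ((x.1.1, !x.1.2), x.2)) := by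
    unfold FreeGroup.IsReduced at h5 ⊢
    rw [List.isChain_map]
    refine h5.imp ?_
    rintro ⟨⟨a, b⟩, c⟩ ⟨⟨a', b'⟩, c'⟩; simp
  rw [h6.reduce_eq, h5.reduce_eq] at h4
  rcases hL : f.toWord with _ | ⟨⟨⟨a, s⟩, b⟩, l⟩
  · rw [hw, hL]; rfl
  · rw [hL] at h4; simp at h4

/-- An involution outside the free group commutes with no nontrivial element of it. -/
theorem SwapGroup.eq_one_of_commute {t f : SwapGroup A} (ht : t.right ≠ 1) (htt : t * t = 1)
    (hf : f.right = 1) (h : t * f = f * t) : f = 1 := by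
  obtain ⟨w, r⟩ := t
  obtain ⟨f, r'⟩ := f
  obtain rfl : r = flipGen := (eq_one_or_flipGen r).resolve_left ht
  obtain rfl : r' = 1 := hf
  have h1 : w * flipAut A w = 1 := congrArg SemidirectProduct.left htt
  have h2 : w * flipAut A f = f * w := by
    have := congrArg SemidirectProduct.left h
    simpa [flipGen] using this
  -- The involution is now the conjugate by `v` of the exchange, so `v⁻¹ * f * v` is fixed by the
  -- exchange.
  obtain ⟨v, rfl⟩ := exists_eq_mul_flip_inv h1
  have h3 : flipAut A (v⁻¹ * f * v) = v⁻¹ * f * v := by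
    rw [map_mul, map_mul, map_inv]
    calc _ = v⁻¹ * (v * ((flipAut A) v)⁻¹ * (flipAut A) f) * (flipAut A) v := by group
      _ = _ := by rw [h2]; group
  have h4 := eq_one_of_flip_eq h3
  have : f = 1 := by
    have h5 : f = v * (v⁻¹ * f * v) * v⁻¹ := by group
    rw [h5, h4]; group
  subst this; rfl

theorem SwapGroup.eq_inl {f : SwapGroup A} (h : f.right = 1) :
    f = SemidirectProduct.inl f.left := by
  ext1 <;> simp [h]

theorem SwapGroup.eq_of_pow_eq {x y : SwapGroup A} (hx : x.right = 1) (hy : y.right = 1) {n : ℕ}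
    (hn : n ≠ 0) (h : x ^ n = y ^ n) : x = y := by
  rw [eq_inl hx, eq_inl hy, ← map_pow, ← map_pow] at h
  rw [eq_inl hx, eq_inl hy, pow_left_injective hn (SemidirectProduct.inl_injective h)]

/-- Keeping the root inside the closure of `{x, y}` allows it to be pulled back along an embedding
whose image contains `x` and `y`. -/
theorem SwapGroup.exists_mem_zpowers_of_commute {x y : SwapGroup A} (hx : x.right = 1)
    (hy : y.right = 1) (h : x * y = y * x) :
    ∃ u ∈ Subgroup.closure {x, y}, x ∈ Subgroup.zpowers u ∧ y ∈ Subgroup.zpowers u := by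
  rw [eq_inl hx, eq_inl hy, ← map_mul, ← map_mul] at h
  obtain ⟨u, hu, ⟨a, ha⟩, ⟨b, hb⟩⟩ :=
    FreeGroup.exists_mem_zpowers_of_commute (SemidirectProduct.inl_injective h)
  refine ⟨SemidirectProduct.inl u, ?_, ⟨a, ?_⟩, ⟨b, ?_⟩⟩
  · have := Subgroup.mem_map_of_mem
      (SemidirectProduct.inl : FreeGroup (A × Bool) →* SwapGroup A) hu
    rwa [MonoidHom.map_closure, Set.image_pair, ← eq_inl hx, ← eq_inl hy] at this
  · simp only [← map_zpow] at ha ⊢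
    rw [ha, ← eq_inl hx]
  · simp only [← map_zpow] at hb ⊢
    rw [hb, ← eq_inl hy]

end SwapGroup

/-! ## Primitive elements of a subgroup of index two -/

/-- `g` is a primitive element of the subgroup `K`. -/
def PrimIn {G : Type*} [Group G] (K : Subgroup G) (g : G) : Prop :=
  g ∈ K ∧ ¬ IsOfFinOrder g ∧ ∀ h ∈ K, g ∈ Subgroup.zpowers h → h ∈ Subgroup.zpowers g

theorem primIn_top_iff {G : Type*} [Group G] {g : G} : PrimIn ⊤ g ↔ IsPrimitiveElt g := by
  simp [PrimIn, IsPrimitiveElt, Subgroup.zpowers_le]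

theorem zpow_right_cancel {G : Type*} [Group G] {g : G} (h : ¬ IsOfFinOrder g) {m n : ℤ}
    (e : g ^ m = g ^ n) : m = n := injective_zpow_iff_not_isOfFinOrder.2 h e

section

variable {G : Type*} [Group G] {K : Subgroup G}

theorem primIn_of_primIn_top {c : G} (h : PrimIn ⊤ c) (hc : c ∈ K) : PrimIn K c :=
  ⟨hc, h.2.1, fun x _ hx => h.2.2 x trivial hx⟩

/-- Otherwise α would be a power of α², and parity of exponents forbids this in infinite order. -/
theorem notMem_of_primIn_sq {α : G} (h : PrimIn K (α ^ 2)) : α ∉ K := fun hα => by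
  obtain ⟨n, hn⟩ := h.2.2 α hα ⟨2, zpow_ofNat α 2⟩
  change (α ^ 2) ^ n = α at hn
  have h1 : α ^ (2 * n) = α ^ (1 : ℤ) := by rw [zpow_mul, zpow_one, zpow_ofNat]; exact hn
  have := zpow_right_cancel (fun hf => h.2.1 hf.pow) h1
  omega

/-- A root of `c` outside `K` would itself be an outside element commuting with `c`. -/
theorem primIn_top_of_forall_conj_ne {c : G} (hc : PrimIn K c) (h : ∀ g ∉ K, g * c * g⁻¹ ≠ c) :
    PrimIn ⊤ c := by
  refine ⟨trivial, hc.2.1, fun β _ hβ => ?_⟩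
  by_cases hb : β ∈ K
  · exact hc.2.2 β hb hβ
  · obtain ⟨m, rfl⟩ := hβ
    refine absurd ?_ (h β hb)
    change β * β ^ m * β⁻¹ = β ^ m
    group

end

/-- The subgroup `K` of index two is torsion-free with unique roots, its commuting elements have
common roots, and the involutions outside of it commute with no nontrivial element of it. -/
structure IsOrbifoldPair {G : Type*} [Group G] (K : Subgroup G) : Prop where
  mul_mem : ∀ x ∉ K, ∀ y ∉ K, x * y ∈ K
  exists_notMem : ∃ x, x ∉ K
  pow_inj : ∀ x ∈ K, ∀ y ∈ K, ∀ n : ℕ, n ≠ 0 → x ^ n = y ^ n → x = y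
  common_root : ∀ x ∈ K, ∀ y ∈ K, x * y = y * x →
    ∃ u ∈ K, x ∈ Subgroup.zpowers u ∧ y ∈ Subgroup.zpowers u
  involution : ∀ t ∉ K, t * t = 1 → ∀ f ∈ K, t * f = f * t → f = 1

namespace IsOrbifoldPair

variable {G : Type*} [Group G] {K : Subgroup G} (hK : IsOrbifoldPair K)
include hK

theorem conj_mem {x : G} (hx : x ∈ K) (g : G) : g * x * g⁻¹ ∈ K := by
  by_cases hg : g ∈ K
  · exact K.mul_mem (K.mul_mem hg hx) (K.inv_mem hg)
  · by_contra h
    have := hK.mul_mem _ h _ hg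
    rw [inv_mul_cancel_right] at this
    exact hg ((K.mul_mem_cancel_right hx).1 this)

theorem normal : K.Normal := ⟨fun _ hx g => hK.conj_mem hx g⟩

theorem sq_mem (g : G) : g * g ∈ K := by
  by_cases hg : g ∈ K
  · exact K.mul_mem hg hg
  · exact hK.mul_mem _ hg _ hg

theorem zpow_inj {x y : G} (hx : x ∈ K) (hy : y ∈ K) {n : ℤ} (hn : n ≠ 0) (h : x ^ n = y ^ n) :
    x = y := by
  rcases Int.natAbs_eq n with e | e
  · rw [e, zpow_natCast, zpow_natCast] at h
    exact hK.pow_inj x hx y hy _ (by omega) h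
  · rw [e, zpow_neg, zpow_neg, inv_inj, zpow_natCast, zpow_natCast] at h
    exact hK.pow_inj x hx y hy _ (by omega) h

/-- The conjugate of `x` by `g` has the same `n`-th power as `x`, so unique roots identify the two.
-/
theorem commute_of_zpow {g x : G} (hx : x ∈ K) {n : ℤ} (hn : n ≠ 0)
    (h : g * x ^ n = x ^ n * g) : g * x = x * g := by
  have := hK.zpow_inj (hK.conj_mem hx g) hx hn (by rw [conj_zpow, h, mul_inv_cancel_right])
  nth_rewrite 2 [← this]
  group

/-- The square of `h` commutes with `f`, hence so does `h` by unique roots. Then `f = f⁻¹`, and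
torsion-freeness of `K` ends the proof. -/
theorem eq_one_of_conj_eq_inv {h f : G} (hh : h ∈ K) (hf : f ∈ K) (e : h * f * h⁻¹ = f⁻¹) :
    f = 1 := by
  have e' : h * f = f⁻¹ * h := by rw [← e]; group
  have h1 : f * h ^ (2 : ℤ) = h ^ (2 : ℤ) * f := by
    have e2 : h * f⁻¹ = f * h := by
      have := congrArg (fun t => f * t * f⁻¹) e'
      simpa [mul_assoc] using this.symm
    rw [zpow_ofNat, pow_two, ← mul_assoc, ← e2, mul_assoc, ← e', mul_assoc]
  have h2 := hK.commute_of_zpow hh two_ne_zero h1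
  rw [← h2] at e'
  have h3 : f = f⁻¹ := mul_right_cancel e'
  refine hK.pow_inj f hf 1 K.one_mem 2 two_ne_zero ?_
  rw [pow_two, one_pow]
  nth_rewrite 2 [h3]
  exact mul_inv_cancel f

/-- A common root of `c` and `y` is a power of `c` because `c` is primitive: the centraliser of `c`
in `K` is cyclic. -/
theorem mem_zpowers_of_commute {c y : G} (hc : PrimIn K c) (hy : y ∈ K) (h : c * y = y * c) :
    y ∈ Subgroup.zpowers c := by
  obtain ⟨u, hu, h1, h2⟩ := hK.common_root c hc.1 y hy h
  exact Subgroup.zpowers_le.2 (hc.2.2 u hu h1) h2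

/-- The square of `g` lies in `K` and commutes with `c`, so it is a power of `c`; correcting `g` by
a power of `c` reduces that exponent to 0 or 1. -/
theorem exists_sq_eq {c g : G} (hc : PrimIn K c) (hg : g ∉ K) (h : g * c = c * g) :
    ∃ α ∉ K, PrimIn ⊤ α ∧ α ^ 2 = c := by
  have hgc : Commute g c := h
  obtain ⟨k, hk⟩ := hK.mem_zpowers_of_commute hc (hK.sq_mem g)
    (hgc.mul_left hgc).symm
  obtain ⟨α, hα, hαc, h2⟩ : ∃ α ∉ K, α * c = c * α ∧ α ^ 2 = c := by
    -- For even `k` the corrected element is an outside involution centralising `c`, which is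
    -- impossible. For odd `k` it is the required square root.
    rcases Int.even_or_odd' k with ⟨m, rfl | rfl⟩
    · exfalso
      have h1 : g * c ^ (-m) ∉ K := by
        rwa [K.mul_mem_cancel_right (K.zpow_mem hc.1 _)]
      have h3 : Commute (g * c ^ (-m)) c :=
        Commute.mul_left h ((Commute.refl c).zpow_left _)
      refine hc.2.1 ?_
      rw [hK.involution _ h1 ?_ c hc.1 h3]
      · exact IsOfFinOrder.one
      · have : (g * c ^ (-m)) * (g * c ^ (-m)) = g * g * c ^ (-(2 * m)) := by
          rw [mul_assoc, ← mul_assoc (c ^ (-m)), ← (hgc.zpow_right (-m)).eq, mul_assoc, ← zpow_add,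
            ← mul_assoc]
          congr 2; ring
        rw [this, ← hk]; simp
    · refine ⟨g * c ^ (-m), by rwa [K.mul_mem_cancel_right (K.zpow_mem hc.1 _)],
        Commute.mul_left h ((Commute.refl c).zpow_left _), ?_⟩
      have : (g * c ^ (-m)) ^ 2 = g * g * c ^ (-(2 * m)) := by
        rw [pow_two, mul_assoc, ← mul_assoc (c ^ (-m)), ← (hgc.zpow_right (-m)).eq, mul_assoc,
          ← zpow_add, ← mul_assoc]
        congr 2; ring
      rw [this, ← hk]
      simp only [← zpow_add]
      simp
  refine ⟨α, hα, ⟨trivial, fun hf => hc.2.1 (h2 ▸ hf.pow), ?_⟩, h2⟩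
  rintro β - ⟨m, rfl⟩
  simp only at *
  have hβ : β ∉ K := fun hb => hα (K.zpow_mem hb m)
  have hβc : c = (β * β) ^ m := by
    rw [← h2, ← pow_two, ← zpow_ofNat, ← zpow_ofNat, ← zpow_mul, ← zpow_mul, mul_comm]
  -- A root β of α lies outside `K`, but β² lies in `K` and is a root of `c`, so primitivity of `c`
  -- applies to it; exponents then give `m * j = 1`.
  obtain ⟨j, hj⟩ := hc.2.2 (β * β) (hK.sq_mem β) ⟨m, hβc.symm⟩
  have hbf : ¬ IsOfFinOrder β := fun hb => hc.2.1 (hβc ▸ (by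
    rw [← pow_two, ← zpow_natCast, ← zpow_mul]; exact hb.zpow))
  have h5 : β ^ (2 * (m * j)) = β ^ (2 : ℤ) := by
    rw [zpow_mul, zpow_mul, zpow_ofNat, pow_two, ← hβc]; exact hj
  have h6 := zpow_right_cancel hbf h5
  refine ⟨j, ?_⟩
  change (β ^ m) ^ j = β
  rw [← zpow_mul, show m * j = 1 by linarith, zpow_one]

/-- If an element of `K` inverts `c` then `c = 1`, and every outside element serves as well. -/
theorem exists_conj_eq_inv_iff {c : G} (hc : c ∈ K) :
    (∃ g ∉ K, g * c * g⁻¹ = c⁻¹) ↔ ∃ g, g * c * g⁻¹ = c⁻¹ := by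
  refine ⟨fun ⟨g, _, h⟩ => ⟨g, h⟩, fun ⟨g, h⟩ => ?_⟩
  by_cases hg : g ∈ K
  · obtain ⟨x, hx⟩ := hK.exists_notMem
    exact ⟨x, hx, by rw [hK.eq_one_of_conj_eq_inv hg hc h]; simp⟩
  · exact ⟨g, hg, h⟩

/-- An outside root β of `c` would commute with `c`, so `g * β`, an element of `K`, would also
invert `c` and force `c = 1`. -/
theorem primIn_iff_of_conj_eq_inv {c g : G} (hc : c ∈ K) (hg : g ∉ K) (h : g * c * g⁻¹ = c⁻¹) :
    PrimIn K c ↔ PrimIn ⊤ c := by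
  refine ⟨fun hp => ⟨trivial, hp.2.1, fun β _ hβ => ?_⟩, fun hp => primIn_of_primIn_top hp hc⟩
  by_cases hb : β ∈ K
  · exact hp.2.2 β hb hβ
  · exfalso
    obtain ⟨m, rfl⟩ := hβ
    refine hp.2.1 ?_
    rw [hK.eq_one_of_conj_eq_inv (hK.mul_mem _ hg _ hb) hc]
    · exact IsOfFinOrder.one
    · rw [← h]
      change g * β * β ^ m * (g * β)⁻¹ = g * β ^ m * g⁻¹
      group

/-- If `β ^ m = α ^ 2` with β in `K`, then α commutes with β by unique roots. For `m = 2 * j`, the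
element `α * β ^ (-j)` is an outside involution centralising β, which is excluded. For `m = 2 * j +
1`, its square is β and its `m`-th power is α, so it is a power of α and β is a power of α². -/
theorem primIn_sq {α : G} (h : PrimIn ⊤ α) (hα : α ∉ K) : PrimIn K (α ^ 2) := by
  refine ⟨pow_two α ▸ hK.sq_mem α, fun hf => h.2.1 (hf.of_pow two_ne_zero), ?_⟩
  rintro β hβ ⟨m, hm⟩
  change β ^ m = α ^ 2 at hm
  have hm0 : m ≠ 0 := by
    rintro rfl
    exact h.2.1 (isOfFinOrder_iff_pow_eq_one.2 ⟨2, two_pos, by rw [← hm, zpow_zero]⟩)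
  have hc : Commute α β := hK.commute_of_zpow hβ hm0 (by rw [hm]; exact (pow_mul_comm' α 2).symm)
  have hcalc : ∀ j : ℤ, (α * β ^ (-j)) ^ 2 = β ^ (m - 2 * j) := fun j => by
    rw [(hc.zpow_right (-j)).mul_pow, ← hm, ← zpow_natCast (β ^ (-j)), ← zpow_mul, ← zpow_add]
    congr 1; push_cast; ring
  rcases Int.even_or_odd' m with ⟨j, rfl | rfl⟩
  · exfalso
    have h1 : α * β ^ (-j) ∉ K := by rwa [K.mul_mem_cancel_right (K.zpow_mem hβ _)]
    have hb1 : β = 1 := hK.involution _ h1 (by rw [← pow_two, hcalc]; simp) β hβ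
      (Commute.mul_left hc ((Commute.refl β).zpow_left _))
    refine h.2.1 (isOfFinOrder_iff_pow_eq_one.2 ⟨2, two_pos, by rw [← hm, hb1, one_zpow]⟩)
  · have h2 := hcalc j
    rw [show 2 * j + 1 - 2 * j = 1 by ring, zpow_one] at h2
    have h3 : (α * β ^ (-j)) ^ (2 * j + 1) = α := by
      rw [zpow_add, zpow_mul, zpow_ofNat, h2, zpow_one, ← mul_assoc,
        (hc.zpow_right j).symm.eq, mul_assoc, ← zpow_add]
      simp
    obtain ⟨i, hi⟩ := h.2.2 (α * β ^ (-j)) trivial ⟨2 * j + 1, h3⟩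
    refine ⟨i, ?_⟩
    change α ^ i = _ at hi
    change (α ^ 2) ^ i = β
    rw [← h2, ← hi, ← zpow_natCast, ← zpow_natCast, ← zpow_mul, ← zpow_mul, mul_comm]

/-- The nontrivial element c² of `K` is inverted by `g`, and also by `g * c`. Neither may lie in
`K`, which leaves only `c` in `K` and `g` outside. -/
theorem mem_of_conj_eq_inv {c g : G} (hc : ¬ IsOfFinOrder c) (h : g * c * g⁻¹ = c⁻¹) :
    c ∈ K ∧ g ∉ K := by
  have h2 : g * (c * c) * g⁻¹ = (c * c)⁻¹ := by
    rw [mul_inv_rev, ← h]; group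
  have hcc : c * c ≠ 1 := fun e =>
    hc (isOfFinOrder_iff_pow_eq_one.2 ⟨2, two_pos, by rw [pow_two, e]⟩)
  have hg : g ∉ K := fun hg => hcc (hK.eq_one_of_conj_eq_inv hg (hK.sq_mem c) h2)
  refine ⟨?_, hg⟩
  by_contra hcK
  refine hcc (hK.eq_one_of_conj_eq_inv (hK.mul_mem _ hg _ hcK) (hK.sq_mem c) ?_)
  rw [← h2]; group

/-- If `g` commuted with `c`, then `c` would be the square of an outside element, which primitivity
in the whole group would place in ⟨c⟩ and so in `K`. -/
theorem conj_ne_of_primIn_top {c g : G} (hp : PrimIn ⊤ c) (hc : c ∈ K) (hg : g ∉ K) :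
    g * c * g⁻¹ ≠ c := fun h => by
  obtain ⟨α, hα, -, rfl⟩ := hK.exists_sq_eq (primIn_of_primIn_top hp hc) hg
    (by nth_rewrite 2 [← h]; group)
  exact hα (Subgroup.zpowers_le.2 hc (hp.2.2 α trivial ⟨2, zpow_ofNat α 2⟩))

/-- The quotient αβ⁻¹ lies in `K` and commutes with α², so it is a power `(α ^ 2) ^ j`. Squaring `α
= (α ^ 2) ^ j * β` gives `2 * j + 1 = 1`. -/
theorem eq_of_sq_eq {α β : G} (hα : α ∉ K) (hβ : β ∉ K) (h : α ^ 2 = β ^ 2)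
    (hp : PrimIn K (α ^ 2)) : α = β := by
  have hcα : Commute (α ^ 2) α := Commute.pow_self α 2
  have hcβ : Commute (α ^ 2) β := h ▸ Commute.pow_self β 2
  have hβ' : β⁻¹ ∉ K := by simpa using hβ
  obtain ⟨j, hj⟩ := hK.mem_zpowers_of_commute hp (hK.mul_mem _ hα _ hβ')
    (hcα.mul_right hcβ.inv_right)
  change (α ^ 2) ^ j = α * β⁻¹ at hj
  have h1 : α = (α ^ 2) ^ j * β := by rw [hj]; group
  have h2 : α ^ 2 = (α ^ 2) ^ (2 * j + 1) := by
    conv_lhs => rw [h1, ((hcβ.zpow_left j).mul_pow 2), ← h]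
    rw [zpow_add, zpow_one, mul_comm 2 j, zpow_mul, zpow_ofNat]
  have h3 : (1 : ℤ) = 2 * j + 1 := zpow_right_cancel hp.2.1 (by rw [zpow_one]; exact h2)
  obtain rfl : j = 0 := by omega
  rw [h1, zpow_zero, one_mul]

end IsOrbifoldPair

/-! ## Points of glued triangles -/

/-- The points of a disjoint union of triangles. -/
abbrev TriPoint (I : Type) := Σ _ : I, ClosedTriangle

theorem Fin.eq_or_of_three : ∀ j c : Fin 3, c = j ∨ c = j + 1 ∨ c = j + 2 := by decide

namespace ClosedTriangle

/-- The point dividing the segment from `x` to `y` in the ratio `s : 1 - s`. -/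
noncomputable def mix (s : unitInterval) (x y : ClosedTriangle) : ClosedTriangle :=
  ⟨fun c => (1 - s) * x.1 c + s * y.1 c, fun c =>
    add_nonneg (mul_nonneg (by linarith [s.2.2]) (x.2.1 c)) (mul_nonneg s.2.1 (y.2.1 c)), by
    rw [Finset.sum_add_distrib, ← Finset.mul_sum, ← Finset.mul_sum, x.2.2, y.2.2]; ring⟩

theorem mix_apply (s : unitInterval) (x y : ClosedTriangle) (c : Fin 3) :
    (mix s x y).1 c = (1 - s) * x.1 c + s * y.1 c := rfl

@[simp] theorem mix_zero (x y : ClosedTriangle) : mix 0 x y = x := by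
  ext c; change (mix 0 x y).1 c = x.1 c; simp [mix_apply]

@[simp] theorem mix_one (x y : ClosedTriangle) : mix 1 x y = y := by
  ext c; change (mix 1 x y).1 c = y.1 c; simp [mix_apply]

@[simp] theorem mix_self (s : unitInterval) (x : ClosedTriangle) : mix s x x = x := by
  ext c; change (mix s x x).1 c = x.1 c; rw [mix_apply]; ring

@[fun_prop]
theorem continuous_mix {W : Type*} [TopologicalSpace W] {s : W → unitInterval}
    {x y : W → ClosedTriangle} (hs : Continuous s) (hx : Continuous x) (hy : Continuous y) :
    Continuous fun w => mix (s w) (x w) (y w) := by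
  refine Continuous.subtype_mk (continuous_pi fun c => ?_) _
  have h1 : Continuous fun w => (x w).1 c := (continuous_apply c).comp
    (continuous_subtype_val.comp hx)
  have h2 : Continuous fun w => (y w).1 c := (continuous_apply c).comp
    (continuous_subtype_val.comp hy)
  have h3 : Continuous fun w => (s w : ℝ) := continuous_subtype_val.comp hs
  fun_prop

theorem apply_le_one (x : ClosedTriangle) (c : Fin 3) : x.1 c ≤ 1 := by
  rw [← x.2.2]
  exact Finset.single_le_sum (fun i _ => x.2.1 i) (Finset.mem_univ c)

theorem sum_eq (x : ClosedTriangle) (i : Fin 3) : x.1 i + x.1 (i + 1) + x.1 (i + 2) = 1 := by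
  have := x.2.2
  rw [Fin.sum_univ_three] at this
  fin_cases i
  · exact this
  · change x.1 1 + x.1 2 + x.1 0 = 1; linarith
  · change x.1 2 + x.1 0 + x.1 1 = 1; linarith

theorem eq_vertex_iff {x : ClosedTriangle} {i : Fin 3} : x = triangleVertex i ↔ x.1 i = 1 := by
  refine ⟨fun h => by rw [h]; simp [triangleVertex], fun h => ?_⟩
  have h1 := sum_eq x i
  have h2 := x.2.1 (i + 1)
  have h3 := x.2.1 (i + 2)
  ext c
  change x.1 c = (Pi.single i 1 : Fin 3 → ℝ) c
  rcases Fin.eq_or_of_three i c with rfl | rfl | rfl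
  · simp [h]
  · rw [Pi.single_eq_of_ne (by simp)]; linarith
  · rw [Pi.single_eq_of_ne (by simp)]; linarith

/-- Vertices are extreme points of the triangle. Hence segments between points that are not removed
never meet a removed vertex. -/
theorem mix_eq_vertex {s : unitInterval} {x y : ClosedTriangle} {i : Fin 3}
    (h : mix s x y = triangleVertex i) : mix s x y = x ∨ mix s x y = y := by
  have h1 := eq_vertex_iff.1 h
  rw [mix_apply] at h1
  by_cases hs : (s : ℝ) = 1
  · right; rw [show s = 1 from Subtype.ext hs, mix_one]
  · left
    have hs' : (s : ℝ) < 1 := lt_of_le_of_ne s.2.2 hs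
    have hx : x.1 i = 1 := by nlinarith [apply_le_one x i, apply_le_one y i, s.2.1]
    rw [h, eq_comm, eq_vertex_iff, hx]

/-- The point of the side `j` matched with the point `x` of the side `i`. -/
theorem exists_sideMatch {i j : Fin 3} {x : ClosedTriangle} (h : x.1 i = 0) :
    ∃ y, SideMatch i j x y := by
  have hs := sum_eq x i
  have e1 : j + 1 ≠ j := by simp
  have e2 : j + 2 ≠ j := by simp
  have e3 : j + 2 ≠ j + 1 := by simp
  refine ⟨⟨fun c => if c = j then 0 else if c = j + 1 then x.1 (i + 2) else x.1 (i + 1),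
    fun c => ?_, ?_⟩, h, ?_, ?_, ?_⟩
  · dsimp only
    split_ifs
    exacts [le_rfl, x.2.1 _, x.2.1 _]
  · rw [h, zero_add, add_comm] at hs
    rw [Fin.sum_univ_three, ← hs]
    fin_cases j <;> simp [add_comm]
  · simp
  · simp
  · simp

end ClosedTriangle

theorem SideMatch.symm {i j : Fin 3} {x y : ClosedTriangle} (h : SideMatch i j x y) :
    SideMatch j i y x := ⟨h.2.1, h.1, h.2.2.2.symm, h.2.2.1.symm⟩

theorem SideMatch.mix {i j : Fin 3} {x y x' y' : ClosedTriangle} (h : SideMatch i j x y)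
    (h' : SideMatch i j x' y') (s : unitInterval) :
    SideMatch i j (ClosedTriangle.mix s x x') (ClosedTriangle.mix s y y') := by
  simp only [SideMatch, ClosedTriangle.mix_apply, h.1, h'.1, h.2.1, h'.2.1, h.2.2.1, h'.2.2.1,
    h.2.2.2, h'.2.2.2]
  simp

/-- Matched points have the same coordinates up to a permutation depending only on the two sides, so
coordinatewise relations between two points are carried across a side. -/
theorem SideMatch.forall_right {i j : Fin 3} {x y x' y' : ClosedTriangle} (h : SideMatch i j x y)
    (h' : SideMatch i j x' y') {p : ℝ → ℝ → Prop} (hp : ∀ c, p (x.1 c) (x'.1 c)) (c : Fin 3) :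
    p (y.1 c) (y'.1 c) := by
  rcases Fin.eq_or_of_three j c with rfl | rfl | rfl
  · have hi := hp i
    have h1 : x.1 i = y.1 c := h.1.trans h.2.1.symm
    have h2 : x'.1 i = y'.1 c := h'.1.trans h'.2.1.symm
    rwa [h1, h2] at hi
  · rw [← h.2.2.2, ← h'.2.2.2]; exact hp _
  · rw [← h.2.2.1, ← h'.2.2.1]; exact hp _

section Gluing

variable {I : Type} {pair : I × Fin 3 → I × Fin 3}

/-- The points `a` and `b` are matched along the side `i` of the triangle of `a` and the side `j`
of the triangle of `b`. -/
def SideStep (pair : I × Fin 3 → I × Fin 3) (i j : Fin 3) (a b : TriPoint I) : Prop :=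
  pair (a.1, i) = (b.1, j) ∧ (a.1, i) ≠ (b.1, j) ∧ SideMatch i j a.2 b.2

theorem SideStep.glue {i j : Fin 3} {a b : TriPoint I} (h : SideStep pair i j a b) :
    SideGlue pair a b := ⟨i, j, h⟩

theorem SideStep.symm (hp : Function.Involutive pair) {i j : Fin 3} {a b : TriPoint I}
    (h : SideStep pair i j a b) : SideStep pair j i b a :=
  ⟨by rw [← h.1, hp], h.2.1.symm, h.2.2.symm⟩

theorem SideGlue.symm (hp : Function.Involutive pair) {a b : TriPoint I}
    (h : SideGlue pair a b) : SideGlue pair b a := by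
  obtain ⟨i, j, h⟩ := h
  exact SideStep.glue (SideStep.symm hp h)

theorem reflTransGen_of_eqvGen (hp : Function.Involutive pair) {a b : TriPoint I}
    (h : Relation.EqvGen (SideGlue pair) a b) : Relation.ReflTransGen (SideGlue pair) a b := by
  induction h with
  | rel a b h => exact .single h
  | refl a => exact .refl
  | symm a b _ ih =>
    have : Std.Symm (SideGlue pair) := ⟨fun _ _ => SideGlue.symm hp⟩
    exact Relation.ReflTransGen.stdSymm.symm _ _ ih
  | trans a b c _ _ h1 h2 => exact h1.trans h2

/-- A property kept by gluing is a property of the classes of glued points. -/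
theorem eqvGen_iff_of_glue {p : TriPoint I → Prop}
    (h : ∀ a b, SideGlue pair a b → (p a ↔ p b)) {a b : TriPoint I}
    (hab : Relation.EqvGen (SideGlue pair) a b) : p a ↔ p b := by
  induction hab with
  | rel a b h' => exact h a b h'
  | refl a => rfl
  | symm a b _ ih => exact ih.symm
  | trans a b c _ _ h1 h2 => exact h1.trans h2

/-- Two points of one triangle that differ by less than `ε` in each coordinate. -/
def Near (ε : ℝ) (a b : TriPoint I) : Prop := a.1 = b.1 ∧ ∀ c, |a.2.1 c - b.2.1 c| < ε

/-- The points of a segment. -/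
noncomputable def mixPt (s : unitInterval) (a b : TriPoint I) : TriPoint I :=
  ⟨a.1, ClosedTriangle.mix s a.2 b.2⟩

/-- Two pairs of points of triangles are matched along the same sides. -/
def PairStep (pair : I × Fin 3 → I × Fin 3) (p q : TriPoint I × TriPoint I) : Prop :=
  ∃ i j, SideStep pair i j p.1 q.1 ∧ SideStep pair i j p.2 q.2

theorem PairStep.mixPt {a b a' b' : TriPoint I} (h : PairStep pair (a, b) (a', b'))
    (s : unitInterval) : SideGlue pair (mixPt s a b) (mixPt s a' b') := by
  obtain ⟨i, j, h1, h2⟩ := h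
  exact ⟨i, j, h1.1, h1.2.1, h1.2.2.mix h2.2.2 s⟩

theorem PairStep.near {ε : ℝ} {a b a' b' : TriPoint I} (h : PairStep pair (a, b) (a', b'))
    (hn : Near ε a b) : Near ε a' b' := by
  obtain ⟨i, j, h1, h2⟩ := h
  refine ⟨?_, h1.2.2.forall_right h2.2.2 (p := fun u v => |u - v| < ε) hn.2⟩
  have h3 := h1.1
  have h4 := h2.1
  simp only [hn.1] at h3 h4
  exact congrArg Prod.fst (h3.symm.trans h4)

/-- `ε` is the radius of a conic neighbourhood of the class of `b₀`. -/
structure IsConeRadius (pair : I × Fin 3 → I × Fin 3) (b₀ : TriPoint I) (ε : ℝ) : Prop where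
  pos : 0 < ε
  coord : ∀ b, Relation.EqvGen (SideGlue pair) b₀ b → ∀ c, b.2.1 c = 0 ∨ 2 * ε ≤ b.2.1 c
  separated : ∀ b b', Relation.EqvGen (SideGlue pair) b₀ b → Relation.EqvGen (SideGlue pair) b₀ b' →
    Near (2 * ε) b b' → b = b'

/-- Gluing only permutes the coordinates, so all points of the class have coordinates in one finite
set, whatever the size of the class; twice the radius is a lower bound for the gaps of this set. -/
theorem exists_isConeRadius (pair : I × Fin 3 → I × Fin 3) (b₀ : TriPoint I) :
    ∃ ε, IsConeRadius pair b₀ ε := by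
  set V : Set ℝ := insert 0 (Set.range b₀.2.1)
  have hV : V.Finite := (Set.finite_range _).insert 0
  have hcl : ∀ b, Relation.EqvGen (SideGlue pair) b₀ b → ∀ c, b.2.1 c ∈ V := fun b hb =>
    (eqvGen_iff_of_glue (p := fun b => ∀ c, b.2.1 c ∈ V) (by
      rintro a b ⟨i, j, -, -, h⟩
      exact ⟨fun hp => h.forall_right h (p := fun u _ => u ∈ V) hp,
        fun hp => h.symm.forall_right h.symm (p := fun u _ => u ∈ V) hp⟩) hb).1
      fun c => Or.inr ⟨c, rfl⟩
  obtain ⟨δ, hδ, hδV⟩ : ∃ δ > 0, ∀ u ∈ V, ∀ v ∈ V, u ≠ v → δ ≤ |u - v| := by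
    -- The element 1 only serves to make the set nonempty, so that it has a minimum.
    set E : Set ℝ := insert 1 ((fun p : ℝ × ℝ => |p.1 - p.2|) '' {p ∈ V ×ˢ V | p.1 ≠ p.2})
    have hE : E.Finite := (((hV.prod hV).subset (Set.sep_subset _ _)).image _).insert 1
    have hEne : hE.toFinset.Nonempty := ⟨1, by simp [E]⟩
    refine ⟨hE.toFinset.min' hEne, ?_, fun u hu v hv huv => Finset.min'_le _ _ ?_⟩
    · have := hE.toFinset.min'_mem hEne
      rw [hE.mem_toFinset] at this
      rcases this with h | ⟨p, hp, h⟩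
      · rw [h]; exact one_pos
      · rw [← h]; exact abs_pos.2 (sub_ne_zero.2 hp.2)
    · rw [hE.mem_toFinset]
      exact Or.inr ⟨(u, v), ⟨⟨hu, hv⟩, huv⟩, rfl⟩
  refine ⟨δ / 2, by positivity, fun b hb c => ?_, fun b b' hb hb' hn => ?_⟩
  · by_cases h : b.2.1 c = 0
    · exact Or.inl h
    · right
      have := hδV _ (hcl b hb c) 0 (Or.inl rfl) h
      rw [sub_zero, abs_of_nonneg (b.2.2.1 c)] at this
      linarith
  · obtain ⟨t, x⟩ := b
    obtain ⟨t', x'⟩ := b'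
    obtain ⟨rfl, hn⟩ := hn
    have : x = x' := by
      ext c
      by_contra h
      have h1 := hδV _ (hcl _ hb c) _ (hcl _ hb' c) h
      have h2 := hn c
      simp only at h1 h2
      linarith
    rw [this]

theorem Near.mono {ε δ : ℝ} {a b : TriPoint I} (h : Near ε a b) (hδ : ε ≤ δ) : Near δ a b :=
  ⟨h.1, fun c => (h.2 c).trans_le hδ⟩

theorem Near.trans {ε δ : ℝ} {a b d : TriPoint I} (h : Near ε a b) (h' : Near δ b d) :
    Near (ε + δ) a d :=
  ⟨h.1.trans h'.1, fun c => (abs_sub_le _ _ _).trans_lt (add_lt_add (h.2 c) (h'.2 c))⟩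

theorem Near.symm {ε : ℝ} {a b : TriPoint I} (h : Near ε a b) : Near ε b a :=
  ⟨h.1.symm, fun c => by rw [abs_sub_comm]; exact h.2 c⟩

theorem Near.refl {ε : ℝ} (h : 0 < ε) (a : TriPoint I) : Near ε a a := ⟨rfl, fun c => by simpa⟩

theorem IsConeRadius.eq_of_near {b₀ b b' a : TriPoint I} {ε : ℝ} (h : IsConeRadius pair b₀ ε)
    (hb : Relation.EqvGen (SideGlue pair) b₀ b) (hb' : Relation.EqvGen (SideGlue pair) b₀ b')
    (hn : Near ε a b) (hn' : Near ε a b') : b = b' :=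
  h.separated b b' hb hb' (by rw [two_mul]; exact hn.symm.trans hn')

theorem eqvGen_of_pairSteps {p q : TriPoint I × TriPoint I}
    (h : Relation.ReflTransGen (PairStep pair) p q) :
    Relation.EqvGen (SideGlue pair) p.2 q.2 := by
  induction h with
  | refl => exact .refl _
  | tail _ h ih =>
    obtain ⟨i, j, -, h2⟩ := h
    exact ih.trans _ _ _ (.rel _ _ h2.glue)

theorem near_of_pairSteps {p q : TriPoint I × TriPoint I} {ε : ℝ}
    (h : Relation.ReflTransGen (PairStep pair) p q) (hn : Near ε p.1 p.2) : Near ε q.1 q.2 := by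
  induction h with
  | refl => exact hn
  | tail _ h ih => exact PairStep.near h ih

/-- Within the cone radius, a nearby point `a` can lie on a side only if the centre `b` does. Every
gluing of `a` therefore transports `b` along with it. -/
theorem exists_pairSteps (hp : Function.Involutive pair) {b₀ a b a' : TriPoint I} {ε : ℝ}
    (h : IsConeRadius pair b₀ ε) (hb : Relation.EqvGen (SideGlue pair) b₀ b) (hn : Near ε a b)
    (ha : Relation.EqvGen (SideGlue pair) a a') :
    ∃ b', Relation.ReflTransGen (PairStep pair) (a, b) (a', b') := by
  replace ha := reflTransGen_of_eqvGen hp ha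
  induction ha with
  | refl => exact ⟨b, .refl⟩
  | @tail d d' _ hdd ih =>
    obtain ⟨b', hb'⟩ := ih
    have hn' : Near ε d b' := near_of_pairSteps hb' hn
    have hbb : Relation.EqvGen (SideGlue pair) b₀ b' := hb.trans _ _ _ (eqvGen_of_pairSteps hb')
    obtain ⟨i, j, h1, h2, h3⟩ := hdd
    have hb0 : b'.2.1 i = 0 := by
      rcases h.coord b' hbb i with h4 | h4
      · exact h4
      · have h5 := hn'.2 i
        have h6 := h.pos
        rw [h3.1, zero_sub, abs_neg, abs_of_nonneg (b'.2.2.1 i)] at h5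
        linarith
    obtain ⟨y, hy⟩ := ClosedTriangle.exists_sideMatch (j := j) hb0
    refine ⟨⟨d'.1, y⟩, hb'.tail ⟨i, j, ⟨h1, h2, h3⟩, ?_, ?_, hy⟩⟩
    · rw [← h1]; simp only [hn'.1]
    · rw [← h1] at h2 ⊢; simp only [hn'.1] at h2 ⊢; exact h2

end Gluing

/-! ## Spaces glued from triangles -/

section Square

variable {X : Type*} [TopologicalSpace X]

/-- The two ways around a square are homotopic. -/
theorem Path.Homotopic.of_square (F : C(unitInterval × unitInterval, X)) {x y z w : X}
    (p : Path x y) (q : Path y w) (r : Path x z) (u : Path z w)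
    (hp : ∀ s, F (s, 0) = p s) (hq : ∀ t, F (1, t) = q t) (hr : ∀ t, F (0, t) = r t)
    (hu : ∀ s, F (s, 1) = u s) : (p.trans q).Homotopic (r.trans u) := by
  let p' : Path ((0, 0) : unitInterval × unitInterval) (1, 0) := ⟨⟨fun s => (s, 0), by fun_prop⟩, rfl, rfl⟩
  let q' : Path ((1, 0) : unitInterval × unitInterval) (1, 1) := ⟨⟨fun t => (1, t), by fun_prop⟩, rfl, rfl⟩
  let r' : Path ((0, 0) : unitInterval × unitInterval) (0, 1) := ⟨⟨fun t => (0, t), by fun_prop⟩, rfl, rfl⟩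
  let u' : Path ((0, 1) : unitInterval × unitInterval) (1, 1) := ⟨⟨fun s => (s, 1), by fun_prop⟩, rfl, rfl⟩
  have : ContractibleSpace unitInterval :=
    (convex_Icc (0 : ℝ) 1).contractibleSpace ⟨0, by simp⟩
  -- The square is contractible, so its two boundary routes are already homotopic there.
  have h : (p'.trans q').Homotopic (r'.trans u') := SimplyConnectedSpace.paths_homotopic _ _
  have h2 := h.map F
  rw [Path.map_trans, Path.map_trans] at h2
  obtain rfl : F (0, 0) = x := (hp 0).trans p.source
  obtain rfl : F (1, 0) = y := (hp 1).trans p.target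
  obtain rfl : F (1, 1) = w := (hq 1).trans q.target
  obtain rfl : F (0, 1) = z := (hr 1).trans r.target
  have e1 : p'.map F.continuous = p := Path.ext (funext hp)
  have e2 : q'.map F.continuous = q := Path.ext (funext hq)
  have e3 : r'.map F.continuous = r := Path.ext (funext hr)
  have e4 : u'.map F.continuous = u := Path.ext (funext hu)
  rwa [e1, e2, e3, e4] at h2

/-- The class of a path, as a morphism between given objects. -/
abbrev pathHom {x y : FundamentalGroupoid X} (p : Path x.as y.as) : x ⟶ y :=
  Path.Homotopic.Quotient.mk p

theorem pathHom_eq {x y : FundamentalGroupoid X} {p q : Path x.as y.as} (h : p.Homotopic q) :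
    (pathHom p : x ⟶ y) = pathHom q := Path.Homotopic.Quotient.eq.2 h

theorem pathHom_surjective {x y : FundamentalGroupoid X} (f : x ⟶ y) :
    ∃ p : Path x.as y.as, pathHom p = f := Quotient.exists_rep f

theorem pathHom_comp {x y z : FundamentalGroupoid X} (p : Path x.as y.as) (q : Path y.as z.as) :
    (pathHom p : x ⟶ y) ≫ pathHom q = pathHom (p.trans q) := rfl

/-- If a relation between points of a path is additive and holds locally, it holds between the
ends. -/
theorem unitInterval_additive {Q : unitInterval → unitInterval → Prop}
    (htrans : ∀ r s t, Q r s → Q s t → Q r t)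
    (hloc : ∀ t, ∀ᶠ s in nhds t, Q s t ∧ Q t s) : Q 0 1 := by
  have h0 : Q 0 0 := (hloc 0).self_of_nhds.1
  have hcl : IsClopen {t | Q 0 t} := by
    refine ⟨⟨isOpen_iff_mem_nhds.2 fun t ht => ?_⟩, isOpen_iff_mem_nhds.2 fun t ht => ?_⟩
    · filter_upwards [hloc t] with s hs h
      exact ht (htrans _ _ _ h hs.1)
    · filter_upwards [hloc t] with s hs
      exact htrans _ _ _ ht hs.2
  have h1 : (1 : unitInterval) ∈ {t | Q 0 t} := by rw [hcl.eq_univ ⟨0, h0⟩]; trivial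
  exact h1

/-- The ends of `p.subpath 0 1` agree with those of `p` only up to propositional equality; the
`eqToHom` factors absorb the difference. -/
theorem pathHom_subpath_eq {x y : FundamentalGroupoid X} (p : Path x.as y.as) :
    ∃ (h : x = ⟨p 0⟩) (h' : y = ⟨p 1⟩),
      pathHom p = eqToHom h ≫ pathHom (p.subpath 0 1) ≫ eqToHom h'.symm := by
  obtain ⟨x⟩ := x
  obtain ⟨y⟩ := y
  have hx : p 0 = x := p.source
  have hy : p 1 = y := p.target
  refine ⟨by rw [hx], by rw [hy], ?_⟩
  rw [Path.subpath_zero_one]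
  have h1 : ∀ {x' y' : X} (hx : x' = x) (hy : y' = y) (e1 e2),
      (pathHom p : (⟨x⟩ : FundamentalGroupoid X) ⟶ ⟨y⟩) = eqToHom e1 ≫
        (pathHom (p.cast hx hy) : (⟨x'⟩ : FundamentalGroupoid X) ⟶ ⟨y'⟩) ≫ eqToHom e2 := by
    rintro x' y' rfl rfl e1 e2; simp
  exact h1 hx hy _ _

end Square

section

variable {I : Type} {pair : I × Fin 3 → I × Fin 3}

theorem continuous_mixPt {W : Type*} [TopologicalSpace W] {s : W → unitInterval}
    {x y : W → TriPoint I} (hs : Continuous s) {t : I} (hx : Continuous x) (hy : Continuous y)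
    (ht : ∀ w, (x w).1 = t) : Continuous fun w => mixPt (s w) (x w) (y w) := by
  have h2 : Continuous (fun a : TriPoint I => a.2) := continuous_sigma fun i => continuous_id
  have : (fun w => mixPt (s w) (x w) (y w)) =
      fun w => ⟨t, ClosedTriangle.mix (s w) (x w).2 (y w).2⟩ := by
    funext w; exact congrArg (fun i => (⟨i, _⟩ : TriPoint I)) (ht w)
  rw [this]
  exact continuous_sigmaMk.comp (ClosedTriangle.continuous_mix hs (h2.comp hx) (h2.comp hy))

theorem eqvGen_mixPt_of_pairSteps {p q : TriPoint I × TriPoint I}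
    (h : Relation.ReflTransGen (PairStep pair) p q) (s : unitInterval) :
    Relation.EqvGen (SideGlue pair) (mixPt s p.2 p.1) (mixPt s q.2 q.1) := by
  induction h with
  | refl => exact .refl _
  | tail _ h ih =>
    obtain ⟨i, j, h1, h2⟩ := h
    exact ih.trans _ _ _ (.rel _ _ (PairStep.mixPt ⟨i, j, h2, h1⟩ s))

theorem isOpen_near {D : Set (TriPoint I)} (ε : ℝ) (b : TriPoint I) :
    IsOpen {a : {a : TriPoint I // a ∉ D} | Near ε a.1 b} := by
  refine IsOpen.preimage (f := Subtype.val) (t := {a : TriPoint I | Near ε a b})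
    continuous_subtype_val ?_
  rw [isOpen_sigma_iff]
  intro t
  by_cases h : t = b.1
  · have : (Sigma.mk t ⁻¹' {a : TriPoint I | Near ε a b}) =
        ⋂ c : Fin 3, {x : ClosedTriangle | |x.1 c - b.2.1 c| < ε} := by
      ext x; simp [Near, h]
    rw [this]
    refine isOpen_iInter_of_finite fun c => isOpen_lt ?_ continuous_const
    have : Continuous fun x : ClosedTriangle => x.1 c :=
      (continuous_apply c).comp continuous_subtype_val
    exact (this.sub continuous_const).abs
  · convert isOpen_empty
    ext x; simp [Near, h]

end

/-- The space `Z` is glued from the triangles indexed by `I`, with some vertices removed, along the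
sides matched by `pair`. -/
structure IsGlued {I : Type} (pair : I × Fin 3 → I × Fin 3) (D : Set (TriPoint I)) {Z : Type*}
    [TopologicalSpace Z] (π : {a : TriPoint I // a ∉ D} → Z) : Prop where
  isQuotientMap : Topology.IsQuotientMap π
  eq_iff : ∀ a b, π a = π b ↔ Relation.EqvGen (SideGlue pair) a.1 b.1
  involutive : Function.Involutive pair
  vertex : ∀ a ∈ D, ∃ i, a.2 = triangleVertex i
  saturated : ∀ a b, SideGlue pair a b → (a ∈ D ↔ b ∈ D)

namespace IsGlued

variable {I : Type} {pair : I × Fin 3 → I × Fin 3} {D : Set (TriPoint I)} {Z : Type*}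
  [TopologicalSpace Z] {π : {a : TriPoint I // a ∉ D} → Z} (hG : IsGlued pair D π)
include hG

theorem notMem_of_eqvGen {a b : TriPoint I} (ha : a ∉ D)
    (h : Relation.EqvGen (SideGlue pair) a b) : b ∉ D := fun hb =>
  ha ((eqvGen_iff_of_glue (p := (· ∈ D)) hG.saturated h).2 hb)

theorem mixPt_notMem {a b : TriPoint I} (ha : a ∉ D) (hb : b ∉ D) (h : a.1 = b.1)
    (s : unitInterval) : mixPt s a b ∉ D := fun hm => by
  obtain ⟨t, x⟩ := a
  obtain ⟨t', y⟩ := b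
  obtain rfl : t = t' := h
  obtain ⟨i, hi⟩ := hG.vertex _ hm
  rcases ClosedTriangle.mix_eq_vertex hi with h1 | h1
  · exact ha (by have : mixPt s (⟨t, x⟩ : TriPoint I) ⟨t, y⟩ = ⟨t, x⟩ := congrArg (Sigma.mk t) h1
                 rwa [this] at hm)
  · exact hb (by have : mixPt s (⟨t, x⟩ : TriPoint I) ⟨t, y⟩ = ⟨t, y⟩ := congrArg (Sigma.mk t) h1
                 rwa [this] at hm)

/-- The segment between two points of a triangle. -/
noncomputable def seg (a b : {a : TriPoint I // a ∉ D}) (h : a.1.1 = b.1.1) : Path a b where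
  toFun s := ⟨mixPt s a.1 b.1, hG.mixPt_notMem a.2 b.2 h s⟩
  continuous_toFun := Continuous.subtype_mk
    (continuous_mixPt continuous_id continuous_const continuous_const (fun _ => rfl)) _
  source' := Subtype.ext (by simp [mixPt])
  target' := Subtype.ext (by
    obtain ⟨⟨t, x⟩, _⟩ := a
    obtain ⟨⟨t', y⟩, _⟩ := b
    obtain rfl : t = t' := h
    simp [mixPt])

/-- The class of the image of a segment. -/
noncomputable def sg {x y : FundamentalGroupoid Z} (a b : {a : TriPoint I // a ∉ D})
    (h : a.1.1 = b.1.1) (hx : π a = x.as) (hy : π b = y.as) : x ⟶ y :=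
  pathHom (((hG.seg a b h).map hG.isQuotientMap.continuous).cast hx.symm hy.symm)

/-- The straight-line homotopy works because a triangle is convex, even with some vertices removed.
-/
theorem homotopic_of_triangle {a b : {a : TriPoint I // a ∉ D}} (p q : Path a b)
    (hp : ∀ s, (p s).1.1 = a.1.1) (hq : ∀ s, (q s).1.1 = a.1.1) : p.Homotopic q := by
  have key : ∀ (s : unitInterval) (u v : TriPoint I), u = v → mixPt s u v = u := by
    rintro s u v rfl; simp [mixPt]
  refine ⟨⟨⟨⟨fun z => ⟨mixPt z.1 (p z.2).1 (q z.2).1,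
    hG.mixPt_notMem (p z.2).2 (q z.2).2 ((hp _).trans (hq _).symm) _⟩, ?_⟩, fun t => ?_,
      fun t => ?_⟩, ?_⟩⟩
  · exact Continuous.subtype_mk (continuous_mixPt continuous_fst (by fun_prop) (by fun_prop)
      (fun z => hp z.2)) _
  · exact Subtype.ext (by simp [mixPt])
  · refine Subtype.ext ?_
    have := (hp t).trans (hq t).symm
    change mixPt 1 (p t).1 (q t).1 = (q t).1
    generalize (p t).1 = u at this ⊢
    generalize (q t).1 = v at this ⊢
    obtain ⟨t1, x⟩ := u
    obtain ⟨t2, y⟩ := v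
    obtain rfl : t1 = t2 := this
    simp [mixPt]
  · rintro t x (rfl | rfl) <;> exact Subtype.ext (key _ _ _ (by simp))

theorem sg_comp {x y z : FundamentalGroupoid Z} (a b d : {a : TriPoint I // a ∉ D})
    (h : a.1.1 = b.1.1) (h' : b.1.1 = d.1.1) (hx : π a = x.as) (hy : π b = y.as)
    (hz : π d = z.as) :
    hG.sg a b h hx hy ≫ hG.sg b d h' hy hz = hG.sg a d (h.trans h') hx hz := by
  obtain ⟨x⟩ := x
  obtain ⟨y⟩ := y
  obtain ⟨z⟩ := z
  cases hx
  cases hy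
  cases hz
  rw [sg, sg, sg, pathHom_comp]
  refine pathHom_eq ?_
  have := hG.homotopic_of_triangle ((hG.seg a b h).trans (hG.seg b d h'))
    (hG.seg a d (h.trans h')) (fun s => by
      rw [Path.trans_apply]; split_ifs
      · rfl
      · exact h.symm) (fun s => rfl)
  have h2 := this.map ⟨π, hG.isQuotientMap.continuous⟩
  rwa [Path.map_trans] at h2

theorem sg_self {x : FundamentalGroupoid Z} (a : {a : TriPoint I // a ∉ D})
    (hx : π a = x.as) : hG.sg a a rfl hx hx = 𝟙 x := by
  obtain ⟨x⟩ := x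
  cases hx
  refine pathHom_eq ?_
  have := hG.homotopic_of_triangle (hG.seg a a rfl) (Path.refl a) (fun s => rfl) (fun s => rfl)
  exact this.map ⟨π, hG.isQuotientMap.continuous⟩

theorem sg_comp_sg_symm {x y : FundamentalGroupoid Z} (a b : {a : TriPoint I // a ∉ D})
    (h : a.1.1 = b.1.1) (hx : π a = x.as) (hy : π b = y.as) :
    hG.sg a b h hx hy ≫ hG.sg b a h.symm hy hx = 𝟙 x := by
  rw [hG.sg_comp, hG.sg_self]

theorem sg_eq_of_mixPt {x y : FundamentalGroupoid Z} {a b a' b' : {a : TriPoint I // a ∉ D}}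
    (h : a.1.1 = b.1.1) (h' : a'.1.1 = b'.1.1) (hx : π a = x.as) (hy : π b = y.as)
    (hx' : π a' = x.as) (hy' : π b' = y.as)
    (hm : ∀ s, Relation.EqvGen (SideGlue pair) (mixPt s a.1 b.1) (mixPt s a'.1 b'.1)) :
    hG.sg a b h hx hy = hG.sg a' b' h' hx' hy' := by
  unfold sg
  congr 1
  ext s
  exact (hG.eq_iff _ _).2 (hm s)

/-- Segments matched along a side have the same image. -/
theorem sg_glue {x y : FundamentalGroupoid Z} {a b a' b' : {a : TriPoint I // a ∉ D}}
    (h : a.1.1 = b.1.1) (h' : a'.1.1 = b'.1.1) (hx : π a = x.as) (hy : π b = y.as)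
    (hx' : π a' = x.as) (hy' : π b' = y.as) (hs : PairStep pair (a.1, b.1) (a'.1, b'.1)) :
    hG.sg a b h hx hy = hG.sg a' b' h' hx' hy' :=
  hG.sg_eq_of_mixPt h h' hx hy hx' hy' fun s => .rel _ _ (hs.mixPt s)

/-- The conic neighbourhood of the class of `b₀`. -/
def cone (_ : IsGlued pair D π) (b₀ : {a : TriPoint I // a ∉ D}) (ε : ℝ) : Set Z :=
  {z | ∃ a b : {a : TriPoint I // a ∉ D}, π b = π b₀ ∧ Near ε a.1 b.1 ∧ π a = z}

/-- Nearness to the class passes to all representatives of a point, since gluing carries the nearby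
centre along. This is the saturation that makes the cone open. -/
theorem exists_near_of_mem_cone {b₀ : {a : TriPoint I // a ∉ D}} {ε : ℝ}
    (hε : IsConeRadius pair b₀.1 ε) {a : {a : TriPoint I // a ∉ D}} (ha : π a ∈ hG.cone b₀ ε) :
    ∃ b : {a : TriPoint I // a ∉ D}, π b = π b₀ ∧ Near ε a.1 b.1 := by
  obtain ⟨a', b', hb, hn, he⟩ := ha
  obtain ⟨b, h⟩ := exists_pairSteps hG.involutive hε ((hG.eq_iff _ _).1 hb.symm) hn
    ((hG.eq_iff _ _).1 he)
  have h1 := eqvGen_of_pairSteps h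
  exact ⟨⟨b, hG.notMem_of_eqvGen b'.2 h1⟩, ((hG.eq_iff b' _).2 h1).symm.trans hb,
    near_of_pairSteps h hn⟩

theorem isOpen_cone {b₀ : {a : TriPoint I // a ∉ D}} {ε : ℝ} (hε : IsConeRadius pair b₀.1 ε) :
    IsOpen (hG.cone b₀ ε) := by
  rw [← hG.isQuotientMap.isOpen_preimage]
  have : π ⁻¹' hG.cone b₀ ε =
      ⋃ b : {b : {a : TriPoint I // a ∉ D} // π b = π b₀}, {a | Near ε a.1 b.1.1} := by
    ext a
    simp only [Set.mem_preimage, Set.mem_iUnion, Set.mem_ofPred_eq, Subtype.exists, exists_prop]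
    constructor
    · intro h
      obtain ⟨b, hb, hn⟩ := hG.exists_near_of_mem_cone hε h
      exact ⟨b.1, b.2, hb, hn⟩
    · rintro ⟨b, hbD, hb, hn⟩
      exact ⟨a, ⟨b, hbD⟩, hb, hn, rfl⟩
  rw [this]
  exact isOpen_iUnion fun b => isOpen_near ε b.1.1

theorem mem_cone (b₀ : {a : TriPoint I // a ∉ D}) {ε : ℝ} (hε : 0 < ε) : π b₀ ∈ hG.cone b₀ ε :=
  ⟨b₀, b₀, rfl, Near.refl hε _, rfl⟩

/-- The contraction of a conic neighbourhood. -/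
theorem exists_contraction {b₀ : {a : TriPoint I // a ∉ D}} {ε : ℝ}
    (hε : IsConeRadius pair b₀.1 ε) :
    ∃ C : C(hG.cone b₀ ε, C(unitInterval, Z)), ∀ z a b, (h : Near ε a.1 b.1) → π b = π b₀ →
      π a = z.1 → ∀ s, C z s = π (hG.seg b a h.1.symm s) := by
  set U := hG.cone b₀ ε
  have hU : IsOpen U := hG.isOpen_cone hε
  choose β hβ1 hβ2 using fun a : π ⁻¹' U => hG.exists_near_of_mem_cone hε (a := a.1) a.2
  have huniq : ∀ a b, Near ε a.1.1 b.1 → π b = π b₀ → b = β a := fun a b hn hb =>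
    Subtype.ext (hε.eq_of_near ((hG.eq_iff _ _).1 hb.symm) ((hG.eq_iff _ _).1 (hβ1 a).symm) hn
      (hβ2 a))
  -- With values in the function space, the contraction descends to the cone by the universal
  -- property of the quotient map restricted to an open set.
  let c : π ⁻¹' U → C(unitInterval, Z) := fun a =>
    ⟨fun s => π (hG.seg (β a) a.1 (hβ2 a).1.symm s),
      hG.isQuotientMap.continuous.comp (hG.seg _ _ _).continuous⟩
  have hc : Continuous c := by
    rw [continuous_iff_continuousAt]
    intro a
    -- By uniqueness the chosen centre is constant on this neighbourhood, so the contraction is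
    -- there an explicit continuous formula.
    set W : Set (π ⁻¹' U) := {a' | Near ε a'.1.1 (β a).1}
    have hW : IsOpen W := (isOpen_near ε (β a).1).preimage continuous_subtype_val
    have haW : a ∈ W := hβ2 a
    refine ContinuousOn.continuousAt ?_ (hW.mem_nhds haW)
    rw [continuousOn_iff_continuous_domRestrict]
    let f : C(W × unitInterval, Z) := ⟨fun w => π ⟨mixPt w.2 (β a).1 w.1.1.1.1,
      hG.mixPt_notMem (β a).2 w.1.1.1.2 w.1.2.1.symm _⟩, by
        refine hG.isQuotientMap.continuous.comp (Continuous.subtype_mk ?_ _)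
        exact continuous_mixPt continuous_snd continuous_const (by fun_prop) (fun _ => rfl)⟩
    have : W.domRestrict c = f.curry := by
      funext w
      ext s
      have h1 : β a = β w.1 := huniq w.1 (β a) w.2 (hβ1 a)
      exact congrArg π (Subtype.ext (congrArg (fun b : {a : TriPoint I // a ∉ D} =>
        mixPt s b.1 w.1.1.1) h1.symm))
    rw [this]
    exact f.curry.continuous
  have hq := hG.isQuotientMap.restrictPreimage_isOpen hU
  -- Glued points have glued centres, and the gluing extends to the whole segment between point and
  -- centre.
  have hwd : ∀ a a' : π ⁻¹' U, π a.1 = π a'.1 → c a = c a' := by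
    intro a a' haa
    obtain ⟨b', h⟩ := exists_pairSteps hG.involutive hε ((hG.eq_iff _ _).1 (hβ1 a).symm) (hβ2 a)
      ((hG.eq_iff _ _).1 haa)
    have h1 := eqvGen_of_pairSteps h
    have h2 := huniq a' ⟨b', hG.notMem_of_eqvGen (β a).2 h1⟩ (near_of_pairSteps h (hβ2 a))
      (((hG.eq_iff (β a) _).2 h1).symm.trans (hβ1 a))
    ext s
    refine (hG.eq_iff _ _).2 ?_
    have h3 := eqvGen_mixPt_of_pairSteps h s
    rw [show b' = (β a').1 from congrArg Subtype.val h2] at h3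
    exact h3
  choose r hr using hq.surjective
  have hCc : (fun z => c (r z)) ∘ U.restrictPreimage π = c := by
    funext a
    exact hwd _ _ (congrArg Subtype.val (hr (U.restrictPreimage π a)))
  refine ⟨⟨fun z => c (r z), hq.continuous_iff.2 (by rw [hCc]; exact hc)⟩, ?_⟩
  rintro z a b hn hb hz s
  have haU : a ∈ π ⁻¹' U := by rw [Set.mem_preimage, hz]; exact z.2
  have h1 : c (r z) = c ⟨a, haU⟩ := hwd _ _ ((congrArg Subtype.val (hr z)).trans hz.symm)
  change c (r z) s = _
  rw [h1]
  have h2 := huniq ⟨a, haU⟩ b hn hb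
  subst h2
  rfl

/-- A path in a conic neighbourhood is homotopic to a path through its centre. -/
theorem pathHom_eq_of_mem_cone {b₀ : {a : TriPoint I // a ∉ D}} {ε : ℝ}
    (hε : IsConeRadius pair b₀.1 ε) {x y w : FundamentalGroupoid Z} (p : Path x.as y.as)
    (hp : ∀ s, p s ∈ hG.cone b₀ ε) {a b a' b' : {a : TriPoint I // a ∉ D}}
    (hn : Near ε a.1 b.1) (hn' : Near ε a'.1 b'.1) (hw : π b₀ = w.as) (hb : π b = w.as)
    (hb' : π b' = w.as) (ha : π a = x.as) (ha' : π a' = y.as) :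
    pathHom p = hG.sg a b hn.1 ha hb ≫ hG.sg b' a' hn'.1.symm hb' ha' := by
  obtain ⟨C, hC⟩ := hG.exists_contraction hε
  have hcomp : hG.sg b a hn.1.symm hb ha ≫ pathHom p = 𝟙 w ≫ hG.sg b' a' hn'.1.symm hb' ha' := by
    -- The first coordinate runs from the centre outwards, the second along the path; one edge of
    -- the square is constant at the centre.
    let F : C(unitInterval × unitInterval, Z) :=
      ⟨fun st => C ⟨p st.2, hp st.2⟩ st.1, by
        have h1 : Continuous fun st : unitInterval × unitInterval =>
          ((⟨p st.2, hp st.2⟩ : hG.cone b₀ ε)) := by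
            refine Continuous.subtype_mk ?_ _
            fun_prop
        exact ContinuousEval.continuous_eval.comp ((C.continuous.comp h1).prodMk continuous_fst)⟩
    refine pathHom_eq (Path.Homotopic.of_square F _ _ (Path.refl w.as) _ ?_ ?_ ?_ ?_)
    · intro s
      exact hC _ a b hn (hb.trans hw.symm) (by simp [ha]) s
    · intro t
      obtain ⟨b1, hb1, hn1⟩ := hG.exists_near_of_mem_cone hε
        (a := (hG.isQuotientMap.surjective (p t)).choose)
        (by rw [(hG.isQuotientMap.surjective (p t)).choose_spec]; exact hp t)
      have := hC ⟨p t, hp t⟩ _ b1 hn1 hb1 (hG.isQuotientMap.surjective (p t)).choose_spec 1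
      change C ⟨p t, hp t⟩ 1 = _
      rw [this, Path.target, (hG.isQuotientMap.surjective (p t)).choose_spec]
    · intro t
      obtain ⟨b1, hb1, hn1⟩ := hG.exists_near_of_mem_cone hε
        (a := (hG.isQuotientMap.surjective (p t)).choose)
        (by rw [(hG.isQuotientMap.surjective (p t)).choose_spec]; exact hp t)
      have := hC ⟨p t, hp t⟩ _ b1 hn1 hb1 (hG.isQuotientMap.surjective (p t)).choose_spec 0
      change C ⟨p t, hp t⟩ 0 = _
      rw [this, Path.source, hb1, hw]
      rfl
    · intro s
      exact hC _ a' b' hn' (hb'.trans hw.symm) (by simp [ha']) s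
  rw [Category.id_comp] at hcomp
  rw [← hcomp, ← Category.assoc, hG.sg_comp_sg_symm, Category.id_comp]

/-- The morphisms generated by segments. -/
inductive SegGen (hG : IsGlued pair D π) :
    ∀ {x y : FundamentalGroupoid Z}, (x ⟶ y) → Prop
  | id (x : FundamentalGroupoid Z) : SegGen hG (𝟙 x)
  | sg {x y : FundamentalGroupoid Z} (a b : {a : TriPoint I // a ∉ D}) (h : a.1.1 = b.1.1)
      (hx : π a = x.as) (hy : π b = y.as) : SegGen hG (hG.sg a b h hx hy)
  | comp {x y z : FundamentalGroupoid Z} (f : x ⟶ y) (g : y ⟶ z) :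
      SegGen hG f → SegGen hG g → SegGen hG (f ≫ g)

/-- A property of subpaths of a path that is additive and holds for subpaths contained in the cone
of some point of the path holds for the path. -/
theorem subpath_induction {x y : FundamentalGroupoid Z} (p : Path x.as y.as)
    {Q : ∀ s t : unitInterval, ((⟨p s⟩ : FundamentalGroupoid Z) ⟶ ⟨p t⟩) → Prop}
    (hcomp : ∀ r s t f g, Q r s f → Q s t g → Q r t (f ≫ g))
    (hcone : ∀ s t u b₀ ε, IsConeRadius pair b₀.1 ε → π b₀ = p u →
      (∀ v, p.subpath s t v ∈ hG.cone b₀ ε) → Q s t (pathHom (p.subpath s t))) :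
    Q 0 1 (pathHom (p.subpath 0 1)) := by
  refine unitInterval_additive (Q := fun s t => Q s t (pathHom (p.subpath s t)))
    (fun r s t h1 h2 => ?_) (fun t => ?_)
  · have := hcomp r s t _ _ h1 h2
    rwa [pathHom_comp, pathHom_eq ⟨Path.Homotopy.subpathTransSubpath p r s t⟩] at this
  · obtain ⟨b₀, hb₀⟩ := hG.isQuotientMap.surjective (p t)
    obtain ⟨ε, hε⟩ := exists_isConeRadius pair b₀.1
    have h1 : p ⁻¹' hG.cone b₀ ε ∈ nhds t := p.continuous.continuousAt.preimage_mem_nhds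
      ((hG.isOpen_cone hε).mem_nhds (hb₀ ▸ hG.mem_cone b₀ hε.pos))
    -- Passing to an interval around `t` keeps entire subpaths in the cone, not only their ends.
    set V := (p ⁻¹' hG.cone b₀ ε).ordConnectedComponent t
    have hV : V ∈ nhds t := Set.ordConnectedComponent_mem_nhds.2 h1
    have hVc : V.OrdConnected := inferInstance
    have hVs : V ⊆ p ⁻¹' hG.cone b₀ ε := Set.ordConnectedComponent_subset
    filter_upwards [hV] with s hs
    have hsub : ∀ u v : unitInterval, u ∈ V → v ∈ V → ∀ w, p.subpath u v w ∈ hG.cone b₀ ε := by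
      intro u v hu hv w
      have : p.subpath u v w ∈ Set.range (p.subpath u v) := ⟨w, rfl⟩
      rw [Path.range_subpath] at this
      obtain ⟨r, hr, e⟩ := this
      rw [← e]
      exact hVs (hVc.uIcc_subset hu hv hr)
    exact ⟨hcone s t t b₀ ε hε hb₀ (hsub s t hs (mem_of_mem_nhds hV)),
      hcone t s t b₀ ε hε hb₀ (hsub t s (mem_of_mem_nhds hV) hs)⟩

/-- The fundamental groupoid is generated by segments. -/
theorem segGen {x y : FundamentalGroupoid Z} (f : x ⟶ y) : SegGen hG f := by
  obtain ⟨p, rfl⟩ := pathHom_surjective f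
  have key := hG.subpath_induction p (Q := fun s t f => SegGen hG f)
    (fun r s t f g => SegGen.comp f g) (by
      intro s t u b₀ ε hε hb₀ hv
      obtain ⟨a, ha⟩ := hG.isQuotientMap.surjective (p s)
      obtain ⟨a', ha'⟩ := hG.isQuotientMap.surjective (p t)
      obtain ⟨b, hb, hn⟩ := hG.exists_near_of_mem_cone hε (a := a)
        (by have := hv 0; rw [Path.source] at this; rwa [ha])
      obtain ⟨b', hb', hn'⟩ := hG.exists_near_of_mem_cone hε (a := a')
        (by have := hv 1; rw [Path.target] at this; rwa [ha'])
      rw [hG.pathHom_eq_of_mem_cone (x := ⟨p s⟩) (y := ⟨p t⟩) (w := ⟨π b₀⟩) hε (p.subpath s t) hv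
        hn hn' rfl hb hb' ha ha']
      exact .comp _ _ (.sg _ _ _ _ _) (.sg _ _ _ _ _))
  obtain ⟨h, h', e⟩ := pathHom_subpath_eq p
  rw [e]
  have hid : ∀ {x y : FundamentalGroupoid Z} (h : x = y), SegGen hG (eqToHom h) := by
    rintro x _ rfl; exact .id x
  exact .comp _ _ (hid h) (.comp _ _ key (hid h'.symm))

end IsGlued

/-! ## Holonomy -/

section Potential

variable {I : Type} {pair : I × Fin 3 → I × Fin 3} {D : Set (TriPoint I)} {Γ : Type*} [Group Γ]

/-- The function `h` is multiplied by the label `l` of a side when this side is crossed. -/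
def IsPotential (pair : I × Fin 3 → I × Fin 3) (D : Set (TriPoint I)) (h : TriPoint I → Γ)
    (l : I × Fin 3 → Γ) : Prop :=
  ∀ i j a b, a ∉ D → SideStep pair i j a b → h b = h a * l (a.1, i)

/-- Both points cross the same side, so both values acquire the same factor on the right and it
cancels in the ratio. -/
theorem IsPotential.ratio_eq {h : TriPoint I → Γ} {l : I × Fin 3 → Γ}
    (hh : IsPotential pair D h l) (hsat : ∀ a b, SideGlue pair a b → (a ∈ D ↔ b ∈ D))
    {p q : TriPoint I × TriPoint I} (hp : Relation.ReflTransGen (PairStep pair) p q)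
    (h1 : p.1 ∉ D) (h2 : p.2 ∉ D) (h3 : p.1.1 = p.2.1) :
    h p.2 * (h p.1)⁻¹ = h q.2 * (h q.1)⁻¹ := by
  have key : q.1 ∉ D ∧ q.2 ∉ D ∧ q.1.1 = q.2.1 ∧ h p.2 * (h p.1)⁻¹ = h q.2 * (h q.1)⁻¹ := by
    induction hp with
    | refl => exact ⟨h1, h2, h3, rfl⟩
    | @tail r s _ hs ih =>
      obtain ⟨i, j, hs1, hs2⟩ := hs
      obtain ⟨i1, i2, i3, i4⟩ := ih
      refine ⟨fun hm => i1 ((hsat _ _ hs1.glue).2 hm), fun hm => i2 ((hsat _ _ hs2.glue).2 hm),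
        ?_, ?_⟩
      · have e1 := hs1.1
        rw [i3] at e1
        exact congrArg Prod.fst (e1.symm.trans hs2.1)
      · rw [i4, hh i j _ _ i1 hs1, hh i j _ _ i2 hs2, i3]
        group
  exact key.2.2.2

end Potential

namespace IsGlued

variable {I : Type} {pair : I × Fin 3 → I × Fin 3} {D : Set (TriPoint I)} {Z : Type*}
  [TopologicalSpace Z] {π : {a : TriPoint I // a ∉ D} → Z} (hG : IsGlued pair D π)
  {Γ : Type*} [Group Γ] {h : TriPoint I → Γ} {l : I × Fin 3 → Γ}

/-- A multiplicative function on the fundamental groupoid whose values on segments are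
the ratios of the values of `h`. -/
structure Holonomy (hG : IsGlued pair D π) (h : TriPoint I → Γ) where
  /-- The function. -/
  toFun : ∀ {x y : FundamentalGroupoid Z}, (x ⟶ y) → Γ
  map_id : ∀ x, toFun (𝟙 x) = 1
  map_comp : ∀ {x y z : FundamentalGroupoid Z} (f : x ⟶ y) (g : y ⟶ z),
    toFun (f ≫ g) = toFun f * toFun g
  map_sg : ∀ {x y : FundamentalGroupoid Z} (a b : {a : TriPoint I // a ∉ D}) (e : a.1.1 = b.1.1)
    (hx : π a = x.as) (hy : π b = y.as), toFun (hG.sg a b e hx hy) = h a.1 * (h b.1)⁻¹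

include hG

/-- The function τ z y is the parallel transport from `z` to a nearby `y`. It does not depend on
representatives: ratios are invariant under gluing, and the centre near a given representative is
unique. -/
theorem exists_transport (hh : IsPotential pair D h l) :
    ∃ (r : Z → {a : TriPoint I // a ∉ D}) (ε : Z → ℝ) (τ : Z → Z → Γ), (∀ z, π (r z) = z) ∧
      (∀ z, IsConeRadius pair (r z).1 (ε z)) ∧
      ∀ z (a b : {a : TriPoint I // a ∉ D}), Near (ε z) a.1 b.1 → π b = z →
        τ z (π a) = h b.1 * (h a.1)⁻¹ := by
  choose r hr using hG.isQuotientMap.surjective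
  choose ε hε using fun z => exists_isConeRadius pair (r z).1
  have hτ : ∀ z y, ∃ g : Γ, ∀ a b : {a : TriPoint I // a ∉ D}, Near (ε z) a.1 b.1 → π b = z →
      π a = y → g = h b.1 * (h a.1)⁻¹ := by
    intro z y
    by_cases hy : ∃ a b : {a : TriPoint I // a ∉ D}, Near (ε z) a.1 b.1 ∧ π b = z ∧ π a = y
    · obtain ⟨a, b, hn, hb, ha⟩ := hy
      refine ⟨h b.1 * (h a.1)⁻¹, fun a' b' hn' hb' ha' => ?_⟩
      have hrb : Relation.EqvGen (SideGlue pair) (r z).1 b.1 :=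
        (hG.eq_iff _ _).1 ((hr z).trans hb.symm)
      obtain ⟨b1, hs⟩ := exists_pairSteps hG.involutive (hε z) hrb hn
        ((hG.eq_iff _ _).1 (ha.trans ha'.symm))
      have : b1 = b'.1 := (hε z).eq_of_near (hrb.trans _ _ _ (eqvGen_of_pairSteps hs))
        ((hG.eq_iff _ _).1 ((hr z).trans hb'.symm)) (near_of_pairSteps hs hn) hn'
      have h2 := hh.ratio_eq hG.saturated hs a.2 b.2 hn.1
      rw [h2, this]
    · exact ⟨1, fun a b hn hb ha => absurd ⟨a, b, hn, hb, ha⟩ hy⟩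
  choose τ hτ using hτ
  exact ⟨r, ε, τ, hr, hε, fun z a b hn hb => hτ z (π a) a b hn hb rfl⟩

/-- The transports are the transition data of a bundle over `Z` with discrete fibre `Γ`, hence of a
covering. Its monodromy commutes with left translations of the fibre, so it is right multiplication
by an element, the holonomy. -/
theorem nonempty_holonomy (hh : IsPotential pair D h l) : Nonempty (hG.Holonomy h) := by
  obtain ⟨r, ε, τ, hr, hε, hτ⟩ := hG.exists_transport hh
  let U : Z → Set Z := fun z => hG.cone (r z) (ε z)
  have hU : ∀ z, IsOpen (U z) := fun z => hG.isOpen_cone (hε z)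
  have hUz : ∀ z, z ∈ U z := fun z => by
    have := hG.mem_cone (r z) (hε z).pos
    rwa [hr z] at this
  have hrep : ∀ z, ∀ y ∈ U z, ∃ a b : {a : TriPoint I // a ∉ D}, Near (ε z) a.1 b.1 ∧ π b = z ∧
      π a = y := by
    rintro z y ⟨a, b, h1, h2, h3⟩
    exact ⟨a, b, h2, h1.trans (hr z), h3⟩
  have hself : ∀ z, τ z z = 1 := fun z => by
    have := hτ z (r z) (r z) (Near.refl (hε z).pos _) (hr z)
    rwa [hr z, mul_inv_cancel] at this
  -- This local cocycle identity makes the changes of chart locally constant.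
  have hloc : ∀ i, ∀ z ∈ U i, ∀ᶠ y in nhds z, τ i y = τ i z * τ z y := by
    intro i z hz
    obtain ⟨b, d, hbd, hd, hb⟩ := hrep i z hz
    obtain ⟨ρ, hρ, hρd⟩ : ∃ ρ < ε i, ∀ c, |b.1.2.1 c - d.1.2.1 c| < ρ := by
      have h1 : ∀ c, ∃ ρ < ε i, |b.1.2.1 c - d.1.2.1 c| < ρ := fun c => by
        obtain ⟨ρ, h1, h2⟩ := exists_between (hbd.2 c)
        exact ⟨ρ, h2, h1⟩
      choose ρ h1 h2 using h1
      refine ⟨max (ρ 0) (max (ρ 1) (ρ 2)), by simp [h1], fun c => ?_⟩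
      fin_cases c
      · exact (h2 0).trans_le (by simp)
      · exact (h2 1).trans_le (by simp)
      · exact (h2 2).trans_le (by simp)
    -- The representative of `z` is within `ρ < ε i` of its centre over `i`; a further displacement
    -- below `ε i - ρ` stays within `ε i` by the triangle inequality.
    set δ := min (ε z) (ε i - ρ)
    have hδ : 0 < δ := lt_min (hε z).pos (by linarith)
    have hcr : IsConeRadius pair (r z).1 δ :=
      ⟨hδ, fun b' hb' c => ((hε z).coord b' hb' c).imp id fun h1 =>
        (mul_le_mul_of_nonneg_left (min_le_left _ _) zero_le_two).trans h1,
        fun b1 b2 h1 h2 hn => (hε z).separated b1 b2 h1 h2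
          (hn.mono (mul_le_mul_of_nonneg_left (min_le_left _ _) zero_le_two))⟩
    have hmem : z ∈ hG.cone (r z) δ := by
      have := hG.mem_cone (r z) hδ
      rwa [hr z] at this
    filter_upwards [(hG.isOpen_cone hcr).mem_nhds hmem]
    rintro y ⟨a, b', hb', hn, rfl⟩
    rw [hr z] at hb'
    obtain ⟨d', hs⟩ := exists_pairSteps hG.involutive (hε i)
      ((hG.eq_iff (r i) d).1 ((hr i).trans hd.symm)) hbd ((hG.eq_iff _ _).1 (hb.trans hb'.symm))
    have hd1 := eqvGen_of_pairSteps hs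
    have hd' : d' ∉ D := hG.notMem_of_eqvGen d.2 hd1
    have hn2 : Near ρ b'.1 d' := near_of_pairSteps hs ⟨hbd.1, hρd⟩
    have hdi : π ⟨d', hd'⟩ = i := ((hG.eq_iff d ⟨d', hd'⟩).2 hd1).symm.trans hd
    rw [hτ i a ⟨d', hd'⟩ ((hn.trans hn2).mono (by
        have : δ ≤ ε i - ρ := min_le_right _ _
        linarith)) hdi,
      hτ z a b' (hn.mono (min_le_left _ _)) hb', ← hb, hτ i b d hbd hd]
    rw [hh.ratio_eq hG.saturated hs b.2 d.2 hbd.1]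
    group
  let _ : TopologicalSpace Γ := ⊥
  have : DiscreteTopology Γ := ⟨rfl⟩
  let B : FiberBundleCore Z Z Γ :=
    { baseSet := U
      isOpen_baseSet := hU
      indexAt := id
      mem_baseSet_at := hUz
      -- Acting on the right leaves left translations of the fibre as symmetries of the bundle.
      coordChange := fun i j x g => g * τ i x * (τ j x)⁻¹
      coordChange_self := fun i x _ v => by group
      continuousOn_coordChange := by
        rintro i j ⟨z, g⟩ ⟨⟨hi, hj⟩, -⟩
        refine ContinuousAt.continuousWithinAt ?_
        have : (fun p : Z × Γ => p.2 * τ i p.1 * (τ j p.1)⁻¹) =ᶠ[nhds (z, g)]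
            fun p => p.2 * (τ i z * (τ j z)⁻¹) := by
          filter_upwards [(continuous_fst.tendsto (z, g)).eventually (hloc i z hi),
            (continuous_fst.tendsto (z, g)).eventually (hloc j z hj)] with p h1 h2
          rw [h1, h2]; group
        refine ContinuousAt.congr ?_ this.symm
        exact ((continuous_of_discreteTopology
          (f := fun g : Γ => g * (τ i z * (τ j z)⁻¹))).comp continuous_snd).continuousAt
      coordChange_comp := fun i j k x _ v => by group }
  have cov : IsCoveringMap B.proj := FiberBundle.isCoveringMap (F := Γ) (E := B.Fiber)
  have hlift : ∀ {x y : FundamentalGroupoid Z} (a b : {a : TriPoint I // a ∉ D})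
      (e : a.1.1 = b.1.1) (hx : π a = x.as) (hy : π b = y.as) (g : Γ),
      cov.monodromy (hG.sg a b e hx hy) ⟨(⟨x.as, g⟩ : B.TotalSpace), rfl⟩ =
        ⟨(⟨y.as, g * (h a.1 * (h b.1)⁻¹)⟩ : B.TotalSpace), rfl⟩ := by
    rintro ⟨x⟩ ⟨y⟩ a b e hx hy g
    cases hx
    cases hy
    -- This lift of the segment is constant in the chart around each of its points, up to the
    -- transport there, and is therefore continuous.
    let f : unitInterval → B.TotalSpace := fun s =>
      ⟨π (hG.seg a b e s), (g * (h a.1 * (h (hG.seg a b e s).1)⁻¹) : Γ)⟩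
    have hf : Continuous f := by
      rw [continuous_iff_continuousAt]
      intro s₀
      rw [FiberBundle.continuousAt_totalSpace]
      refine ⟨(hG.isQuotientMap.continuous.comp (hG.seg a b e).continuous).continuousAt, ?_⟩
      set z := π (hG.seg a b e s₀) with hz
      refine ContinuousAt.congr (f := fun _ => g * (h a.1 * (h (hG.seg a b e s₀).1)⁻¹))
        continuousAt_const ?_
      have h1 := (isOpen_near (D := D) (ε z) (hG.seg a b e s₀).1).preimage
        (hG.seg a b e).continuous
      filter_upwards [h1.mem_nhds (show s₀ ∈ _ from Near.refl (hε z).pos _)] with s hs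
      have h2 := hτ z _ _ hs hz.symm
      change _ = g * (h a.1 * (h (hG.seg a b e s).1)⁻¹) * τ (π (hG.seg a b e s))
        (π (hG.seg a b e s)) * (τ z (π (hG.seg a b e s)))⁻¹
      rw [hself, h2]; group
    let P : Path (⟨π a, g⟩ : B.TotalSpace) ⟨π b, (g * (h a.1 * (h b.1)⁻¹) : Γ)⟩ :=
      ⟨⟨f, hf⟩, by
        have h0 : hG.seg a b e 0 = a := Path.source _
        change (⟨π (hG.seg a b e 0), (g * (h a.1 * (h (hG.seg a b e 0).1)⁻¹) : Γ)⟩ :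
          B.TotalSpace) = _
        rw [h0, mul_inv_cancel, mul_one], by
        have h0 : hG.seg a b e 1 = b := Path.target _
        change (⟨π (hG.seg a b e 1), (g * (h a.1 * (h (hG.seg a b e 1).1)⁻¹) : Γ)⟩ :
          B.TotalSpace) = _
        rw [h0]⟩
    exact cov.monodromy_map (Path.Homotopic.Quotient.mk P)
  let L : ∀ {x y : FundamentalGroupoid Z}, (x ⟶ y) → Γ := fun {x y} f =>
    (cov.monodromy f ⟨(⟨x.as, (1 : Γ)⟩ : B.TotalSpace), rfl⟩).1.2
  have hfib : ∀ {x : Z} (e : B.proj ⁻¹' {x}), e = ⟨⟨x, e.1.2⟩, rfl⟩ := by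
    rintro x ⟨⟨x', v⟩, rfl⟩; rfl
  have hid : ∀ x : FundamentalGroupoid Z, ∀ e, cov.monodromy (𝟙 x) e = e := fun x e =>
    congrFun cov.monodromy_refl e
  have hcomp : ∀ {x y z : FundamentalGroupoid Z} (f : x ⟶ y) (g : y ⟶ z) e,
      cov.monodromy (f ≫ g) e = cov.monodromy g (cov.monodromy f e) := fun f g e =>
    cov.monodromy_trans_apply f g e
  -- Monodromy by right multiplication is known for segments, and segments generate the groupoid.
  have hL : ∀ {x y : FundamentalGroupoid Z} (f : x ⟶ y) (g : Γ),
      cov.monodromy f ⟨(⟨x.as, g⟩ : B.TotalSpace), rfl⟩ =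
        ⟨(⟨y.as, (g * L f : Γ)⟩ : B.TotalSpace), rfl⟩ := by
    intro x y f
    have : ∃ u : Γ, ∀ g : Γ, cov.monodromy f ⟨(⟨x.as, g⟩ : B.TotalSpace), rfl⟩ =
        ⟨(⟨y.as, (g * u : Γ)⟩ : B.TotalSpace), rfl⟩ := by
      induction hG.segGen f with
      | id x => exact ⟨1, fun g => by rw [hid, mul_one]⟩
      | sg a b e hx hy => exact ⟨_, hlift a b e hx hy⟩
      | comp f1 f2 _ _ ih1 ih2 =>
        obtain ⟨u1, h1⟩ := ih1
        obtain ⟨u2, h2⟩ := ih2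
        exact ⟨u1 * u2, fun g => by rw [hcomp, h1, h2, mul_assoc]⟩
    obtain ⟨u, hu⟩ := this
    have hLu : L f = u := by
      change (cov.monodromy f ⟨(⟨x.as, (1 : Γ)⟩ : B.TotalSpace), rfl⟩).1.2 = u
      rw [hu]; exact one_mul u
    rw [hLu]; exact hu
  refine ⟨⟨L, fun x => ?_, fun {x y z} f g => ?_, fun {x y} a b e hx hy => ?_⟩⟩
  · change (cov.monodromy (𝟙 x) ⟨(⟨x.as, (1 : Γ)⟩ : B.TotalSpace), rfl⟩).1.2 = (1 : Γ)
    rw [hid]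
  · change (cov.monodromy (f ≫ g) ⟨(⟨x.as, (1 : Γ)⟩ : B.TotalSpace), rfl⟩).1.2 = L f * L g
    rw [hcomp, hL f 1, hL g]
    exact congrArg (· * L g) (one_mul (L f))
  · change (cov.monodromy (hG.sg a b e hx hy) ⟨(⟨x.as, (1 : Γ)⟩ : B.TotalSpace), rfl⟩).1.2 = _
    rw [hlift]
    exact one_mul (h a.1 * (h b.1)⁻¹)

end IsGlued

/-! ## Words of crossed sides -/

section Words

variable {T : Type} (pr : T × Fin 3 → T × Fin 3)

/-- A side glued to another side of the same triangle. -/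
def FoldedSide (σ : T × Fin 3) : Prop := (pr σ).1 = σ.1 ∧ pr σ ≠ σ

open Classical in
/-- The label of a side. -/
noncomputable def sideLabel (σ : T × Fin 3) : SwapGroup (T × Fin 3) :=
  if FoldedSide pr σ then theta
  else SemidirectProduct.inl (FreeGroup.of (σ, false) * (FreeGroup.of (pr σ, false))⁻¹)

/-- Two consecutive crossings that do not cancel. -/
def NoCancel (σ τ : T × Fin 3) : Prop := τ ≠ pr σ ∧ ¬ (FoldedSide pr σ ∧ FoldedSide pr τ)

open Classical in
/-- The word of the free group spelled by a sequence of crossed sides, starting in the sheet `s`. -/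
noncomputable def sheetWord : Bool → List (T × Fin 3) → List (((T × Fin 3) × Bool) × Bool)
  | _, [] => []
  | s, σ :: w => if FoldedSide pr σ then sheetWord (!s) w
      else ((σ, s), true) :: ((pr σ, s), false) :: sheetWord s w

theorem flipAut_sheetWord (s : Bool) (w : List (T × Fin 3)) :
    flipAut _ (FreeGroup.mk (sheetWord pr s w)) = FreeGroup.mk (sheetWord pr (!s) w) := by
  rw [flipAut_mk]
  congr 1
  induction w generalizing s with
  | nil => rfl
  | cons σ w ih =>
    by_cases h : FoldedSide pr σ
    · simp only [sheetWord, h, if_true]; exact ih _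
    · simp only [sheetWord, h, if_false, List.map_cons, ih]

/-- Moving each θ to the right end of the product exchanges the copies in all later letters; this is
the sheet recorded by `sheetWord`. -/
theorem left_prod_sideLabel (w : List (T × Fin 3)) :
    (w.map (sideLabel pr)).prod.left = FreeGroup.mk (sheetWord pr false w) := by
  induction w with
  | nil => rfl
  | cons σ w ih =>
    rw [List.map_cons, List.prod_cons]
    by_cases h : FoldedSide pr σ
    · have := flipAut_sheetWord pr false w
      simp only [sheetWord, sideLabel, h, if_true, theta, SemidirectProduct.mul_left, ih]
      simpa [flipGen] using this
    · simp only [sheetWord, sideLabel, h, if_false, SemidirectProduct.mul_left, ih]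
      simp [FreeGroup.of, FreeGroup.mul_mk, FreeGroup.invRev]

/-- The two letters of one crossing differ because the side is glued to another one. Letters of
adjacent crossings differ because the second does not undo the first. Across one θ they lie in
different copies, and two θ never follow each other. -/
theorem isReduced_sheetWord (s : Bool) (w : List (T × Fin 3))
    (hw : w.IsChain (NoCancel pr)) (hb : ∀ σ ∈ w, pr σ ≠ σ) :
    FreeGroup.IsReduced (sheetWord pr s w) := by
  induction w generalizing s with
  | nil => exact List.isChain_nil
  | cons σ w ih =>
    have hw' := hw.tail
    have ih' := fun s => ih s hw' fun σ hσ => hb σ (List.mem_cons_of_mem _ hσ)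
    by_cases h : FoldedSide pr σ
    · simp only [sheetWord, h, if_true]; exact ih' _
    · simp only [sheetWord, h, if_false]
      unfold FreeGroup.IsReduced at ih' ⊢
      refine List.isChain_cons_cons.2 ⟨?_, ?_⟩
      · intro e
        exact absurd (congrArg Prod.fst e).symm (hb σ List.mem_cons_self)
      · rw [List.isChain_cons]
        refine ⟨?_, ih' s⟩
        rcases w with _ | ⟨τ, w⟩
        · intro y hy; simp [sheetWord] at hy
        · have h1 : NoCancel pr σ τ := (List.isChain_cons_cons.1 hw).1
          by_cases hτ : FoldedSide pr τ
          · simp only [sheetWord, hτ, if_true]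
            rcases w with _ | ⟨υ, w⟩
            · intro y hy; simp [sheetWord] at hy
            · have h2 : NoCancel pr τ υ := (List.isChain_cons_cons.1 hw').1
              have hυ : ¬ FoldedSide pr υ := fun hυ => h2.2 ⟨hτ, hυ⟩
              simp only [sheetWord, hυ, if_false]
              intro y hy e
              simp only [List.head?_cons, Option.mem_some_iff] at hy
              subst hy
              have := congrArg Prod.snd e
              simp at this
          · simp only [sheetWord, hτ, if_false]
            intro y hy e
            simp only [List.head?_cons, Option.mem_some_iff] at hy
            subst hy
            exact absurd (congrArg Prod.fst e).symm h1.1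

/-- The product of the labels of a reduced nonempty sequence of crossings is nontrivial. -/
theorem eq_nil_of_prod_sideLabel {w : List (T × Fin 3)}
    (hw : w.IsChain (NoCancel pr)) (hb : ∀ σ ∈ w, pr σ ≠ σ)
    (h : (w.map (sideLabel pr)).prod = 1) : w = [] := by
  classical
  have h1 := congrArg SemidirectProduct.left h
  rw [left_prod_sideLabel] at h1
  have h2 := FreeGroup.reduce.sound h1
  rw [(isReduced_sheetWord pr false w hw hb).reduce_eq, FreeGroup.reduce_nil] at h2
  rcases w with _ | ⟨σ, w⟩
  · rfl
  · exfalso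
    by_cases hσ : FoldedSide pr σ
    · rcases w with _ | ⟨τ, w⟩
      -- A single folded side spells the empty word but has label θ, which is seen only in the
      -- order-two component.
      · have : Nonempty (T × Fin 3) := ⟨σ⟩
        simp only [List.map_cons, List.map_nil, List.prod_cons, List.prod_nil, mul_one, sideLabel,
          hσ, if_true, theta] at h
        exact flipGen_ne_one (congrArg SemidirectProduct.right h)
      · have hτ : ¬ FoldedSide pr τ := fun hτ => (List.isChain_cons_cons.1 hw).1.2 ⟨hσ, hτ⟩
        simp [sheetWord, hσ, hτ] at h2
    · simp [sheetWord, hσ] at h2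

theorem sideLabel_mul_sideLabel (hp : Function.Involutive pr) (σ : T × Fin 3) :
    sideLabel pr σ * sideLabel pr (pr σ) = 1 := by
  by_cases h : FoldedSide pr σ
  · have h' : FoldedSide pr (pr σ) := ⟨by rw [hp]; exact h.1.symm, by rw [hp]; exact h.2.symm⟩
    simp only [sideLabel, h, h', if_true, theta_mul_self]
  · have h' : ¬ FoldedSide pr (pr σ) := fun h' => h
      ⟨by have := h'.1; rw [hp] at this; exact this.symm,
        by have := h'.2; rw [hp] at this; exact this.symm⟩
    simp only [sideLabel, h, h', if_false, hp σ]
    rw [← map_mul, ← map_one SemidirectProduct.inl]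
    congr 1
    group

end Words

/-! ### Reduced sequences of crossings and faithfulness -/

section Crossings

variable {I T : Type} {pair : I × Fin 3 → I × Fin 3} {C : Type*} [Groupoid C]

/-- A choice of a morphism for every crossing of a side. -/
structure Crossings (pair : I × Fin 3 → I × Fin 3) (C : Type*) [Groupoid C] where
  /-- The object attached to a triangle. -/
  B : I → C
  /-- The morphism attached to a side. -/
  cr : ∀ {v v₁ : I} {i j : Fin 3}, pair (v, i) = (v₁, j) → (v, i) ≠ (v₁, j) → (B v ⟶ B v₁)
  cr_comp : ∀ {v v₁ : I} {i j : Fin 3} (e : pair (v, i) = (v₁, j)) (n : (v, i) ≠ (v₁, j))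
    (e' : pair (v₁, j) = (v, i)) (n' : (v₁, j) ≠ (v, i)), cr e n ≫ cr e' n' = 𝟙 _

namespace Crossings

/-- The morphisms generated by crossings. -/
inductive Gen (X : Crossings pair C) : ∀ {v v' : I}, (X.B v ⟶ X.B v') → Prop
  | nil (v : I) : Gen X (𝟙 (X.B v))
  | cons {v v₁ v' : I} {i j : Fin 3} (e : pair (v, i) = (v₁, j)) (n : (v, i) ≠ (v₁, j))
      (f : X.B v₁ ⟶ X.B v') : Gen X f → Gen X (X.cr e n ≫ f)

theorem Gen.comp {X : Crossings pair C} {v v' v'' : I} {f : X.B v ⟶ X.B v'}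
    {g : X.B v' ⟶ X.B v''} (hf : X.Gen f) (hg : X.Gen g) : X.Gen (f ≫ g) := by
  induction hf with
  | nil => rwa [Category.id_comp]
  | cons e n f _ ih => rw [Category.assoc]; exact .cons e n _ (ih hg)

/-- The image of a system of crossings. -/
def map (X : Crossings pair C) {C' : Type*} [Groupoid C'] (F : C ⥤ C') : Crossings pair C' where
  B v := F.obj (X.B v)
  cr e n := F.map (X.cr e n)
  cr_comp e n e' n' := by rw [← F.map_comp, X.cr_comp, F.map_id]

theorem Gen.map {X : Crossings pair C} {C' : Type*} [Groupoid C'] (F : C ⥤ C') {v v' : I}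
    {f : X.B v ⟶ X.B v'} (hf : X.Gen f) :
    (X.map F).Gen (v := v) (v' := v') (F.map f : F.obj (X.B v) ⟶ F.obj (X.B v')) := by
  induction hf with
  | nil v => rw [F.map_id]; exact .nil v
  | cons e n f _ ih => rw [F.map_comp]; exact .cons (X := X.map F) e n _ ih

/-- The sides of the triangles indexed by `I` lie over those of the triangles indexed by `T`, and
the two folded sides of a triangle are crossed by the same morphism. -/
structure IsOver (X : Crossings pair C) (pr : T × Fin 3 → T × Fin 3) (t : I → T) : Prop where
  involutive : Function.Involutive pair
  involutive' : Function.Involutive pr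
  pair_over : ∀ {v v₁ i j}, pair (v, i) = (v₁, j) → pr (t v, i) = (t v₁, j)
  ne_over : ∀ {v v₁ i j}, pair (v, i) = (v₁, j) → (v, i) ≠ (v₁, j) → (t v, i) ≠ (t v₁, j)
  fold_pair : ∀ {v v₁ i j}, pair (v, i) = (v₁, j) → t v₁ = t v → i ≠ j → pair (v, j) = (v₁, i)
  fold_cr : ∀ {v v₁ i j} (e : pair (v, i) = (v₁, j)) (n : (v, i) ≠ (v₁, j))
    (e' : pair (v, j) = (v₁, i)) (n' : (v, j) ≠ (v₁, i)), t v₁ = t v → i ≠ j →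
    X.cr e n = X.cr e' n'

/-- The morphisms represented by reduced sequences of crossings. -/
inductive Red (X : Crossings pair C) (pr : T × Fin 3 → T × Fin 3) (t : I → T) :
    ∀ {v v' : I}, List (T × Fin 3) → (X.B v ⟶ X.B v') → Prop
  | nil (v : I) : Red X pr t [] (𝟙 (X.B v))
  | cons {v v₁ v' : I} {i j : Fin 3} (e : pair (v, i) = (v₁, j)) (n : (v, i) ≠ (v₁, j))
      {w : List (T × Fin 3)} {f : X.B v₁ ⟶ X.B v'} : Red X pr t w f →
      (∀ τ ∈ w.head?, NoCancel pr (t v, i) τ) → Red X pr t ((t v, i) :: w) (X.cr e n ≫ f)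

variable {X : Crossings pair C} {pr : T × Fin 3 → T × Fin 3} {t : I → T}

/-- A new crossing either undoes the first one, or crosses the same fold again and cancels because
both directions of a fold give the same morphism, or leaves the sequence reduced. -/
theorem IsOver.exists_red_cr_comp (hX : X.IsOver pr t) {v v₁ v' : I} {i j : Fin 3}
    (e : pair (v, i) = (v₁, j)) (n : (v, i) ≠ (v₁, j)) {w : List (T × Fin 3)}
    {f : X.B v₁ ⟶ X.B v'} (hf : X.Red pr t w f) : ∃ w', X.Red pr t w' (X.cr e n ≫ f) := by
  cases hf with
  | nil => exact ⟨_, .cons e n (.nil _) (by simp)⟩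
  | @cons _ v₂ _ k l e' n' w f hf hnc =>
    by_cases hkj : k = j
    · subst hkj
      have h1 : pair (v₁, k) = (v, i) := by rw [← e, hX.involutive]
      obtain ⟨rfl, rfl⟩ := Prod.mk.inj (h1.symm.trans e')
      rw [← Category.assoc, X.cr_comp, Category.id_comp]
      exact ⟨w, hf⟩
    · by_cases hfold : FoldedSide pr (t v, i) ∧ FoldedSide pr (t v₁, k)
      · obtain ⟨h1, h2⟩ := hfold
        have hp1 := hX.pair_over e
        have ht : t v₁ = t v := by have := h1.1; rwa [hp1] at this
        have hij : i ≠ j := fun h => h1.2 (by rw [hp1, ht, h])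
        -- A triangle has only three sides, so it has at most one pair of sides glued together.
        have hki : k = i := by
          by_contra hki
          have hp2 : pr (t v, j) = (t v, i) := by rw [← ht, ← hp1, hX.involutive', ht]
          rw [ht] at h2
          obtain ⟨m, hm⟩ : ∃ m, pr (t v, k) = (t v, m) := ⟨(pr (t v, k)).2, Prod.ext h2.1 rfl⟩
          have hmk : m ≠ k := fun h => h2.2 (by rw [hm, h])
          have hp3 : pr (t v, m) = (t v, k) := by rw [← hm, hX.involutive']
          have : m = i ∨ m = j := by
            clear * - hij hki hkj hmk
            revert i j k m; decide
          rcases this with rfl | rfl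
          · rw [hp1, ht] at hp3; exact hkj (congrArg Prod.snd hp3).symm
          · rw [hp2] at hp3; exact hki (congrArg Prod.snd hp3).symm
        subst hki
        have e2 := hX.fold_pair e ht hij
        have h3 : pair (v₁, k) = (v, j) := by rw [← e2, hX.involutive]
        obtain ⟨rfl, rfl⟩ := Prod.mk.inj (h3.symm.trans e')
        -- The first crossing is replaced by the opposite crossing of the fold, of which the second
        -- is the inverse.
        rw [hX.fold_cr e n e2 n'.symm ht hij, ← Category.assoc, X.cr_comp, Category.id_comp]
        exact ⟨w, hf⟩
      · refine ⟨_, .cons e n (.cons e' n' hf hnc) ?_⟩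
        intro τ hτ
        simp only [List.head?_cons, Option.mem_some_iff] at hτ
        subst hτ
        refine ⟨fun h => hkj ?_, hfold⟩
        rw [hX.pair_over e] at h
        exact congrArg Prod.snd h

theorem IsOver.exists_red (hX : X.IsOver pr t) {v v' : I} {f : X.B v ⟶ X.B v'} (hf : X.Gen f) :
    ∃ w, X.Red pr t w f := by
  induction hf with
  | nil v => exact ⟨[], .nil v⟩
  | cons e n f _ ih =>
    obtain ⟨w, hw⟩ := ih
    exact hX.exists_red_cr_comp e n hw

theorem Red.isChain {v v' : I} {w : List (T × Fin 3)} {f : X.B v ⟶ X.B v'}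
    (h : X.Red pr t w f) : w.IsChain (NoCancel pr) := by
  induction h with
  | nil => exact List.isChain_nil
  | cons e n _ hnc ih => exact List.isChain_cons.2 ⟨hnc, ih⟩

theorem IsOver.ne_of_red (hX : X.IsOver pr t) {v v' : I} {w : List (T × Fin 3)}
    {f : X.B v ⟶ X.B v'} (h : X.Red pr t w f) : ∀ σ ∈ w, pr σ ≠ σ := by
  induction h with
  | nil => simp
  | cons e n _ hnc ih =>
    intro σ hσ
    rcases List.mem_cons.1 hσ with rfl | hσ
    · rw [hX.pair_over e]; exact (hX.ne_over e n).symm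
    · exact ih σ hσ

/-- A multiplicative function with the given labels on crossings has trivial kernel. -/
theorem IsOver.eq_id (hX : X.IsOver pr t)
    {L : ∀ {x y : C}, (x ⟶ y) → SwapGroup (T × Fin 3)} (hid : ∀ x : C, L (𝟙 x) = 1)
    (hcomp : ∀ {x y z : C} (f : x ⟶ y) (g : y ⟶ z), L (f ≫ g) = L f * L g)
    (hcr : ∀ {v v₁ i j} (e : pair (v, i) = (v₁, j)) (n : (v, i) ≠ (v₁, j)),
      L (X.cr e n) = sideLabel pr (t v, i))
    {v : I} {f : X.B v ⟶ X.B v} (hf : X.Gen f) (h1 : L f = 1) : f = 𝟙 _ := by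
  obtain ⟨w, hw⟩ := hX.exists_red hf
  have hL : ∀ {v v' : I} {w : List (T × Fin 3)} {f : X.B v ⟶ X.B v'}, X.Red pr t w f →
      L f = (w.map (sideLabel pr)).prod := by
    intro v v' w f h
    induction h with
    | nil => simp [hid]
    | cons e n _ _ ih => rw [hcomp, hcr, ih, List.map_cons, List.prod_cons]
  have hnil := eq_nil_of_prod_sideLabel pr hw.isChain (hX.ne_of_red hw)
    ((hL hw).symm.trans h1)
  subst hnil
  cases hw
  rfl

/-- A multiplicative function with the given labels on crossings is injective. -/
theorem IsOver.injective (hX : X.IsOver pr t)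
    {L : ∀ {x y : C}, (x ⟶ y) → SwapGroup (T × Fin 3)} (hid : ∀ x : C, L (𝟙 x) = 1)
    (hcomp : ∀ {x y z : C} (f : x ⟶ y) (g : y ⟶ z), L (f ≫ g) = L f * L g)
    (hcr : ∀ {v v₁ i j} (e : pair (v, i) = (v₁, j)) (n : (v, i) ≠ (v₁, j)),
      L (X.cr e n) = sideLabel pr (t v, i))
    (hgen : ∀ x : C, ∃ (v : I) (p : X.B v ⟶ x), ∀ f : x ⟶ x, X.Gen (p ≫ f ≫ Groupoid.inv p))
    {x y : C} {f g : x ⟶ y} (h : L f = L g) : f = g := by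
  obtain ⟨v, p, hp⟩ := hgen x
  have hinv : ∀ {x y : C} (f : x ⟶ y), L f * L (Groupoid.inv f) = 1 := fun f => by
    rw [← hcomp, Groupoid.comp_inv, hid]
  have h1 : p ≫ (f ≫ Groupoid.inv g) ≫ Groupoid.inv p = 𝟙 _ := by
    refine hX.eq_id hid hcomp hcr (hp _) ?_
    rw [hcomp, hcomp, hcomp, h, hinv, one_mul, hinv]
  have h2 : f ≫ Groupoid.inv g = 𝟙 _ := by
    have := congrArg (fun k => Groupoid.inv p ≫ k ≫ p) h1
    simpa using this
  have := congrArg (· ≫ g) h2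
  simpa using this

end Crossings

end Crossings

/-! ## Crossings of sides of a glued space -/

theorem CategoryTheory.comp_comp_cancel {C : Type*} [Category C] {u v w z : C} {f : u ⟶ v}
    {g : v ⟶ w} {g' : w ⟶ v} {k : v ⟶ z} (h : g ≫ g' = 𝟙 v) : (f ≫ g) ≫ g' ≫ k = f ≫ k := by
  rw [Category.assoc, ← Category.assoc g, h, Category.id_comp]

theorem CategoryTheory.comp_comp_comp_assoc {C : Type*} [Category C] {u v w z q : C} (f : u ⟶ v)
    {g : v ⟶ w} {g' : w ⟶ z} {k : v ⟶ z} (h : g ≫ g' = k) (l : z ⟶ q) :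
    (f ≫ g) ≫ g' ≫ l = f ≫ k ≫ l := by
  rw [← h]; simp only [Category.assoc]

theorem CategoryTheory.comp_comp_cancel₂ {C : Type*} [Category C] {u v w z p q : C} (f : u ⟶ v)
    (f' : v ⟶ w) {g : w ⟶ z} {g' : z ⟶ w} (h : g ≫ g' = 𝟙 w) (k : w ⟶ p) (l : p ⟶ q) :
    (f ≫ f' ≫ g) ≫ g' ≫ k ≫ l = f ≫ (f' ≫ k) ≫ l := by
  simp only [Category.assoc]
  rw [← Category.assoc g, h, Category.id_comp]

namespace ClosedTriangle

/-- The barycentre of the triangle. -/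
noncomputable def bary : ClosedTriangle := ⟨fun _ => 1 / 3, fun _ => by norm_num, by simp⟩

/-- The midpoint of the side `i`. -/
noncomputable def mid (i : Fin 3) : ClosedTriangle :=
  ⟨fun c => if c = i then 0 else 1 / 2, fun c => by
    dsimp only; split_ifs <;> norm_num, by
    rw [Fin.sum_univ_three]; fin_cases i <;> simp <;> norm_num⟩

theorem bary_ne_vertex (i : Fin 3) : bary ≠ triangleVertex i := fun h => by
  have h1 : (1 / 3 : ℝ) = 1 := eq_vertex_iff.1 h
  norm_num at h1

theorem mid_ne_vertex (i j : Fin 3) : mid i ≠ triangleVertex j := fun h => by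
  have h1 : (if j = i then (0 : ℝ) else 1 / 2) = 1 := eq_vertex_iff.1 h
  split_ifs at h1 <;> norm_num at h1

theorem sideMatch_mid (i j : Fin 3) : SideMatch i j (mid i) (mid j) := by
  simp [SideMatch, mid]

end ClosedTriangle

namespace IsGlued

variable {I : Type} {pair : I × Fin 3 → I × Fin 3} {D : Set (TriPoint I)} {Z : Type*}
  [TopologicalSpace Z] {π : {a : TriPoint I // a ∉ D} → Z} (hG : IsGlued pair D π)
include hG

/-- The barycentre of a triangle. -/
noncomputable def bt (v : I) : {a : TriPoint I // a ∉ D} :=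
  ⟨⟨v, ClosedTriangle.bary⟩, fun h => by
    obtain ⟨i, hi⟩ := hG.vertex _ h
    exact ClosedTriangle.bary_ne_vertex i hi⟩

/-- The midpoint of a side. -/
noncomputable def mt (v : I) (i : Fin 3) : {a : TriPoint I // a ∉ D} :=
  ⟨⟨v, ClosedTriangle.mid i⟩, fun h => by
    obtain ⟨j, hj⟩ := hG.vertex _ h
    exact ClosedTriangle.mid_ne_vertex i j hj⟩

theorem eq_of_sideStep {i j : Fin 3} {a b : {a : TriPoint I // a ∉ D}}
    (h : SideStep pair i j a.1 b.1) : π a = π b :=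
  (hG.eq_iff a b).2 (.rel _ _ h.glue)

theorem sideStep_mt {v v₁ : I} {i j : Fin 3} (e : pair (v, i) = (v₁, j)) (n : (v, i) ≠ (v₁, j)) :
    SideStep pair i j (hG.mt v i).1 (hG.mt v₁ j).1 :=
  ⟨e, n, ClosedTriangle.sideMatch_mid i j⟩

/-- The object of the barycentre of a triangle. -/
noncomputable def bary (v : I) : FundamentalGroupoid Z := ⟨π (hG.bt v)⟩

/-- The path between barycentres that crosses a side through its midpoint. -/
noncomputable def cross {v v₁ : I} {i j : Fin 3} (e : pair (v, i) = (v₁, j))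
    (n : (v, i) ≠ (v₁, j)) : hG.bary v ⟶ hG.bary v₁ :=
  hG.sg (y := ⟨π (hG.mt v i)⟩) (hG.bt v) (hG.mt v i) rfl rfl rfl ≫
    hG.sg (hG.mt v₁ j) (hG.bt v₁) rfl (hG.eq_of_sideStep (hG.sideStep_mt e n)).symm rfl

/-- A side can be crossed through any of its points. -/
theorem sg_comp_sg_eq_cross {v v₁ : I} {i j : Fin 3} (e : pair (v, i) = (v₁, j))
    (n : (v, i) ≠ (v₁, j)) {x : FundamentalGroupoid Z} {a a' : {a : TriPoint I // a ∉ D}}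
    (hv : v = a.1.1) (hv' : a'.1.1 = v₁) (hs : SideStep pair i j a.1 a'.1) (hx : π a = x.as)
    (hx' : π a' = x.as) :
    hG.sg (x := hG.bary v) (hG.bt v) a hv rfl hx ≫
      hG.sg (y := hG.bary v₁) a' (hG.bt v₁) hv' hx' rfl = hG.cross e n := by
  have h1 := hG.sg_comp (x := hG.bary v) (y := ⟨π (hG.mt v i)⟩) (z := x) (hG.bt v) (hG.mt v i) a
    rfl hv rfl rfl hx
  have h2 := hG.sg_comp (x := x) (y := ⟨π (hG.mt v i)⟩) (z := hG.bary v₁) a' (hG.mt v₁ j)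
    (hG.bt v₁) hv' rfl hx' (hG.eq_of_sideStep (hG.sideStep_mt e n)).symm rfl
  have h3 : hG.sg (x := x) (y := ⟨π (hG.mt v i)⟩) a' (hG.mt v₁ j) hv' hx'
      (hG.eq_of_sideStep (hG.sideStep_mt e n)).symm = hG.sg a (hG.mt v i) hv.symm hx rfl :=
    (hG.sg_glue _ _ _ _ _ _ ⟨i, j, hs, hG.sideStep_mt e n⟩).symm
  refine (congrArg₂ (· ≫ ·) h1 h2).symm.trans (comp_comp_cancel ?_)
  rw [h3]
  exact hG.sg_comp_sg_symm _ _ _ _ _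

/-- The crossings of the sides of a glued space. -/
noncomputable def crossings : Crossings pair (FundamentalGroupoid Z) where
  B := hG.bary
  cr := hG.cross
  cr_comp {v v₁ i j} e n e' n' := by
    have h1 := hG.sg_comp_sg_eq_cross (x := ⟨π (hG.mt v i)⟩) e' n' (a := hG.mt v₁ j)
      (a' := hG.mt v i) rfl rfl (hG.sideStep_mt e' n') (hG.eq_of_sideStep (hG.sideStep_mt e' n'))
      rfl
    refine (congrArg (hG.cross e n ≫ ·) h1).symm.trans ((comp_comp_cancel ?_).trans ?_)
    · exact hG.sg_comp_sg_symm _ _ _ _ _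
    · exact hG.sg_comp_sg_symm _ _ _ _ _

/-- Two representatives of one point are linked by a chain of gluings, and each gluing turns the
detour through that point into one crossing. -/
theorem gen_sg_comp_sg {x : FundamentalGroupoid Z} (a a' : {a : TriPoint I // a ∉ D})
    (hx : π a = x.as) (hx' : π a' = x.as) :
    hG.crossings.Gen (v := a.1.1) (v' := a'.1.1)
      (hG.sg (x := hG.bary a.1.1) (hG.bt a.1.1) a rfl rfl hx ≫
        hG.sg (y := hG.bary a'.1.1) a' (hG.bt a'.1.1) rfl hx' rfl) := by
  obtain ⟨a', ha'⟩ := a'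
  have h : Relation.ReflTransGen (SideGlue pair) a.1 a' :=
    reflTransGen_of_eqvGen hG.involutive ((hG.eq_iff a ⟨a', ha'⟩).1 (hx.trans hx'.symm))
  induction h with
  | refl =>
    have h1 := hG.sg_comp_sg_symm (x := hG.bary a.1.1) (hG.bt a.1.1) a rfl rfl hx
    exact h1 ▸ .nil _
  | @tail b b' h hb ih =>
    have hbD : b ∉ D := fun hm => ha' ((hG.saturated _ _ hb).1 hm)
    have hxb : π ⟨b, hbD⟩ = x.as := ((hG.eq_iff _ ⟨b', ha'⟩).2 (.rel _ _ hb)).trans hx'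
    have h1 := ih hbD hxb
    obtain ⟨i, j, e, n, hm⟩ := hb
    have h2 : hG.crossings.Gen (v := b.1) (v' := b'.1)
        (hG.sg (x := hG.bary b.1) (hG.bt b.1) ⟨b, hbD⟩ rfl rfl hxb ≫
        hG.sg (y := hG.bary b'.1) ⟨b', ha'⟩ (hG.bt b'.1) rfl hx' rfl) := by
      have h3 := hG.sg_comp_sg_eq_cross e n (a := ⟨b, hbD⟩) (a' := ⟨b', ha'⟩) rfl rfl ⟨e, n, hm⟩
        hxb hx'
      have h4 := Crossings.Gen.cons (X := hG.crossings) e n _ (.nil _)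
      rw [Category.comp_id] at h4
      exact h3 ▸ h4
    have h3 := h1.comp h2
    have h4 := comp_comp_cancel (f := hG.sg (x := hG.bary a.1.1) (hG.bt a.1.1) a rfl rfl hx)
      (k := hG.sg (y := hG.bary b'.1) ⟨b', ha'⟩ (hG.bt b'.1) rfl hx' rfl)
      (hG.sg_comp_sg_symm (x := x) (y := hG.bary b.1) ⟨b, hbD⟩ (hG.bt b.1) rfl hxb rfl)
    exact h4 ▸ h3

/-- Every morphism is a sequence of crossings, up to segments at the ends. -/
theorem gen_of_hom {x y : FundamentalGroupoid Z} (f : x ⟶ y) (a a' : {a : TriPoint I // a ∉ D})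
    (hx : π a = x.as) (hy : π a' = y.as) :
    hG.crossings.Gen (v := a.1.1) (v' := a'.1.1)
      (hG.sg (x := hG.bary a.1.1) (hG.bt a.1.1) a rfl rfl hx ≫ f ≫
        hG.sg (y := hG.bary a'.1.1) a' (hG.bt a'.1.1) rfl hy rfl) := by
  induction hG.segGen f generalizing a a' with
  | id x =>
    have h1 := hG.gen_sg_comp_sg a a' hx hy
    have h2 := Category.id_comp (hG.sg (x := x) (y := hG.bary a'.1.1) a' (hG.bt a'.1.1) rfl hy rfl)
    exact h2.symm ▸ h1
  | @sg x y b b' h hb hb' =>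
    have h1 := hG.gen_sg_comp_sg a b hx hb
    have h2 := hG.gen_sg_comp_sg b' a' hb' hy
    obtain ⟨⟨t, b⟩, hbD⟩ := b
    obtain ⟨⟨t', b'⟩, hbD'⟩ := b'
    obtain rfl : t = t' := h
    have h3 := h1.comp h2
    have h4 : hG.sg (x := x) (y := hG.bary t) ⟨⟨t, b⟩, hbD⟩ (hG.bt t) rfl hb rfl ≫
        hG.sg (x := hG.bary t) (y := y) (hG.bt t) ⟨⟨t, b'⟩, hbD'⟩ rfl rfl hb' =
        hG.sg ⟨⟨t, b⟩, hbD⟩ ⟨⟨t, b'⟩, hbD'⟩ rfl hb hb' := hG.sg_comp _ _ _ _ _ _ _ _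
    have h5 := comp_comp_comp_assoc (hG.sg (x := hG.bary a.1.1) (hG.bt a.1.1) a rfl rfl hx) h4
      (hG.sg (y := hG.bary a'.1.1) a' (hG.bt a'.1.1) rfl hy rfl)
    exact h5 ▸ h3
  | @comp x z y f g _ _ ih1 ih2 =>
    obtain ⟨b, hb⟩ := hG.isQuotientMap.surjective z.as
    have h3 := (ih1 a b hx hb).comp (ih2 b a' hb hy)
    have h5 := comp_comp_cancel₂ (hG.sg (x := hG.bary a.1.1) (hG.bt a.1.1) a rfl rfl hx) f
      (hG.sg_comp_sg_symm (x := z) (y := hG.bary b.1.1) b (hG.bt b.1.1) rfl hb rfl) g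
      (hG.sg (y := hG.bary a'.1.1) a' (hG.bt a'.1.1) rfl hy rfl)
    exact h5 ▸ h3

theorem inv_sg {x y : FundamentalGroupoid Z} (a b : {a : TriPoint I // a ∉ D})
    (h : a.1.1 = b.1.1) (hx : π a = x.as) (hy : π b = y.as) :
    Groupoid.inv (hG.sg a b h hx hy) = hG.sg b a h.symm hy hx := by
  rw [← cancel_epi (hG.sg a b h hx hy), Groupoid.comp_inv, hG.sg_comp_sg_symm]

end IsGlued

/-! ## Potentials of glued triangles -/

section Glued

variable {I : Type} {pair : I × Fin 3 → I × Fin 3} {W : Type*} [TopologicalSpace W]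

theorem IsGlued.of_isQuotientMap {f : TriPoint I → W} (hf : Topology.IsQuotientMap f)
    (h : ∀ a b, f a = f b ↔ Relation.EqvGen (SideGlue pair) a b)
    (hp : Function.Involutive pair) :
    IsGlued pair ∅ (fun a : {a : TriPoint I // a ∉ (∅ : Set (TriPoint I))} => f a.1) where
  isQuotientMap := by
    let e : {a : TriPoint I // a ∉ (∅ : Set (TriPoint I))} ≃ₜ TriPoint I :=
      { toFun := Subtype.val
        invFun := fun a => ⟨a, id⟩
        left_inv := fun _ => rfl
        right_inv := fun _ => rfl
        continuous_toFun := continuous_subtype_val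
        continuous_invFun := continuous_id.subtype_mk _ }
    exact hf.comp e.isQuotientMap
  eq_iff a b := h _ _
  involutive := hp
  vertex _ h := h.elim
  saturated _ _ _ := Iff.rfl

theorem IsGlued.restrict {f : TriPoint I → W} (hf : Topology.IsQuotientMap f)
    (h : ∀ a b, f a = f b ↔ Relation.EqvGen (SideGlue pair) a b)
    (hp : Function.Involutive pair) {U : Set W} (hU : IsOpen U)
    (hv : ∀ a, f a ∉ U → ∃ i, a.2 = triangleVertex i) :
    IsGlued pair {a | f a ∉ U}
      (fun a : {a : TriPoint I // a ∉ {a | f a ∉ U}} => (⟨f a.1, not_not.1 a.2⟩ : {w // w ∈ U})) where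
  isQuotientMap := by
    let e : {a : TriPoint I // a ∉ {a | f a ∉ U}} ≃ₜ f ⁻¹' U :=
      Homeomorph.setCongr (s := {a | a ∉ {a | f a ∉ U}}) (by ext a; simp)
    exact (hf.restrictPreimage_isOpen hU).comp e.isQuotientMap
  eq_iff a b := by rw [← h]; exact Subtype.ext_iff
  involutive := hp
  vertex a ha := hv a ha
  saturated a b hab := by
    have : f a = f b := (h a b).2 (.rel _ _ hab)
    simp only [Set.mem_ofPred_eq, this]

end Glued

/-! ### Corners around a vertex -/

section Corners

variable {T : Type} {pr : T × Fin 3 → T × Fin 3}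

/-- The corner next to the corner `c`, across a side. -/
def nextCorner (pr : T × Fin 3 → T × Fin 3) (c : T × Fin 3) : T × Fin 3 :=
  ((pr (c.1, c.2 + 1)).1, (pr (c.1, c.2 + 1)).2 + 1)

theorem nextCorner_injective (hp : Function.Involutive pr) :
    Function.Injective (nextCorner pr) := by
  rintro ⟨t, c⟩ ⟨t', c'⟩ h
  have h1 := congrArg Prod.fst h
  have h2 := add_right_cancel (congrArg Prod.snd h)
  have h3 := congrArg Prod.fst (hp.injective (Prod.ext h1 h2))
  have h4 := add_right_cancel (congrArg Prod.snd (hp.injective (Prod.ext h1 h2)))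
  exact Prod.ext h3 h4

/-- The corner `c` is followed by a side that is not glued. -/
def IsLastCorner (pr : T × Fin 3 → T × Fin 3) (c : T × Fin 3) : Prop :=
  pr (c.1, c.2 + 1) = (c.1, c.2 + 1)

/-- The fan of corners that starts at the corner `c` is finite. -/
def FanEnds (pr : T × Fin 3 → T × Fin 3) (c : T × Fin 3) : Prop :=
  ∃ n, IsLastCorner pr ((nextCorner pr)^[n] c)

/-- A finite fan imposes no cyclic condition: prescribe the value 1 at its last corner and go
backwards. -/
theorem exists_cornerPotential {Γ : Type*} [Group Γ] (pr : T × Fin 3 → T × Fin 3)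
    (l : T × Fin 3 → Γ) :
    ∃ hv : T × Fin 3 → Γ, ∀ c, FanEnds pr c → ¬ IsLastCorner pr c →
      hv (nextCorner pr c) = hv c * l (c.1, c.2 + 1) := by
  classical
  -- The index counts the steps to the last corner of the fan, where the value is 1.
  let w : ℕ → T × Fin 3 → Γ := fun n =>
    Nat.rec (fun _ => 1) (fun _ f c => f (nextCorner pr c) * (l (c.1, c.2 + 1))⁻¹) n
  refine ⟨fun c => if h : ∃ n, IsLastCorner pr ((nextCorner pr)^[n] c) then w (Nat.find h) c else 1,
    fun c hc hn => ?_⟩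
  dsimp only
  unfold FanEnds at hc
  have hc' : ∃ n, IsLastCorner pr ((nextCorner pr)^[n] (nextCorner pr c)) := by
    obtain ⟨n, h⟩ := hc
    cases n with
    | zero => exact absurd h hn
    | succ n => exact ⟨n, h⟩
  have hk : Nat.find hc = Nat.find hc' + 1 := Nat.find_comp_succ hc hc' hn
  rw [dif_pos hc, dif_pos hc', hk]
  change _ = w (Nat.find hc') (nextCorner pr c) * (l (c.1, c.2 + 1))⁻¹ * _
  rw [inv_mul_cancel_right]

theorem Fin.add_one_add_two (i : Fin 3) : i + 1 + 2 = i := by revert i; decide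
theorem Fin.add_two_add_one (i : Fin 3) : i + 2 + 1 = i := by revert i; decide
theorem Fin.add_one_add_one (i : Fin 3) : i + 1 + 1 = i + 2 := by revert i; decide
theorem Fin.add_two_add_two (i : Fin 3) : i + 2 + 2 = i + 1 := by revert i; decide
theorem Fin.add_one_ne (i : Fin 3) : i + 1 ≠ i := by revert i; decide
theorem Fin.add_two_ne (i : Fin 3) : i + 2 ≠ i := by revert i; decide
theorem Fin.add_one_ne_add_two (i : Fin 3) : i + 1 ≠ i + 2 := by revert i; decide

theorem triangleVertex_apply_self (i : Fin 3) : (triangleVertex i).1 i = 1 := by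
  simp [triangleVertex]

theorem triangleVertex_apply_ne {i j : Fin 3} (h : j ≠ i) : (triangleVertex i).1 j = 0 := by
  simp [triangleVertex, h]

theorem triangleVertex_injective : Function.Injective triangleVertex := fun i j h => by
  by_contra hij
  have := triangleVertex_apply_self i
  rw [h, triangleVertex_apply_ne hij] at this
  exact zero_ne_one this

/-- A step between vertices passes to the next corner or comes from the previous one. -/
theorem SideStep.vertex (hp : Function.Involutive pr) {i j : Fin 3} {a b : TriPoint T} (h : SideStep pr i j a b) {c : Fin 3}
    (ha : a.2 = triangleVertex c) :
    (i = c + 1 ∧ b.2 = triangleVertex (nextCorner pr (a.1, c)).2 ∧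
      b.1 = (nextCorner pr (a.1, c)).1) ∨
    (i = c + 2 ∧ ∃ c', b.2 = triangleVertex c' ∧ nextCorner pr (b.1, c') = (a.1, c) ∧
      c' + 1 = j) := by
  obtain ⟨e, n, h1, h2, h3, h4⟩ := h
  rw [ha] at h1 h3 h4
  rcases Fin.eq_or_of_three c i with rfl | rfl | rfl
  · rw [triangleVertex_apply_self] at h1
    exact absurd h1 one_ne_zero
  · left
    refine ⟨rfl, ?_, ?_⟩
    · rw [ClosedTriangle.eq_vertex_iff]
      simp only [nextCorner]
      rw [e, ← h4, Fin.add_one_add_two, triangleVertex_apply_self]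
    · simp only [nextCorner, e]
  · right
    rw [Fin.add_two_add_one, triangleVertex_apply_self] at h3
    refine ⟨rfl, j + 2, ClosedTriangle.eq_vertex_iff.2 h3.symm, ?_, Fin.add_two_add_one j⟩
    have e' : pr (b.1, j) = (a.1, c + 2) := by rw [← e, hp]
    simp only [nextCorner, Fin.add_two_add_one, e']

/-- An endless fan is a cycle, as there are finitely many corners and `nextCorner` is injective. The
cycle then contains every corner of the vertex, and none of them touches a side that is not glued.
-/
theorem fanEnds_of_eqvGen [Finite T] (hp : Function.Involutive pr) {c : T × Fin 3}
    {b : TriPoint T} {i : Fin 3}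
    (h : Relation.EqvGen (SideGlue pr) ⟨c.1, triangleVertex c.2⟩ b) (hi : pr (b.1, i) = (b.1, i))
    (hb : b.2.1 i = 0) : FanEnds pr c := by
  by_contra hc
  have hc : ∀ n, ¬ IsLastCorner pr ((nextCorner pr)^[n] c) := fun n hn => hc ⟨n, hn⟩
  set O : Set (T × Fin 3) := Set.range fun n => (nextCorner pr)^[n] c
  have hO : ∀ d, nextCorner pr d ∈ O ↔ d ∈ O := by
    intro d
    constructor
    · rintro ⟨n, hn⟩
      cases n with
      | zero =>
        obtain ⟨m, hm, hper⟩ := (nextCorner_injective hp).mem_periodicPts c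
        obtain ⟨k, rfl⟩ : ∃ k, m = k + 1 := ⟨m - 1, by omega⟩
        have h1 : nextCorner pr ((nextCorner pr)^[k] c) = c := by
          rw [← Function.iterate_succ_apply' (nextCorner pr)]; exact hper
        exact ⟨k, nextCorner_injective hp (h1.trans hn)⟩
      | succ n =>
        refine ⟨n, nextCorner_injective hp ?_⟩
        dsimp only at hn ⊢
        rw [← hn, Function.iterate_succ_apply']
    · rintro ⟨n, rfl⟩
      exact ⟨n + 1, Function.iterate_succ_apply' _ _ _⟩
  have hlast : ∀ d ∈ O, ¬ IsLastCorner pr d := by rintro _ ⟨n, rfl⟩; exact hc n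
  have key : ∃ d : Fin 3, (b.1, d) ∈ O ∧ b.2 = triangleVertex d := by
    replace h := reflTransGen_of_eqvGen hp h
    clear hi hb
    induction h with
    | refl => exact ⟨c.2, ⟨0, rfl⟩, rfl⟩
    | @tail a b _ hab ih =>
      obtain ⟨d, hd, ha⟩ := ih
      obtain ⟨i, j, hs⟩ := hab
      rcases SideStep.vertex hp hs ha with ⟨-, h1, h2⟩ | ⟨-, c', h1, h2, -⟩
      · exact ⟨_, by rw [h2]; exact (hO _).2 hd, h1⟩
      · exact ⟨c', (hO _).1 (h2 ▸ hd), h1⟩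
  obtain ⟨d, hd, hbd⟩ := key
  rw [hbd] at hb
  rcases Fin.eq_or_of_three d i with rfl | rfl | rfl
  · rw [triangleVertex_apply_self] at hb
    exact one_ne_zero hb
  · exact hlast _ hd hi
  -- The unglued side precedes the corner `d` here, so its predecessor in the cycle would be a last
  -- corner.
  · obtain ⟨e, he⟩ := (Finite.injective_iff_surjective.1 (nextCorner_injective hp)) (b.1, d)
    refine hlast e ((hO e).1 (he ▸ hd)) ?_
    have h1 : pr (e.1, e.2 + 1) = (b.1, d + 2) := by
      refine Prod.ext (congrArg Prod.fst he :) ?_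
      have := congrArg Prod.snd he
      simp only [nextCorner] at this
      rw [← this, add_assoc]
      exact (add_zero _).symm
    have h2 := congrArg pr h1
    rw [hp, hi] at h2
    rw [IsLastCorner, h1, h2]

end Corners

/-! ### The potential of the triangulated surface -/

section BasePotential

variable {T : Type} {pr : T × Fin 3 → T × Fin 3}

open Classical in
/-- The value of the potential at the inner points of a side. -/
noncomputable def sidePotential (pr : T × Fin 3 → T × Fin 3) (σ : T × Fin 3) :
    SwapGroup (T × Fin 3) :=
  if FoldedSide pr σ then (if σ.2 < (pr σ).2 then 1 else theta)
  else SemidirectProduct.inl (FreeGroup.of (σ, false))⁻¹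

theorem foldedSide_pair (hp : Function.Involutive pr) {σ : T × Fin 3} :
    FoldedSide pr (pr σ) ↔ FoldedSide pr σ := by
  simp only [FoldedSide, hp σ]
  exact ⟨fun h => ⟨h.1.symm, h.2.symm⟩, fun h => ⟨h.1.symm, h.2.symm⟩⟩

theorem sidePotential_pair (hp : Function.Involutive pr) (σ : T × Fin 3) :
    sidePotential pr (pr σ) = sidePotential pr σ * sideLabel pr σ := by
  unfold sidePotential sideLabel
  rw [foldedSide_pair hp, hp]
  by_cases h : FoldedSide pr σ
  · simp only [h, if_true]
    have hne : σ.2 ≠ (pr σ).2 := fun e => h.2 (Prod.ext h.1 e.symm)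
    rcases lt_or_gt_of_ne hne with h1 | h1
    · rw [if_neg h1.not_gt, if_pos h1, one_mul]
    · rw [if_pos h1, if_neg h1.not_gt, theta_mul_self]
  · simp only [h, if_false]
    rw [← map_mul]
    simp

open Classical in
/-- The potential of points of triangles with given values at the corners. -/
noncomputable def basePotential (pr : T × Fin 3 → T × Fin 3)
    (hv : T × Fin 3 → SwapGroup (T × Fin 3)) (a : TriPoint T) : SwapGroup (T × Fin 3) :=
  if h : ∃ c, a.2 = triangleVertex c then hv (a.1, h.choose)
  else if h : ∃ i, a.2.1 i = 0 then sidePotential pr (a.1, h.choose) else 1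

variable {hv : T × Fin 3 → SwapGroup (T × Fin 3)}

theorem basePotential_vertex {a : TriPoint T} {c : Fin 3} (h : a.2 = triangleVertex c) :
    basePotential pr hv a = hv (a.1, c) := by
  have h' : ∃ c, a.2 = triangleVertex c := ⟨c, h⟩
  rw [basePotential, dif_pos h', triangleVertex_injective (h'.choose_spec.symm.trans h)]

/-- A point that is not a vertex lies on at most one side, so the choice in the definition is
forced. -/
theorem basePotential_side {a : TriPoint T} {i : Fin 3} (h : ¬ ∃ c, a.2 = triangleVertex c)
    (hi : a.2.1 i = 0) : basePotential pr hv a = sidePotential pr (a.1, i) := by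
  have h' : ∃ i, a.2.1 i = 0 := ⟨i, hi⟩
  rw [basePotential, dif_neg h, dif_pos h']
  have h1 := h'.choose_spec
  generalize h'.choose = j at h1 ⊢
  by_contra hne
  have hij : j ≠ i := fun e => hne (by rw [e])
  have h2 := ClosedTriangle.sum_eq a.2 i
  rcases Fin.eq_or_of_three i j with rfl | rfl | rfl
  · exact hij rfl
  · exact h ⟨i + 2, ClosedTriangle.eq_vertex_iff.2 (by linarith)⟩
  · exact h ⟨i + 1, ClosedTriangle.eq_vertex_iff.2 (by linarith)⟩

theorem basePotential_of_ne {a : TriPoint T} (h : ∀ i, a.2.1 i ≠ 0) :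
    basePotential pr hv a = 1 := by
  rw [basePotential, dif_neg, dif_neg]
  · rintro ⟨i, hi⟩; exact h i hi
  · rintro ⟨c, hc⟩
    refine h (c + 1) ?_
    rw [hc, triangleVertex_apply_ne (Fin.add_one_ne c)]

/-- Away from vertices the values on the sides are independent of each other, and a side and its
partner are tied by `sidePotential_pair`. At a vertex the condition runs along its fan, which must
end. -/
theorem exists_isPotential (hp : Function.Involutive pr) (D : Set (TriPoint T))
    (hD : ∀ t c, (⟨t, triangleVertex c⟩ : TriPoint T) ∉ D → FanEnds pr (t, c)) :
    ∃ h : TriPoint T → SwapGroup (T × Fin 3), IsPotential pr D h (sideLabel pr) ∧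
      ∀ a : TriPoint T, (∀ i, a.2.1 i ≠ 0) → h a = 1 := by
  obtain ⟨hv, h⟩ := exists_cornerPotential pr (sideLabel pr)
  refine ⟨basePotential pr hv, fun i j a b ha hs => ?_, fun a => basePotential_of_ne⟩
  by_cases hvert : ∃ c, a.2 = triangleVertex c
  · obtain ⟨c, hc⟩ := hvert
    have hfan : FanEnds pr (a.1, c) := hD _ _ (by rw [← hc]; exact ha)
    rw [basePotential_vertex hc]
    rcases hs.vertex hp hc with ⟨rfl, h1, h2⟩ | ⟨rfl, c', h1, h2, rfl⟩
    · rw [basePotential_vertex h1, h2]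
      refine h _ hfan ?_
      rw [IsLastCorner, hs.1]
      exact hs.2.1.symm
    · have h3 := h (b.1, c') (by
        obtain ⟨n, hn⟩ := hfan
        exact ⟨n + 1, by rw [Function.iterate_succ_apply, h2]; exact hn⟩) (by
        rw [IsLastCorner]
        have := hs.symm hp
        rw [this.1]
        exact this.2.1.symm)
      rw [h2] at h3
      rw [basePotential_vertex h1, h3, mul_assoc]
      have h4 := sideLabel_mul_sideLabel pr hp (b.1, c' + 1)
      rw [(hs.symm hp).1] at h4
      rw [h4, mul_one]
  · have hvert' : ¬ ∃ c, b.2 = triangleVertex c := by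
      rintro ⟨c, hc⟩
      rcases (hs.symm hp).vertex hp hc with ⟨-, h1, -⟩ | ⟨-, c', h1, -⟩
      · exact hvert ⟨_, h1⟩
      · exact hvert ⟨_, h1⟩
    rw [basePotential_side hvert hs.2.2.1, basePotential_side hvert' hs.2.2.2.1, ← hs.1,
      sidePotential_pair hp]

end BasePotential

/-! ## Doubling -/

section Double

variable {T : Type} {pr : T × Fin 3 → T × Fin 3}

open Classical in
/-- The gluing of two copies of a family of triangles that exchanges the sheets along the folded
sides. -/
noncomputable def doublePair (pr : T × Fin 3 → T × Fin 3) (σ : (T × Bool) × Fin 3) :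
    (T × Bool) × Fin 3 :=
  (((pr (σ.1.1, σ.2)).1, if FoldedSide pr (σ.1.1, σ.2) then !σ.1.2 else σ.1.2),
    (pr (σ.1.1, σ.2)).2)

theorem doublePair_involutive (hp : Function.Involutive pr) :
    Function.Involutive (doublePair pr) := by
  rintro ⟨⟨t, s⟩, i⟩
  have h1 : FoldedSide pr ((pr (t, i)).1, (pr (t, i)).2) ↔ FoldedSide pr (t, i) :=
    foldedSide_pair hp
  have h2 : pr ((pr (t, i)).1, (pr (t, i)).2) = (t, i) := hp _
  unfold doublePair
  dsimp only
  by_cases h : FoldedSide pr (t, i)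
  · rw [if_pos (h1.2 h), if_pos h, h2, Bool.not_not]
  · rw [if_neg (fun h' => h (h1.1 h')), if_neg h, h2]

open Classical in
theorem doublePair_eq_iff {t t' : T} {s s' : Bool} {i j : Fin 3} :
    doublePair pr ((t, s), i) = ((t', s'), j) ↔
      pr (t, i) = (t', j) ∧ s' = if FoldedSide pr (t, i) then !s else s := by
  simp only [doublePair, Prod.ext_iff]
  constructor
  · rintro ⟨⟨h1, h2⟩, h3⟩; exact ⟨⟨h1, h3⟩, h2.symm⟩
  · rintro ⟨⟨h1, h3⟩, h2⟩; exact ⟨⟨h1, h2.symm⟩, h3⟩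

theorem ne_of_doublePair {t t' : T} {s s' : Bool} {i j : Fin 3}
    (h : doublePair pr ((t, s), i) = ((t', s'), j)) (n : ((t, s), i) ≠ ((t', s'), j)) :
    (t, i) ≠ (t', j) := by
  rw [doublePair_eq_iff] at h
  intro e
  have h1 : pr (t, i) = (t, i) := h.1.trans e.symm
  have h2 : ¬ FoldedSide pr (t, i) := fun hf => hf.2 h1
  rw [if_neg h2] at h
  obtain ⟨rfl, rfl⟩ := Prod.ext_iff.1 e
  exact n (by rw [h.2])

open Classical in
theorem sideGlue_doublePair_iff {a b : TriPoint (T × Bool)} :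
    SideGlue (doublePair pr) a b ↔
      SideGlue pr ⟨a.1.1, a.2⟩ ⟨b.1.1, b.2⟩ ∧ b.1.2 = if a.1.1 = b.1.1 then !a.1.2 else a.1.2 := by
  obtain ⟨⟨t, s⟩, x⟩ := a
  obtain ⟨⟨t', s'⟩, y⟩ := b
  constructor
  · rintro ⟨i, j, e, n, h⟩
    have n' := ne_of_doublePair e n
    rw [doublePair_eq_iff] at e
    refine ⟨⟨i, j, e.1, n', h⟩, e.2.trans ?_⟩
    have : FoldedSide pr (t, i) ↔ t = t' := by
      rw [FoldedSide, e.1]; exact ⟨fun h => h.1.symm, fun h => ⟨h.symm, n'.symm⟩⟩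
    simp only [this]
  · rintro ⟨⟨i, j, e, n, h⟩, hs⟩
    refine ⟨i, j, doublePair_eq_iff.2 ⟨e, hs.trans ?_⟩, fun h => n ?_, h⟩
    · have : FoldedSide pr (t, i) ↔ t = t' := by
        rw [FoldedSide, e]; exact ⟨fun h => h.1.symm, fun h => ⟨h.symm, n.symm⟩⟩
      simp only [this]
    · obtain ⟨h1, rfl⟩ := Prod.ext_iff.1 h
      obtain ⟨rfl, -⟩ := Prod.ext_iff.1 h1
      rfl

/-- The element of the group of order two attached to a sheet. -/
def sheetElt {A : Type} (s : Bool) : SwapGroup A := if s then theta else 1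

theorem sheetElt_mul_self {A : Type} (s : Bool) : (sheetElt s : SwapGroup A) * sheetElt s = 1 := by
  cases s
  · simp [sheetElt]
  · simp [sheetElt, theta_mul_self]

theorem sheetElt_not {A : Type} (s : Bool) : (sheetElt (!s) : SwapGroup A) = theta * sheetElt s := by
  cases s
  · simp [sheetElt]
  · simp [sheetElt, theta_mul_self]

open Classical in
/-- The potential of the doubled triangles. -/
noncomputable def doublePotential (D : Set (TriPoint T)) (h : TriPoint T → SwapGroup (T × Fin 3))
    (a : TriPoint (T × Bool)) : SwapGroup (T × Fin 3) :=
  if (⟨a.1.1, a.2⟩ : TriPoint T) ∈ D then 1 else h ⟨a.1.1, a.2⟩ * sheetElt a.1.2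

/-- The labels of the sides of the doubled triangles. -/
noncomputable def doubleLabel (pr : T × Fin 3 → T × Fin 3) (σ : (T × Bool) × Fin 3) :
    SwapGroup (T × Fin 3) :=
  sheetElt σ.1.2 * sideLabel pr (σ.1.1, σ.2) * sheetElt (doublePair pr σ).1.2

/-- Around a removed vertex only folded sides are crossed. They also change the sheet, so their
corrected labels are trivial and the value 1 is consistent at that vertex. This is why the potential
extends over the points above the punctures. -/
theorem isPotential_doublePotential {D : Set (TriPoint T)}
    {h : TriPoint T → SwapGroup (T × Fin 3)} (hh : IsPotential pr D h (sideLabel pr))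
    (hsat : ∀ a b, SideGlue pr a b → (a ∈ D ↔ b ∈ D))
    (hD : ∀ i j a b, a ∈ D → SideStep pr i j a b → FoldedSide pr (a.1, i))
    (D' : Set (TriPoint (T × Bool))) :
    IsPotential (doublePair pr) D' (doublePotential D h) (doubleLabel pr) := by
  rintro i j ⟨⟨t, s⟩, x⟩ ⟨⟨t', s'⟩, y⟩ - ⟨e, n, hm⟩
  have n' := ne_of_doublePair e n
  have hs : SideStep pr i j ⟨t, x⟩ ⟨t', y⟩ := ⟨(doublePair_eq_iff.1 e).1, n', hm⟩
  have hDD := hsat _ _ hs.glue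
  unfold doublePotential doubleLabel
  simp only [e]
  by_cases hm : (⟨t, x⟩ : TriPoint T) ∈ D
  · rw [if_pos hm, if_pos (hDD.1 hm)]
    have hf := hD _ _ _ _ hm hs
    have h2 := (doublePair_eq_iff.1 e).2
    rw [if_pos hf] at h2
    rw [h2, sheetElt_not, sideLabel, if_pos hf, one_mul, mul_assoc, ← mul_assoc theta theta,
      theta_mul_self, one_mul, sheetElt_mul_self]
  · rw [if_neg hm, if_neg (fun h => hm (hDD.2 h)), hh i j _ _ hm hs, mul_assoc (h _) (sheetElt s),
      ← mul_assoc (sheetElt s) (_ * _), ← mul_assoc (sheetElt s) (sheetElt s), sheetElt_mul_self,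
      one_mul, mul_assoc]

end Double

/-! ## The surface, its cover and their holonomies -/

theorem IsGlued.map_sg {I I' : Type} {pair : I × Fin 3 → I × Fin 3}
    {pair' : I' × Fin 3 → I' × Fin 3} {D : Set (TriPoint I)} {D' : Set (TriPoint I')}
    {Z Z' : Type*} [TopologicalSpace Z] [TopologicalSpace Z'] {π : {a : TriPoint I // a ∉ D} → Z}
    {π' : {a : TriPoint I' // a ∉ D'} → Z'} (hG : IsGlued pair D π) (hG' : IsGlued pair' D' π')
    (F : C(Z, Z')) (φ : I → I') (hD : ∀ a ∉ D, (⟨φ a.1, a.2⟩ : TriPoint I') ∉ D')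
    (hF : ∀ a, F (π a) = π' ⟨⟨φ a.1.1, a.1.2⟩, hD _ a.2⟩) {x y : FundamentalGroupoid Z}
    (a b : {a : TriPoint I // a ∉ D}) (h : a.1.1 = b.1.1) (hx : π a = x.as) (hy : π b = y.as) :
    (FundamentalGroupoid.map F).map (hG.sg a b h hx hy) =
      hG'.sg (x := (FundamentalGroupoid.map F).obj x) (y := (FundamentalGroupoid.map F).obj y)
        ⟨⟨φ a.1.1, a.1.2⟩, hD _ a.2⟩ ⟨⟨φ b.1.1, b.1.2⟩, hD _ b.2⟩ (congrArg φ h)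
        ((hF a).symm.trans (congrArg F hx)) ((hF b).symm.trans (congrArg F hy)) := by
  change Path.Homotopic.Quotient.mk (Path.map _ _) = Path.Homotopic.Quotient.mk _
  congr 1
  ext s
  exact hF _

/-- The vertex between two sides glued together is its own next corner, so it is glued to no other
point. -/
theorem eq_of_eqvGen_of_pair_eq {T : Type} {pr : T × Fin 3 → T × Fin 3}
    (hp : Function.Involutive pr) {t : T} {i : Fin 3} (h : pr (t, i + 1) = (t, i + 2))
    {b : TriPoint T} (hb : Relation.EqvGen (SideGlue pr) ⟨t, triangleVertex i⟩ b) :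
    b = ⟨t, triangleVertex i⟩ := by
  have hn : nextCorner pr (t, i) = (t, i) := by simp only [nextCorner, h, Fin.add_two_add_one]
  replace hb := reflTransGen_of_eqvGen hp hb
  induction hb with
  | refl => rfl
  | @tail a b _ hab ih =>
    subst ih
    obtain ⟨t', y⟩ := b
    obtain ⟨k, j, hs⟩ := hab
    rcases SideStep.vertex hp hs rfl with ⟨-, h1, h2⟩ | ⟨-, c', h1, h2, -⟩
    · rw [hn] at h1 h2
      obtain rfl : t' = t := h2
      obtain rfl : y = _ := h1
      rfl
    · have := Prod.ext_iff.1 (nextCorner_injective hp (h2.trans hn.symm))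
      obtain rfl : t' = t := this.1
      obtain rfl : c' = i := this.2
      obtain rfl : y = _ := h1
      rfl

namespace IdealTriangulation

variable {S : Type*} [TopologicalSpace S] [ChartedSpace (EuclideanHalfSpace 2) S] {M P : Set S}
  (τ : IdealTriangulation M P)

/-- The point of the surface given by a point of a triangle. -/
def basePt (a : TriPoint τ.Tri) : S := τ.chart a.1 a.2

/-- The point of the cover given by a point of a triangle in a sheet. -/
def coverPt (a : TriPoint (τ.Tri × Bool)) : τ.Cover := Quot.mk _ a

/-- The points of triangles that are mapped to punctures. -/
def deleted : Set (TriPoint τ.Tri) := {a | τ.basePt a ∉ Pᶜ}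

/-- The points of triangles of the cover that lie over punctures. -/
def coverDeleted : Set (TriPoint (τ.Tri × Bool)) := {a | τ.coverPt a ∉ {x | τ.proj x ∈ Pᶜ}}

variable {τ} in
theorem basePt_mem {a : TriPoint τ.Tri} (h : a ∉ τ.deleted) : τ.basePt a ∈ Pᶜ := not_not.1 h

variable {τ} in
theorem coverPt_mem {a : TriPoint (τ.Tri × Bool)} (h : a ∉ τ.coverDeleted) :
    τ.proj (τ.coverPt a) ∈ Pᶜ := not_not.1 h

/-- The point of the punctured surface given by a point of a triangle. -/
def basePt₀ (a : {a : TriPoint τ.Tri // a ∉ τ.deleted}) : ↥(Pᶜ) := ⟨τ.basePt a.1, basePt_mem a.2⟩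

/-- The point of the cover given by a point of a triangle in a sheet. -/
def coverPt₁ (a : {a : TriPoint (τ.Tri × Bool) // a ∉ (∅ : Set (TriPoint (τ.Tri × Bool)))}) :
    τ.Cover := τ.coverPt a.1

/-- The point of the punctured cover given by a point of a triangle in a sheet. -/
def coverPt₀ (a : {a : TriPoint (τ.Tri × Bool) // a ∉ τ.coverDeleted}) : τ.PuncturedCover :=
  ⟨τ.coverPt a.1, coverPt_mem a.2⟩

theorem basePt_eq_iff (a b : TriPoint τ.Tri) :
    τ.basePt a = τ.basePt b ↔ Relation.EqvGen (SideGlue τ.pair) a b := τ.chart_eq_iff a b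

theorem coverGlue_eq : τ.CoverGlue = SideGlue (doublePair τ.pair) := by
  funext a b
  exact propext sideGlue_doublePair_iff.symm

theorem coverPt_eq_iff (a b : TriPoint (τ.Tri × Bool)) :
    τ.coverPt a = τ.coverPt b ↔ Relation.EqvGen (SideGlue (doublePair τ.pair)) a b := by
  rw [← coverGlue_eq]
  exact Quot.eq

theorem isQuotientMap_coverPt : Topology.IsQuotientMap τ.coverPt := isQuotientMap_quot_mk

theorem mem_coverDeleted {a : TriPoint (τ.Tri × Bool)} :
    a ∈ τ.coverDeleted ↔ (⟨a.1.1, a.2⟩ : TriPoint τ.Tri) ∈ τ.deleted := Iff.rfl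

variable {τ} (hS : IsMarkedSurface M P) (hτ : τ.IsSkewedGentle)

include hS in
-- Finitely many triangles form a compact space and `S` is Hausdorff.
theorem isQuotientMap_basePt : Topology.IsQuotientMap τ.basePt := by
  have := τ.finite_tri
  have := hS.t2
  refine .of_surjective_continuous (fun s => ?_) (continuous_sigma τ.continuous_chart)
  obtain ⟨t, x, h⟩ := τ.chart_surjective s
  exact ⟨⟨t, x⟩, h⟩

include hτ in
-- A puncture is represented by the enclosed vertex of a self-folded triangle, and that vertex is
-- alone in its class.
theorem IsSkewedGentle.exists_of_mem_deleted {a : TriPoint τ.Tri} (ha : a ∈ τ.deleted) :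
    ∃ i, a.2 = triangleVertex i ∧ τ.pair (a.1, i + 1) = (a.1, i + 2) := by
  obtain ⟨t, i, h, hp⟩ := hτ.puncture_enclosed _ (not_not.1 ha)
  obtain rfl := eq_of_eqvGen_of_pair_eq τ.pair_pair h ((τ.basePt_eq_iff ⟨t, _⟩ a).1 hp)
  exact ⟨i, rfl, h⟩

include hS in
theorem isOpen_compl_punctures : IsOpen (Pᶜ) := by
  have := hS.t2
  exact hS.finite_punctures.isClosed.isOpen_compl

include hS hτ

/-- The punctured surface is glued from triangles. -/
theorem isGlued_base : IsGlued τ.pair τ.deleted τ.basePt₀ :=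
  IsGlued.restrict (isQuotientMap_basePt hS) τ.basePt_eq_iff τ.pair_pair
    (isOpen_compl_punctures hS) fun _ ha => (hτ.exists_of_mem_deleted ha).imp fun _ h => h.1

omit hS hτ in
/-- The cover is glued from triangles. -/
theorem isGlued_cover : IsGlued (doublePair τ.pair) ∅ τ.coverPt₁ :=
  IsGlued.of_isQuotientMap τ.isQuotientMap_coverPt τ.coverPt_eq_iff
    (doublePair_involutive τ.pair_pair)

/-- The punctured cover is glued from triangles. -/
theorem isGlued_puncturedCover : IsGlued (doublePair τ.pair) τ.coverDeleted τ.coverPt₀ :=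
  IsGlued.restrict τ.isQuotientMap_coverPt τ.coverPt_eq_iff (doublePair_involutive τ.pair_pair)
    ((isOpen_compl_punctures hS).preimage τ.proj.continuous)
    fun a ha => (hτ.exists_of_mem_deleted (a := ⟨a.1.1, a.2⟩) ha).imp fun _ h => h.1

omit hτ in
-- A vertex that is not a puncture is a marked point, hence lies on a boundary segment, which is a
-- side that is not glued.
theorem fanEnds (t : τ.Tri) (c : Fin 3) (h : (⟨t, triangleVertex c⟩ : TriPoint τ.Tri) ∉ τ.deleted) :
    FanEnds τ.pair (t, c) := by
  have := τ.finite_tri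
  have h1 : τ.chart t (triangleVertex c) ∈ M ∪ P := by
    rw [← τ.vertices]; exact ⟨t, c, rfl⟩
  have h2 := hS.marked_subset (h1.resolve_right (not_not.1 h))
  rw [← τ.boundary_segments] at h2
  obtain ⟨t', i, x, hi, hx, e⟩ := h2
  exact fanEnds_of_eqvGen τ.pair_pair (c := (t, c)) (b := ⟨t', x⟩)
    ((τ.basePt_eq_iff ⟨t, triangleVertex c⟩ ⟨t', x⟩).1 e.symm) hi hx

omit hτ in
theorem exists_potential : ∃ h : TriPoint τ.Tri → SwapGroup (τ.Tri × Fin 3),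
    IsPotential τ.pair τ.deleted h (sideLabel τ.pair) ∧
      ∀ a : TriPoint τ.Tri, (∀ i, a.2.1 i ≠ 0) → h a = 1 :=
  exists_isPotential τ.pair_pair _ (fanEnds hS)

omit hτ in
/-- The potential of the triangulated surface. -/
noncomputable def potential : TriPoint τ.Tri → SwapGroup (τ.Tri × Fin 3) :=
  (exists_potential hS).choose

omit hτ in
theorem isPotential_potential : IsPotential τ.pair τ.deleted (potential hS) (sideLabel τ.pair) :=
  (exists_potential hS).choose_spec.1

omit hτ in
theorem potential_bary (t : τ.Tri) : potential hS ⟨t, ClosedTriangle.bary⟩ = 1 :=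
  (exists_potential hS).choose_spec.2 _ fun i => by
    change (1 / 3 : ℝ) ≠ 0
    norm_num

/-- The holonomy of the punctured surface. -/
noncomputable def baseHol : (isGlued_base hS hτ).Holonomy (potential hS) :=
  ((isGlued_base hS hτ).nonempty_holonomy (isPotential_potential hS)).some

omit hτ in
/-- The potential of the cover. -/
noncomputable def coverPotential : TriPoint (τ.Tri × Bool) → SwapGroup (τ.Tri × Fin 3) :=
  doublePotential τ.deleted (potential hS)

theorem isPotential_coverPotential : IsPotential (doublePair τ.pair) ∅ (coverPotential hS)
    (doubleLabel τ.pair) := by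
  refine isPotential_doublePotential (isPotential_potential hS) (isGlued_base hS hτ).saturated
    (fun i j a b ha hs => ?_) _
  obtain ⟨c, hc, hpair⟩ := hτ.exists_of_mem_deleted ha
  rcases hs.vertex τ.pair_pair hc with ⟨rfl, -, -⟩ | ⟨rfl, -⟩
  · rw [FoldedSide, hpair]
    exact ⟨rfl, fun h => Fin.add_one_ne_add_two c (congrArg Prod.snd h).symm⟩
  · have : τ.pair (a.1, c + 2) = (a.1, c + 1) := by rw [← hpair, τ.pair_pair]
    rw [FoldedSide, this]
    exact ⟨rfl, fun h => Fin.add_one_ne_add_two c (congrArg Prod.snd h)⟩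

/-- The holonomy of the cover. -/
noncomputable def coverHol : (isGlued_cover (τ := τ)).Holonomy (coverPotential hS) :=
  (isGlued_cover.nonempty_holonomy (isPotential_coverPotential hS hτ)).some

omit hτ in
-- Within one sheet the sheet factors cancel, so upstairs and downstairs ratios agree.
theorem coverPotential_ratio {a b : TriPoint (τ.Tri × Bool)} (ha : a ∉ τ.coverDeleted)
    (hb : b ∉ τ.coverDeleted) (h : a.1 = b.1) :
    coverPotential hS a * (coverPotential hS b)⁻¹ =
      potential hS ⟨a.1.1, a.2⟩ * (potential hS ⟨b.1.1, b.2⟩)⁻¹ := by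
  rw [coverPotential, doublePotential, doublePotential, if_neg (mt τ.mem_coverDeleted.2 ha),
    if_neg (mt τ.mem_coverDeleted.2 hb), h]
  group

omit hS hτ in
variable (τ) in
/-- The projection of the punctured cover to the punctured surface. -/
def puncturedProj : C(τ.PuncturedCover, ↥(Pᶜ)) := ⟨fun x => ⟨τ.proj x.1, x.2⟩, by fun_prop⟩

theorem fill_sg {x y : FundamentalGroupoid τ.PuncturedCover}
    (a b : {a : TriPoint (τ.Tri × Bool) // a ∉ τ.coverDeleted}) (h : a.1.1 = b.1.1)
    (hx : τ.coverPt₀ a = x.as) (hy : τ.coverPt₀ b = y.as) :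
    τ.fill.map ((isGlued_puncturedCover hS hτ).sg a b h hx hy) =
      isGlued_cover.sg (x := τ.fill.obj x) (y := τ.fill.obj y) ⟨a.1, id⟩ ⟨b.1, id⟩ h
        (congrArg Subtype.val hx) (congrArg Subtype.val hy) :=
  (isGlued_puncturedCover hS hτ).map_sg (isGlued_cover (τ := τ))
      ⟨Subtype.val, continuous_subtype_val⟩ id (fun _ _ => id) (fun _ => rfl) a b h hx hy

omit hS hτ in
/-- The point of the surface under a point of the cover. -/
def toBase (a : {a : TriPoint (τ.Tri × Bool) // a ∉ τ.coverDeleted}) :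
    {a : TriPoint τ.Tri // a ∉ τ.deleted} := ⟨⟨a.1.1.1, a.1.2⟩, a.2⟩

theorem puncturedProj_sg {x y : FundamentalGroupoid τ.PuncturedCover}
    (a b : {a : TriPoint (τ.Tri × Bool) // a ∉ τ.coverDeleted}) (h : a.1.1 = b.1.1)
    (hx : τ.coverPt₀ a = x.as) (hy : τ.coverPt₀ b = y.as) :
    (FundamentalGroupoid.map τ.puncturedProj).map ((isGlued_puncturedCover hS hτ).sg a b h hx hy) =
      (isGlued_base hS hτ).sg (x := (FundamentalGroupoid.map τ.puncturedProj).obj x)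
        (y := (FundamentalGroupoid.map τ.puncturedProj).obj y) (toBase a) (toBase b)
        (congrArg Prod.fst h) (congrArg τ.puncturedProj hx) (congrArg τ.puncturedProj hy) :=
  (isGlued_puncturedCover hS hτ).map_sg (isGlued_base hS hτ) τ.puncturedProj Prod.fst
    (fun _ h => h) (fun _ => rfl) a b h hx hy

/-- Both holonomies are multiplicative, so it suffices to compare them on segments, where they are
ratios of potentials. -/
theorem coverHol_fill {x y : FundamentalGroupoid τ.PuncturedCover} (f : x ⟶ y) :
    (coverHol hS hτ).toFun (τ.fill.map f) =
      (baseHol hS hτ).toFun ((FundamentalGroupoid.map τ.puncturedProj).map f) := by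
  induction (isGlued_puncturedCover hS hτ).segGen f with
  | id x =>
    rw [CategoryTheory.Functor.map_id, CategoryTheory.Functor.map_id]
    exact ((coverHol hS hτ).map_id _).trans ((baseHol hS hτ).map_id _).symm
  | comp f g _ _ h1 h2 =>
    rw [CategoryTheory.Functor.map_comp, CategoryTheory.Functor.map_comp, (coverHol hS hτ).map_comp,
      (baseHol hS hτ).map_comp, h1, h2]
  | sg a b h hx hy =>
    have h1 := (congrArg (coverHol hS hτ).toFun (fill_sg hS hτ a b h hx hy)).trans
      ((coverHol hS hτ).map_sg _ _ _ _ _)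
    have h2 := (congrArg (baseHol hS hτ).toFun (puncturedProj_sg hS hτ a b h hx hy)).trans
      ((baseHol hS hτ).map_sg _ _ _ _ _)
    exact h1.trans ((coverPotential_ratio hS a.2 b.2 h).trans h2.symm)

end IdealTriangulation

/-! ## Faithfulness of the holonomy of the cover -/

namespace IsGlued

variable {I : Type} {pair : I × Fin 3 → I × Fin 3} {D : Set (TriPoint I)} {Z : Type*}
  [TopologicalSpace Z] {π : {a : TriPoint I // a ∉ D} → Z} (hG : IsGlued pair D π)
include hG

theorem exists_gen (x : FundamentalGroupoid Z) : ∃ (v : I) (p : hG.crossings.B v ⟶ x),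
    ∀ f : x ⟶ x, hG.crossings.Gen (p ≫ f ≫ Groupoid.inv p) := by
  obtain ⟨a, ha⟩ := hG.isQuotientMap.surjective x.as
  refine ⟨a.1.1, hG.sg (x := hG.bary a.1.1) (hG.bt a.1.1) a rfl rfl ha, fun f => ?_⟩
  have h := hG.gen_of_hom f a a ha ha
  have h2 := hG.inv_sg (x := hG.bary a.1.1) (y := x) (hG.bt a.1.1) a rfl rfl ha
  exact h2.symm ▸ h

omit hG in
theorem Holonomy.map_cross {Γ : Type*} [Group Γ] {h : TriPoint I → Γ} {l : I × Fin 3 → Γ}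
    {hG : IsGlued pair D π} (L : hG.Holonomy h) (hh : IsPotential pair D h l) {v v₁ : I}
    {i j : Fin 3} (e : pair (v, i) = (v₁, j)) (n : (v, i) ≠ (v₁, j)) :
    L.toFun (hG.cross e n) =
      h ⟨v, ClosedTriangle.bary⟩ * l (v, i) * (h ⟨v₁, ClosedTriangle.bary⟩)⁻¹ := by
  refine (L.map_comp _ _).trans ((congrArg₂ (· * ·) (L.map_sg _ _ _ _ _)
    (L.map_sg _ _ _ _ _)).trans ?_)
  rw [hh i j _ _ (hG.mt v i).2 (hG.sideStep_mt e n)]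
  change h ⟨v, ClosedTriangle.bary⟩ * (h (hG.mt v i).1)⁻¹ * (h (hG.mt v i).1 * l (v, i) *
    (h ⟨v₁, ClosedTriangle.bary⟩)⁻¹) = _
  group

end IsGlued

/-- The orientation-reversing identification of two sides of one triangle fixes their common vertex.
-/
theorem SideMatch.triangleVertex {i j : Fin 3} (h : i ≠ j) : ∃ k, k ≠ i ∧ k ≠ j ∧
    SideMatch i j (triangleVertex k) (triangleVertex k) ∧
    SideMatch j i (triangleVertex k) (triangleVertex k) := by
  rcases Fin.eq_or_of_three i j with rfl | rfl | rfl
  · exact absurd rfl h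
  · refine ⟨i + 2, Fin.add_two_ne i, (Fin.add_one_ne_add_two i).symm, ?_⟩
    simp [SideMatch, _root_.triangleVertex, Fin.add_one_add_two, Fin.add_one_add_one, (Fin.add_two_ne i).symm]
  · refine ⟨i + 1, Fin.add_one_ne i, Fin.add_one_ne_add_two i, ?_⟩
    simp [SideMatch, _root_.triangleVertex, Fin.add_two_add_two, Fin.add_two_add_one,
      (Fin.add_one_ne_add_two i).symm, (Fin.add_one_ne i).symm]

namespace IdealTriangulation

variable {S : Type*} [TopologicalSpace S] [ChartedSpace (EuclideanHalfSpace 2) S] {M P : Set S}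
  {τ : IdealTriangulation M P}

/-- The only geometric point is `fold_cr`: both crossings of a fold can be moved to its endpoint
over the puncture, which belongs to the cover, and there they coincide. -/
theorem isOver_cover : (isGlued_cover (τ := τ)).crossings.IsOver τ.pair Prod.fst where
  involutive := doublePair_involutive τ.pair_pair
  involutive' := τ.pair_pair
  pair_over {v v₁ i j} e := (doublePair_eq_iff.1 e).1
  ne_over {v v₁ i j} e n := ne_of_doublePair e n
  fold_pair {v v₁ i j} e ht hij := by
    obtain ⟨t, s⟩ := v
    obtain ⟨t', s'⟩ := v₁
    obtain rfl : t' = t := ht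
    rw [doublePair_eq_iff] at e ⊢
    have h1 : τ.pair (t', j) = (t', i) := by rw [← e.1, τ.pair_pair]
    have h2 : FoldedSide τ.pair (t', i) := by
      rw [FoldedSide, e.1]; exact ⟨rfl, fun h => hij (congrArg Prod.snd h).symm⟩
    have h3 : FoldedSide τ.pair (t', j) := by
      rw [FoldedSide, h1]; exact ⟨rfl, fun h => hij (congrArg Prod.snd h)⟩
    rw [if_pos h3]
    rw [if_pos h2] at e
    exact ⟨h1, e.2⟩
  fold_cr {v v₁ i j} e n e' n' _ hij := by
    obtain ⟨k, -, -, h1, h2⟩ := SideMatch.triangleVertex hij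
    have hs : SideStep (doublePair τ.pair) i j ⟨v, triangleVertex k⟩ ⟨v₁, triangleVertex k⟩ :=
      ⟨e, n, h1⟩
    have e1 := (isGlued_cover (τ := τ)).sg_comp_sg_eq_cross
      (x := ⟨τ.coverPt ⟨v, triangleVertex k⟩⟩) (a := ⟨⟨v, triangleVertex k⟩, id⟩)
      (a' := ⟨⟨v₁, triangleVertex k⟩, id⟩) e n rfl rfl hs rfl
      ((τ.coverPt_eq_iff _ _).2 (.rel _ _ hs.glue)).symm
    have e2 := (isGlued_cover (τ := τ)).sg_comp_sg_eq_cross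
      (x := ⟨τ.coverPt ⟨v, triangleVertex k⟩⟩) (a := ⟨⟨v, triangleVertex k⟩, id⟩)
      (a' := ⟨⟨v₁, triangleVertex k⟩, id⟩) e' n' rfl rfl ⟨e', n', h2⟩ rfl
      ((τ.coverPt_eq_iff _ _).2 (.rel _ _ hs.glue)).symm
    exact e1.symm.trans e2

variable (hS : IsMarkedSurface M P) (hτ : τ.IsSkewedGentle)
include hS hτ

omit hS in
theorem bary_notMem_deleted (t : τ.Tri) :
    (⟨t, ClosedTriangle.bary⟩ : TriPoint τ.Tri) ∉ τ.deleted := fun h => by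
  obtain ⟨i, hi, -⟩ := hτ.exists_of_mem_deleted h
  exact ClosedTriangle.bary_ne_vertex i hi

theorem coverPotential_bary (v : τ.Tri × Bool) :
    coverPotential hS ⟨v, ClosedTriangle.bary⟩ = sheetElt v.2 := by
  rw [coverPotential, doublePotential, if_neg (bary_notMem_deleted hτ v.1),
    potential_bary hS, one_mul]

/-- Between barycentres the sheet factors of the potential and of the label cancel, so each crossing
has the label of the side below it and the reduced-word argument applies. -/
theorem coverHol_injective {x y : FundamentalGroupoid τ.Cover} {f g : x ⟶ y}
    (h : (coverHol hS hτ).toFun f = (coverHol hS hτ).toFun g) : f = g := by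
  refine isOver_cover.injective (L := (coverHol hS hτ).toFun) (coverHol hS hτ).map_id
    (coverHol hS hτ).map_comp (fun {v v₁ i j} e n => ?_) isGlued_cover.exists_gen h
  refine ((coverHol hS hτ).map_cross (isPotential_coverPotential hS hτ) e n).trans ?_
  rw [coverPotential_bary hS hτ, coverPotential_bary hS hτ, doubleLabel, e]
  dsimp only
  rw [← mul_assoc, mul_inv_cancel_right, ← mul_assoc, sheetElt_mul_self, one_mul]

end IdealTriangulation

/-! ## The holonomy of the orbifold groupoid -/

namespace IdealTriangulation

variable {S : Type*} [TopologicalSpace S] [ChartedSpace (EuclideanHalfSpace 2) S] {M P : Set S}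
  {τ : IdealTriangulation M P} (hS : IsMarkedSurface M P) (hτ : τ.IsSkewedGentle)

/-- The points of the triangle `t` near its vertex `i`. -/
def nearVertex (τ : IdealTriangulation M P) (t : τ.Tri) (i : Fin 3) : Set (TriPoint τ.Tri) :=
  {a | a.1 = t ∧ 1 / 2 < a.2.1 i}

/-- Points close to the enclosed vertex are away from the opposite side, so only the two folded
sides can be crossed. -/
theorem sideStep_nearVertex {t : τ.Tri} {i : Fin 3} (h : τ.pair (t, i + 1) = (t, i + 2))
    {a b : TriPoint τ.Tri} (ha : a ∈ τ.nearVertex t i) {k j : Fin 3}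
    (hs : SideStep τ.pair k j a b) : b ∈ τ.nearVertex t i ∧ FoldedSide τ.pair (a.1, k) := by
  obtain ⟨t', x⟩ := a
  obtain ⟨t'', y⟩ := b
  obtain ⟨rfl, hx⟩ := ha
  obtain ⟨e, n, h1, h2, h3, h4⟩ := hs
  dsimp only at *
  rcases Fin.eq_or_of_three i k with rfl | rfl | rfl
  · linarith
  · rw [h] at e
    obtain ⟨rfl, rfl⟩ := Prod.ext_iff.1 e
    refine ⟨⟨rfl, ?_⟩, ?_⟩
    · rw [Fin.add_one_add_two, Fin.add_two_add_one] at h4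
      rwa [← h4]
    · rw [FoldedSide, h]
      exact ⟨rfl, fun h => Fin.add_one_ne_add_two i (congrArg Prod.snd h).symm⟩
  · have h' : τ.pair (t', i + 2) = (t', i + 1) := by rw [← h, τ.pair_pair]
    rw [h'] at e
    obtain ⟨rfl, rfl⟩ := Prod.ext_iff.1 e
    refine ⟨⟨rfl, ?_⟩, ?_⟩
    · rw [Fin.add_one_add_two, Fin.add_two_add_one] at h3
      rwa [← h3]
    · rw [FoldedSide, h']
      exact ⟨rfl, fun h => Fin.add_one_ne_add_two i (congrArg Prod.snd h)⟩

theorem nearVertex_saturated {t : τ.Tri} {i : Fin 3} (h : τ.pair (t, i + 1) = (t, i + 2))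
    {a b : TriPoint τ.Tri} (hab : τ.basePt a = τ.basePt b) :
    a ∈ τ.nearVertex t i ↔ b ∈ τ.nearVertex t i :=
  eqvGen_iff_of_glue (p := (· ∈ τ.nearVertex t i)) (fun a b hs => by
    obtain ⟨k, j, hs⟩ := hs
    exact ⟨fun ha => (sideStep_nearVertex h ha hs).1,
      fun hb => (sideStep_nearVertex h hb (SideStep.symm τ.pair_pair hs)).1⟩) ((τ.basePt_eq_iff a b).1 hab)

include hS in
theorem isOpen_image_nearVertex {t : τ.Tri} {i : Fin 3} (h : τ.pair (t, i + 1) = (t, i + 2)) :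
    IsOpen (τ.basePt '' τ.nearVertex t i) := by
  rw [← (isQuotientMap_basePt hS).isOpen_preimage]
  have : τ.basePt ⁻¹' (τ.basePt '' τ.nearVertex t i) = τ.nearVertex t i := by
    refine Set.Subset.antisymm ?_ (Set.subset_preimage_image _ _)
    rintro a ⟨b, hb, e⟩
    exact (nearVertex_saturated h e).1 hb
  rw [this, isOpen_sigma_iff]
  intro t'
  by_cases ht : t' = t
  · have : Sigma.mk t' ⁻¹' τ.nearVertex t i = {x : ClosedTriangle | 1 / 2 < x.1 i} := by
      ext x; simp [nearVertex, ht]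
    rw [this]
    exact isOpen_lt continuous_const ((continuous_apply i).comp continuous_subtype_val)
  · convert isOpen_empty
    ext x; simp [nearVertex, ht]

/-- Every gluing near the puncture is across a folded side and contributes a factor θ, of square 1.
-/
theorem potential_nearVertex {t : τ.Tri} {i : Fin 3} (h : τ.pair (t, i + 1) = (t, i + 2))
    {a b : {a : TriPoint τ.Tri // a ∉ τ.deleted}} (ha : a.1 ∈ τ.nearVertex t i)
    (hab : τ.basePt₀ a = τ.basePt₀ b) :
    (potential hS a.1)⁻¹ * potential hS b.1 = 1 ∨
      (potential hS a.1)⁻¹ * potential hS b.1 = theta := by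
  obtain ⟨b, hb⟩ := b
  replace hab := reflTransGen_of_eqvGen τ.pair_pair
    ((τ.basePt_eq_iff a.1 b).1 (congrArg Subtype.val hab))
  have key : b ∈ τ.nearVertex t i ∧ ((potential hS a.1)⁻¹ * potential hS b = 1 ∨
      (potential hS a.1)⁻¹ * potential hS b = theta) := by
    have hsat : ∀ {c d}, SideGlue τ.pair c d → d ∉ τ.deleted → c ∉ τ.deleted := fun hcd hd hc => by
      have : τ.basePt _ = τ.basePt _ := (τ.basePt_eq_iff _ _).2 (.rel _ _ hcd)
      exact hd (by rwa [deleted, Set.mem_ofPred_eq, ← this])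
    induction hab with
    | refl => exact ⟨ha, Or.inl (inv_mul_cancel _)⟩
    | @tail c d _ hcd ih =>
      have hc := hsat hcd hb
      obtain ⟨h1, h2⟩ := ih hc
      obtain ⟨k, j, hs⟩ := hcd
      obtain ⟨h3, h4⟩ := sideStep_nearVertex h h1 hs
      refine ⟨h3, ?_⟩
      rw [isPotential_potential hS k j c d hc hs, sideLabel, if_pos h4, ← mul_assoc]
      rcases h2 with h2 | h2
      · right; rw [h2, one_mul]
      · left; rw [h2, theta_mul_self]
  exact key.2

/-- The holonomy of a path near a puncture is trivial or the involution. -/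
theorem baseHol_nearVertex {t : τ.Tri} {i : Fin 3} (h : τ.pair (t, i + 1) = (t, i + 2))
    {x y : FundamentalGroupoid ↥(Pᶜ)} (p : Path x.as y.as)
    (hp : ∀ s, (p s).1 ∈ τ.basePt '' τ.nearVertex t i)
    (a b : {a : TriPoint τ.Tri // a ∉ τ.deleted}) (ha : τ.basePt₀ a = x.as)
    (hb : τ.basePt₀ b = y.as) :
    (potential hS a.1)⁻¹ * (baseHol hS hτ).toFun (pathHom p) * potential hS b.1 = 1 ∨
      (potential hS a.1)⁻¹ * (baseHol hS hτ).toFun (pathHom p) * potential hS b.1 = theta := by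
  set L := baseHol hS hτ
  have hG := isGlued_base hS hτ
  have key := hG.subpath_induction p (Q := fun s t f =>
    ∀ a b : {a : TriPoint τ.Tri // a ∉ τ.deleted}, τ.basePt₀ a = p s → τ.basePt₀ b = p t →
      (potential hS a.1)⁻¹ * L.toFun f * potential hS b.1 = 1 ∨
      (potential hS a.1)⁻¹ * L.toFun f * potential hS b.1 = theta) ?_ ?_
  · obtain ⟨h1, h2, e⟩ := pathHom_subpath_eq p
    rw [e, L.map_comp, L.map_comp]
    have hid : ∀ {x y : FundamentalGroupoid ↥(Pᶜ)} (h : x = y), L.toFun (eqToHom h) = 1 := by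
      rintro x _ rfl; exact L.map_id x
    rw [hid, hid, one_mul, mul_one]
    exact key a b (ha.trans p.source.symm) (hb.trans p.target.symm)
  · intro r s u f g hf hg a b ha hb
    obtain ⟨c, hc⟩ := hG.isQuotientMap.surjective (p s)
    have e : (potential hS a.1)⁻¹ * L.toFun (f ≫ g) * potential hS b.1 =
        ((potential hS a.1)⁻¹ * L.toFun f * potential hS c.1) *
        ((potential hS c.1)⁻¹ * L.toFun g * potential hS b.1) := by
      rw [L.map_comp]; group
    rw [e]
    rcases hf a c ha hc with h1 | h1 <;> rcases hg c b hc hb with h2 | h2 <;>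
      simp [h1, h2, theta_mul_self]
  · intro s u v b₀ ε hε hb₀ hv a a' ha ha'
    obtain ⟨b, hb, hn⟩ := hG.exists_near_of_mem_cone hε (a := a)
      (by have := hv 0; rw [Path.source] at this; rwa [ha])
    obtain ⟨b', hb', hn'⟩ := hG.exists_near_of_mem_cone hε (a := a')
      (by have := hv 1; rw [Path.target] at this; rwa [ha'])
    rw [hG.pathHom_eq_of_mem_cone (x := ⟨p s⟩) (y := ⟨p u⟩) (w := ⟨τ.basePt₀ b₀⟩) hε
      (p.subpath s u) hv hn hn' rfl hb hb' ha ha', L.map_comp, L.map_sg, L.map_sg]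
    have hmem : b.1 ∈ τ.nearVertex t i := by
      obtain ⟨c, hc, e⟩ := hp v
      exact (nearVertex_saturated h (e.trans (congrArg Subtype.val (hb.trans hb₀)).symm)).1 hc
    have h2 := potential_nearVertex hS h hmem (hb.trans hb'.symm)
    have e : (potential hS a.1)⁻¹ * (potential hS a.1 * (potential hS b.1)⁻¹ *
        (potential hS b'.1 * (potential hS a'.1)⁻¹)) * potential hS a'.1 =
        (potential hS b.1)⁻¹ * potential hS b'.1 := by group
    rwa [e]

end IdealTriangulation

/-! ### Concentric circles around a puncture -/

namespace PunctureDisc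

variable {S : Type*} [TopologicalSpace S] {P : Set S} (d : PunctureDisc P)

/-- The point of the disc at the radius `r` and the angle `2 π s`. -/
noncomputable def polar (r s : unitInterval) : ℂ := r * Circle.exp (2 * Real.pi * s)

omit [TopologicalSpace S] in
theorem norm_polar (r s : unitInterval) : ‖polar r s‖ = r := by
  rw [polar, norm_mul, Circle.norm_coe, mul_one, Complex.norm_real, Real.norm_of_nonneg r.2.1]

theorem polar_mem (r s : unitInterval) : polar r s ∈ Metric.closedBall (0 : ℂ) 1 := by
  rw [mem_closedBall_zero_iff, norm_polar]; exact r.2.2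

theorem continuous_polar : Continuous fun z : unitInterval × unitInterval => polar z.1 z.2 := by
  unfold polar; fun_prop

theorem polar_one_right (r : unitInterval) : polar r 1 = polar r 0 := by
  simp [polar]

theorem toFun_polar_mem {r : unitInterval} (hr : r ≠ 0) (s : unitInterval) :
    d.toFun (polar r s) ∈ Pᶜ := fun h => hr (by
  have := d.only_center _ (polar_mem r s) h
  rw [← norm_eq_zero, norm_polar] at this
  exact Subtype.ext this)

/-- The circle of radius `r`. -/
noncomputable def circlePath {r : unitInterval} (hr : r ≠ 0) :
    Path (X := ↥(Pᶜ)) ⟨d.toFun (polar r 0), d.toFun_polar_mem hr 0⟩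
      ⟨d.toFun (polar r 0), d.toFun_polar_mem hr 0⟩ where
  toFun s := ⟨d.toFun (polar r s), d.toFun_polar_mem hr s⟩
  continuous_toFun := by
    refine Continuous.subtype_mk ?_ _
    exact d.continuousOn.comp_continuous (continuous_polar.comp (continuous_const.prodMk continuous_id))
      (polar_mem r)
  source' := rfl
  target' := Subtype.ext (congrArg d.toFun (polar_one_right r))

/-- The radius from the boundary circle to the circle of radius `r`. -/
theorem exists_loop_comp {r : unitInterval} (hr : r ≠ 0) :
    ∃ q : Path (X := ↥(Pᶜ)) ⟨d.toFun (1 : Circle), d.notMem 1⟩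
      ⟨d.toFun (polar r 0), d.toFun_polar_mem hr 0⟩,
      (q.trans (d.circlePath hr)).Homotopic (d.loop.trans q) := by
  have hr0 : 0 < (r : ℝ) := lt_of_le_of_ne r.2.1 (fun h => hr (Subtype.ext h.symm))
  -- The radius decreases linearly from 1 to `r` and stays positive, so the homotopy avoids the
  -- puncture.
  let ρ : unitInterval → unitInterval := fun s => ⟨1 - s * (1 - r), by
    constructor
    · nlinarith [s.2.1, s.2.2, r.2.1, r.2.2]
    · nlinarith [s.2.1, s.2.2, r.2.1, r.2.2]⟩
  have hρ : Continuous ρ := by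
    refine Continuous.subtype_mk ?_ _
    fun_prop
  have hρ0 : ∀ s, ρ s ≠ 0 := fun s h => by
    have : (1 : ℝ) - s * (1 - r) = 0 := congrArg Subtype.val h
    nlinarith [s.2.1, s.2.2, r.2.1, r.2.2]
  have e0 : ρ 0 = 1 := Subtype.ext (by simp [ρ])
  have e1 : ρ 1 = r := Subtype.ext (by simp [ρ])
  let F : C(unitInterval × unitInterval, ↥(Pᶜ)) :=
    ⟨fun z => ⟨d.toFun (polar (ρ z.1) z.2), d.toFun_polar_mem (hρ0 _) _⟩, by
      refine Continuous.subtype_mk ?_ _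
      refine d.continuousOn.comp_continuous ?_ (fun _ => polar_mem _ _)
      exact continuous_polar.comp ((hρ.comp continuous_fst).prodMk continuous_snd)⟩
  have h1 : polar 1 0 = (1 : Circle) := by simp [polar]
  let q : Path (X := ↥(Pᶜ)) ⟨d.toFun (1 : Circle), d.notMem 1⟩
      ⟨d.toFun (polar r 0), d.toFun_polar_mem hr 0⟩ :=
    { toFun := fun s => F (s, 0)
      continuous_toFun := F.continuous.comp (by fun_prop)
      source' := Subtype.ext (by change d.toFun (polar (ρ 0) 0) = _; rw [e0, h1])
      target' := Subtype.ext (by change d.toFun (polar (ρ 1) 0) = _; rw [e1]) }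
  refine ⟨q, Path.Homotopic.of_square F _ _ _ _ (fun _ => rfl) (fun s => ?_) (fun s => ?_)
    fun s => ?_⟩
  · exact Subtype.ext (by change d.toFun (polar (ρ 1) s) = d.toFun (polar r s); rw [e1])
  · refine Subtype.ext ?_
    change d.toFun (polar (ρ 0) s) = d.toFun (Circle.exp (2 * Real.pi * (s : ℝ)))
    rw [e0]; simp [polar]
  · refine Subtype.ext ?_
    change d.toFun (polar (ρ s) 1) = d.toFun (polar (ρ s) 0)
    rw [polar_one_right]

theorem exists_circlePath_mem {U : Set S} (hU : IsOpen U) (h : d.toFun 0 ∈ U) :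
    ∃ (r : unitInterval) (hr : r ≠ 0), ∀ s, (d.circlePath hr s).1 ∈ U := by
  have h1 := (d.continuousOn 0 (by simp)).preimage_mem_nhdsWithin (hU.mem_nhds h)
  obtain ⟨ε, hε, h2⟩ := Metric.mem_nhdsWithin_iff.1 h1
  refine ⟨⟨min (ε / 2) 1, by positivity, min_le_right _ _⟩, fun h => ?_, fun s => h2 ⟨?_, polar_mem _ _⟩⟩
  · have h3 : min (ε / 2) 1 = 0 := congrArg Subtype.val h
    have h4 : 0 < min (ε / 2) 1 := by positivity
    exact h4.ne' h3
  · rw [mem_ball_zero_iff]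
    refine (norm_polar _ s).trans_lt ?_
    exact (min_le_left _ _).trans_lt (by linarith)

end PunctureDisc

namespace IdealTriangulation

variable {S : Type*} [TopologicalSpace S] [ChartedSpace (EuclideanHalfSpace 2) S] {M P : Set S}
  {τ : IdealTriangulation M P} (hS : IsMarkedSurface M P) (hτ : τ.IsSkewedGentle)

/-- The boundary loop is freely homotopic to a circle so small that only folded sides are met; its
holonomy is thus conjugate to 1 or θ. -/
theorem baseHol_loop_mul_self (d : PunctureDisc P) :
    (baseHol hS hτ).toFun (pathHom (x := ⟨_⟩) (y := ⟨_⟩) d.loop) *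
      (baseHol hS hτ).toFun (pathHom (x := ⟨_⟩) (y := ⟨_⟩) d.loop) = 1 := by
  obtain ⟨t, i, h, hi⟩ := hτ.puncture_enclosed _ d.center_mem
  obtain ⟨r, hr, hc⟩ := d.exists_circlePath_mem (isOpen_image_nearVertex hS h)
    ⟨⟨t, triangleVertex i⟩, ⟨rfl, by rw [triangleVertex_apply_self]; norm_num⟩, hi⟩
  obtain ⟨a, ha⟩ := (isGlued_base hS hτ).isQuotientMap.surjective
    ⟨d.toFun (PunctureDisc.polar r 0), d.toFun_polar_mem hr 0⟩
  have h1 := baseHol_nearVertex hS hτ h (x := ⟨_⟩) (y := ⟨_⟩) (d.circlePath hr) hc a a ha ha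
  obtain ⟨q, hq⟩ := d.exists_loop_comp hr
  have h2 := congrArg (baseHol hS hτ).toFun (pathHom_eq (x := ⟨_⟩) (y := ⟨_⟩) hq)
  rw [← pathHom_comp (x := ⟨_⟩) (y := ⟨_⟩) (z := ⟨_⟩),
    ← pathHom_comp (x := ⟨_⟩) (y := ⟨_⟩) (z := ⟨_⟩), (baseHol hS hτ).map_comp,
    (baseHol hS hτ).map_comp] at h2
  generalize (baseHol hS hτ).toFun (pathHom (x := ⟨_⟩) (y := ⟨_⟩) (d.circlePath hr)) = u at h1 h2
  generalize (baseHol hS hτ).toFun (pathHom (x := ⟨_⟩) (y := ⟨_⟩) d.loop) = v at h2 ⊢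
  generalize (baseHol hS hτ).toFun (pathHom (x := ⟨_⟩) (y := ⟨_⟩) q) = w at h2
  have hu : u * u = 1 := by
    have e : u * u = potential hS a.1 * (((potential hS a.1)⁻¹ * u * potential hS a.1) *
        ((potential hS a.1)⁻¹ * u * potential hS a.1)) * (potential hS a.1)⁻¹ := by group
    rw [e]
    rcases h1 with h1 | h1 <;> simp [h1, theta_mul_self]
  have hv : v = w * u * w⁻¹ := by rw [h2, mul_inv_cancel_right]
  have e : v * v = w * (u * u) * w⁻¹ := by rw [hv]; group
  rw [e, hu]; group

end IdealTriangulation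

/-! ## The disc around a puncture and the faithfulness of the orbifold holonomy -/

namespace ClosedTriangle

/-- The point at the distance `r` from the vertex `i`, at the fraction `s` of the angle. -/
noncomputable def sector (i : Fin 3) (r s : unitInterval) : ClosedTriangle :=
  ⟨fun c => if c = i then 1 - r / 2 else if c = i + 1 then r / 2 * (1 - s) else r / 2 * s, fun c => by
    dsimp only
    split_ifs
    · linarith [r.2.2]
    · exact mul_nonneg (by linarith [r.2.1]) (by linarith [s.2.2])
    · exact mul_nonneg (by linarith [r.2.1]) s.2.1, by
    rw [Fin.sum_univ_three]; fin_cases i <;> simp <;> ring⟩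

variable (i : Fin 3) (r s : unitInterval)

theorem sector_self : (sector i r s).1 i = 1 - r / 2 := by simp [sector]

theorem sector_add_one : (sector i r s).1 (i + 1) = r / 2 * (1 - s) := by
  simp [sector]

theorem sector_add_two : (sector i r s).1 (i + 2) = r / 2 * s := by
  simp [sector, (Fin.add_one_ne_add_two i).symm]

theorem continuous_sector : Continuous fun z : unitInterval × unitInterval => sector i z.1 z.2 := by
  refine Continuous.subtype_mk (continuous_pi fun c => ?_) _
  by_cases h : c = i
  · simp only [h, if_true]; fun_prop
  · by_cases h' : c = i + 1
    · simp only [h', if_true, if_false, Fin.add_one_ne]; fun_prop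
    · simp only [h, h', if_false]; fun_prop

theorem sector_zero : sector i 0 s = triangleVertex i :=
  eq_vertex_iff.2 (by rw [sector_self]; simp)

theorem sector_one_eq_mix : sector i 1 s = mix s (mid (i + 2)) (mid (i + 1)) := by
  ext c
  change (sector i 1 s).1 c = (mix s (mid (i + 2)) (mid (i + 1))).1 c
  rw [mix_apply]
  rcases Fin.eq_or_of_three i c with rfl | rfl | rfl
  · rw [sector_self]
    simp only [mid, (Fin.add_two_ne c).symm, (Fin.add_one_ne c).symm, if_false]
    simp; ring
  · rw [sector_add_one]
    simp [mid]; ring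
  · rw [sector_add_two]
    simp [mid, (Fin.add_one_ne_add_two i).symm]; ring

theorem sideMatch_sector : SideMatch (i + 1) (i + 2) (sector i r 1) (sector i r 0) := by
  simp [SideMatch, Fin.add_one_add_one, Fin.add_two_add_two, Fin.add_one_add_two,
    Fin.add_two_add_one, sector_self, sector_add_one, sector_add_two]

end ClosedTriangle

open PunctureDisc in
theorem PunctureDisc.polar_surjective {z : ℂ} (hz : z ∈ Metric.closedBall (0 : ℂ) 1) :
    ∃ r s, polar r s = z := by
  rw [mem_closedBall_zero_iff] at hz
  obtain ⟨x, hx, h⟩ : ∃ x ∈ Set.Ico (0 : ℝ) (2 * Real.pi), Complex.exp (x * Complex.I) * ‖z‖ = z := by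
    refine ⟨toIcoMod Real.two_pi_pos 0 z.arg, ?_, ?_⟩
    · have := toIcoMod_mem_Ico Real.two_pi_pos 0 z.arg
      rwa [zero_add] at this
    · have h1 := Complex.norm_mul_exp_arg_mul_I z
      rw [mul_comm]
      conv_rhs => rw [← h1]
      congr 1
      rw [toIcoMod]
      rw [Complex.exp_eq_exp_iff_exists_int]
      refine ⟨-toIcoDiv Real.two_pi_pos 0 z.arg, ?_⟩
      push_cast
      simp only [zsmul_eq_mul]
      ring
  have hpi := Real.two_pi_pos
  refine ⟨⟨‖z‖, norm_nonneg _, hz⟩, ⟨x / (2 * Real.pi), div_nonneg hx.1 hpi.le,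
    (div_le_one hpi).2 hx.2.le⟩, ?_⟩
  rw [polar, Circle.coe_exp]
  dsimp only
  rw [mul_div_cancel₀ _ hpi.ne', mul_comm, h]

namespace IdealTriangulation

variable {S : Type*} [TopologicalSpace S] [ChartedSpace (EuclideanHalfSpace 2) S] {M P : Set S}
  {τ : IdealTriangulation M P} (hS : IsMarkedSurface M P) (hτ : τ.IsSkewedGentle)

open ClosedTriangle PunctureDisc

/-- The polar coordinates of a point near a vertex. -/
noncomputable def toPolar (i : Fin 3) (x : ClosedTriangle) : ℂ :=
  ((2 * (1 - x.1 i) : ℝ) : ℂ) * Circle.exp (2 * Real.pi * (x.1 (i + 2) / (1 - x.1 i)))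

theorem toPolar_sector (i : Fin 3) (r s : unitInterval) : toPolar i (sector i r s) = polar r s := by
  rw [toPolar, polar, sector_self, sector_add_two]
  by_cases hr : (r : ℝ) = 0
  · simp [hr]
  · have h1 : (r : ℝ) / 2 * s / (1 - (1 - r / 2)) = s := by
      rw [sub_sub_cancel, mul_div_cancel_left₀ _ (div_ne_zero hr two_ne_zero)]
    rw [h1]
    congr 1
    push_cast; ring

theorem toPolar_sideStep {t : τ.Tri} {i : Fin 3} (h : τ.pair (t, i + 1) = (t, i + 2))
    {k j : Fin 3} {x : ClosedTriangle} {b : TriPoint τ.Tri} (hx : x.1 i ≠ 0)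
    (hs : SideStep τ.pair k j ⟨t, x⟩ b) :
    b.1 = t ∧ b.2.1 i = x.1 i ∧ toPolar i b.2 = toPolar i x := by
  obtain ⟨t', y⟩ := b
  obtain ⟨e, n, h1, h2, h3, h4⟩ := hs
  have key : ∀ {x y : ClosedTriangle}, x.1 (i + 1) = 0 → y.1 (i + 2) = 0 → y.1 i = x.1 i →
      toPolar i y = toPolar i x := by
    intro x y hx hy hxy
    have := sum_eq x i
    rw [toPolar, toPolar, hy, hxy]
    by_cases h0 : 1 - x.1 i = 0
    · simp [h0]
    · have h5 : x.1 (i + 2) = 1 - x.1 i := by linarith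
      rw [h5, div_self h0]
      simp
  dsimp only at *
  rcases Fin.eq_or_of_three i k with rfl | rfl | rfl
  · exact absurd h1 hx
  · rw [h] at e
    obtain ⟨rfl, rfl⟩ := Prod.ext_iff.1 e
    rw [Fin.add_one_add_two, Fin.add_two_add_one] at h4
    exact ⟨rfl, h4.symm, key h1 h2 h4.symm⟩
  · have h' : τ.pair (t, i + 2) = (t, i + 1) := by rw [← h, τ.pair_pair]
    rw [h'] at e
    obtain ⟨rfl, rfl⟩ := Prod.ext_iff.1 e
    rw [Fin.add_one_add_two, Fin.add_two_add_one] at h3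
    exact ⟨rfl, h3.symm, (key h2 h1 h3).symm⟩

/-- Polar coordinates agree on points glued across the fold, so they are a left inverse of the disc
and prove its injectivity. -/
theorem toPolar_eq {t : τ.Tri} {i : Fin 3} (h : τ.pair (t, i + 1) = (t, i + 2))
    {x y : ClosedTriangle} (hx : x.1 i ≠ 0) (hxy : τ.basePt ⟨t, x⟩ = τ.basePt ⟨t, y⟩) :
    toPolar i y = toPolar i x := by
  have hxy := reflTransGen_of_eqvGen τ.pair_pair ((τ.basePt_eq_iff _ _).1 hxy)
  have key : ∀ {a b : TriPoint τ.Tri}, a.1 = t → a.2.1 i ≠ 0 →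
      Relation.ReflTransGen (SideGlue τ.pair) a b →
      b.1 = t ∧ b.2.1 i = a.2.1 i ∧ toPolar i b.2 = toPolar i a.2 := by
    intro a b ha ha' hab
    induction hab with
    | refl => exact ⟨ha, rfl, rfl⟩
    | @tail c d _ hcd ih =>
      obtain ⟨t', z⟩ := c
      obtain ⟨h1, h2, h3⟩ := ih
      obtain rfl : t' = t := h1
      obtain ⟨k, j, hs⟩ := hcd
      obtain ⟨h4, h5, h6⟩ := toPolar_sideStep h (h2.trans_ne ha') hs
      exact ⟨h4, h5.trans h2, h6.trans h3⟩
  exact (key rfl hx hxy).2.2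

theorem sector_apply_ne_zero (i : Fin 3) (r s : unitInterval) : (sector i r s).1 i ≠ 0 := by
  rw [sector_self]; linarith [r.2.2]

include hS in
-- The fan of this corner consists of the corner alone, repeated forever, whereas the fan of a
-- vertex that is not removed ends.
theorem triangleVertex_mem_deleted {t : τ.Tri} {i : Fin 3}
    (h : τ.pair (t, i + 1) = (t, i + 2)) : (⟨t, triangleVertex i⟩ : TriPoint τ.Tri) ∈ τ.deleted := by
  by_contra hm
  obtain ⟨n, hn⟩ := fanEnds hS t i hm
  have h1 : nextCorner τ.pair (t, i) = (t, i) := by simp only [nextCorner, h, Fin.add_two_add_one]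
  rw [Function.iterate_fixed h1, IsLastCorner, h] at hn
  exact Fin.add_one_ne_add_two i (congrArg Prod.snd hn).symm

include hS hτ in
/-- The disc covered by the corner of a self-folded triangle. -/
theorem exists_punctureDisc {t : τ.Tri} {i : Fin 3} (h : τ.pair (t, i + 1) = (t, i + 2)) :
    ∃ d : PunctureDisc P, ∀ r s, d.toFun (polar r s) = τ.basePt ⟨t, sector i r s⟩ := by
  let B := Metric.closedBall (0 : ℂ) 1
  let k : C(unitInterval × unitInterval, B) :=
    ⟨fun z => ⟨polar z.1 z.2, polar_mem _ _⟩, continuous_polar.subtype_mk _⟩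
  have hk : Topology.IsQuotientMap k := .of_surjective_continuous (fun z => by
    obtain ⟨r, s, e⟩ := polar_surjective z.2
    exact ⟨(r, s), Subtype.ext e⟩) k.continuous
  let G : C(unitInterval × unitInterval, S) := ⟨fun z => τ.basePt ⟨t, sector i z.1 z.2⟩,
    (τ.continuous_chart t).comp (continuous_sector i)⟩
  -- Polar coordinates identify points only at radius 0, where the sector collapses to the vertex,
  -- and at angles 0 and 1, where the two folded sides are glued.
  have hfac : Function.FactorsThrough G k := by
    rintro ⟨r, s⟩ ⟨r', s'⟩ hab
    have hab : polar r s = polar r' s' := congrArg Subtype.val hab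
    have hr : r = r' := by
      have := congrArg norm hab
      rw [norm_polar, norm_polar] at this
      exact Subtype.ext this
    subst hr
    by_cases hr : r = 0
    · subst hr
      change τ.basePt _ = τ.basePt _
      rw [sector_zero, sector_zero]
    -- Angles with the same exponential differ by an integer number of turns, here 0 or one full
    -- turn.
    · have hs : ∀ {s s' : unitInterval}, (s : ℝ) ≤ s' → polar r s = polar r s' → s = s' ∨ s = 0 ∧ s' = 1 := by
        intro s s' hle he
        rw [polar, polar, mul_right_inj' (by simpa using fun h => hr (Subtype.ext h))] at he
        obtain ⟨m, hm⟩ := Circle.exp_eq_exp.1 (Circle.ext he)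
        have hpi := Real.two_pi_pos
        have h1 : (s : ℝ) = s' + m := by
          have : 2 * Real.pi * (s : ℝ) = 2 * Real.pi * (s' + m) := by rw [hm]; ring
          exact mul_left_cancel₀ hpi.ne' this
        have h2 : m ≤ 0 := by
          by_contra hm'
          have : (1 : ℝ) ≤ m := by exact_mod_cast (by omega : 1 ≤ m)
          linarith
        have h3 : -1 ≤ m := by
          by_contra hm'
          have : (m : ℝ) ≤ -2 := by exact_mod_cast (by omega : m ≤ -2)
          linarith [s.2.1, s'.2.2]
        obtain rfl | rfl : m = 0 ∨ m = -1 := by omega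
        · left; exact Subtype.ext (by simpa using h1)
        · right
          push_cast at h1
          exact ⟨Subtype.ext (by change (s : ℝ) = 0; linarith [s.2.1, s'.2.2]),
            Subtype.ext (by change (s' : ℝ) = 1; linarith [s.2.1, s'.2.2])⟩
      have hgl : τ.basePt ⟨t, sector i r 1⟩ = τ.basePt ⟨t, sector i r 0⟩ :=
        (τ.basePt_eq_iff _ _).2 (.rel _ _ ⟨i + 1, i + 2, h, fun e =>
          Fin.add_one_ne_add_two i (congrArg Prod.snd e), sideMatch_sector i r⟩)
      change τ.basePt _ = τ.basePt _
      rcases le_total (s : ℝ) s' with hle | hle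
      · rcases hs hle hab with rfl | ⟨rfl, rfl⟩
        · rfl
        · exact hgl.symm
      · rcases hs hle hab.symm with rfl | ⟨rfl, rfl⟩
        · rfl
        · exact hgl
  classical
  let f : ℂ → S := fun z => if hz : z ∈ B then hk.lift G hfac ⟨z, hz⟩ else G (0, 0)
  have hf : ∀ r s, f (polar r s) = τ.basePt ⟨t, sector i r s⟩ := fun r s => by
    dsimp only [f]
    rw [dif_pos (polar_mem r s)]
    exact DFunLike.congr_fun (hk.lift_comp G hfac) (r, s)
  refine ⟨⟨f, ?_, ?_, ?_, ?_⟩, hf⟩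
  · rw [continuousOn_iff_continuous_domRestrict]
    have : B.domRestrict f = hk.lift G hfac := by
      funext z
      exact dif_pos z.2
    rw [this]
    exact (hk.lift G hfac).continuous
  · intro z hz z' hz' e
    obtain ⟨r, s, rfl⟩ := polar_surjective hz
    obtain ⟨r', s', rfl⟩ := polar_surjective hz'
    rw [hf, hf] at e
    have := toPolar_eq h (sector_apply_ne_zero i r s) e
    rw [toPolar_sector, toPolar_sector] at this
    exact this.symm
  · have : (0 : ℂ) = polar 0 0 := by simp [polar]
    rw [this, hf, sector_zero]
    exact not_not.1 (triangleVertex_mem_deleted hS h)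
  · intro z hz hP
    obtain ⟨r, s, rfl⟩ := polar_surjective hz
    rw [hf] at hP
    obtain ⟨j, hj, -⟩ := hτ.exists_of_mem_deleted (a := ⟨t, sector i r s⟩) (not_not.2 hP)
    dsimp only at hj
    have hij : j = i := by
      by_contra hij
      have := sector_apply_ne_zero i r s
      rw [hj, triangleVertex_apply_ne (Ne.symm hij)] at this
      exact this rfl
    subst hij
    have h1 := eq_vertex_iff.1 hj
    rw [sector_self] at h1
    have h2 : (r : ℝ) = 0 := by linarith
    simp [polar, h2]

end IdealTriangulation

/-! ### Faithfulness of the holonomy on the orbifold groupoid -/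

namespace IdealTriangulation

variable {S : Type*} [TopologicalSpace S] [ChartedSpace (EuclideanHalfSpace 2) S] {M P : Set S}
  {τ : IdealTriangulation M P} (hS : IsMarkedSurface M P) (hτ : τ.IsSkewedGentle)

/-- The holonomy of the punctured surface as a functor. -/
noncomputable def baseHolFunctor :
    FundamentalGroupoid ↥(Pᶜ) ⥤ SingleObj (SwapGroup (τ.Tri × Fin 3))ᵐᵒᵖ where
  obj _ := SingleObj.star _
  map f := MulOpposite.op ((baseHol hS hτ).toFun f)
  map_id x := congrArg MulOpposite.op ((baseHol hS hτ).map_id x)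
  map_comp f g := congrArg MulOpposite.op ((baseHol hS hτ).map_comp f g)

/-- The holonomy of the orbifold groupoid as a functor. -/
noncomputable def orbHolFunctor : OrbGroupoid P ⥤ SingleObj (SwapGroup (τ.Tri × Fin 3))ᵐᵒᵖ :=
  CategoryTheory.Quotient.lift (orbHomRel P) (baseHolFunctor hS hτ) (by
    rintro x y f g ⟨d⟩
    refine congrArg MulOpposite.op ?_
    have h1 := baseHol_loop_mul_self hS hτ d
    have h2 : (baseHol hS hτ).toFun (pathHom (x := ⟨_⟩) (y := ⟨_⟩) d.loop) *
        (baseHol hS hτ).toFun (pathHom (x := ⟨_⟩) (y := ⟨_⟩) d.loop.symm) = 1 :=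
      ((baseHol hS hτ).map_comp _ _).symm.trans ((congrArg (baseHol hS hτ).toFun
        (Groupoid.comp_inv (pathHom (x := ⟨_⟩) (y := ⟨_⟩) d.loop))).trans
        ((baseHol hS hτ).map_id _))
    exact mul_left_cancel (h1.trans h2.symm))

/-- The holonomy of the orbifold groupoid. -/
noncomputable def orbHol {x y : OrbGroupoid P} (f : x ⟶ y) : SwapGroup (τ.Tri × Fin 3) :=
  MulOpposite.unop ((orbHolFunctor hS hτ).map f)

theorem orbHol_id (x : OrbGroupoid P) : orbHol hS hτ (𝟙 x) = 1 :=
  congrArg MulOpposite.unop ((orbHolFunctor hS hτ).map_id x)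

theorem orbHol_comp {x y z : OrbGroupoid P} (f : x ⟶ y) (g : y ⟶ z) :
    orbHol hS hτ (f ≫ g) = orbHol hS hτ f * orbHol hS hτ g :=
  congrArg MulOpposite.unop ((orbHolFunctor hS hτ).map_comp f g)

theorem orbHol_down {x y : FundamentalGroupoid τ.PuncturedCover} (f : x ⟶ y) :
    orbHol hS hτ (τ.down.map f) = (coverHol hS hτ).toFun (τ.fill.map f) :=
  (coverHol_fill hS hτ f).symm

/-- The crossings of the orbifold groupoid. -/
noncomputable def orbCrossings : Crossings τ.pair (OrbGroupoid P) :=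
  (isGlued_base hS hτ).crossings.map (CategoryTheory.Quotient.functor (orbHomRel P))

/-- The image of `c` equals the image of its inverse, so it is an involution, and it may be moved
from one factor to the other. -/
theorem _root_.CategoryTheory.comp_eq_comp_of_involutive {C D : Type*} [Groupoid C] [Category D]
    (F : C ⥤ D) {u v m : C} (f₁ : u ⟶ m) (f₂ : u ⟶ m) (g₁ : m ⟶ v) (g₂ : m ⟶ v) (c c' : m ⟶ m)
    (h1 : f₁ ≫ c = f₂) (h2 : c ≫ g₂ = g₁) (hc : c ≫ c' = 𝟙 m) (h : F.map c = F.map c') :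
    F.map (f₂ ≫ g₁) = F.map (f₁ ≫ g₂) := by
  have hcc : F.map c ≫ F.map c = 𝟙 _ := by
    conv_lhs => rw [h, ← h]
    conv_lhs => enter [2]; rw [h]
    rw [← F.map_comp, hc, F.map_id]
  rw [← h1, ← h2]
  simp only [F.map_comp, Category.assoc]
  rw [← Category.assoc (F.map c), hcc, Category.id_comp]

/-- The two crossings of the fold use its midpoint from opposite sides, and differ by the loop
around the disc cut out by the corner. The orbifold relation identifies that loop with its inverse.
-/
theorem quotient_cross_eq {t : τ.Tri} {i : Fin 3} (h : τ.pair (t, i + 1) = (t, i + 2))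
    (e : τ.pair (t, i + 1) = (t, i + 2)) (n : (t, i + 1) ≠ (t, i + 2))
    (e' : τ.pair (t, i + 2) = (t, i + 1)) (n' : (t, i + 2) ≠ (t, i + 1)) :
    (CategoryTheory.Quotient.functor (orbHomRel P)).map ((isGlued_base hS hτ).cross e n) =
      (CategoryTheory.Quotient.functor (orbHomRel P)).map ((isGlued_base hS hτ).cross e' n') := by
  have hG := isGlued_base hS hτ
  obtain ⟨d, hd⟩ := exists_punctureDisc hS hτ h
  have hd1 : ∀ s : unitInterval, d.toFun (Circle.exp (2 * Real.pi * (s : ℝ))) =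
      τ.basePt (mixPt s (hG.mt t (i + 2)).1 (hG.mt t (i + 1)).1) := fun s => by
    have h1 := hd 1 s
    rw [ClosedTriangle.sector_one_eq_mix] at h1
    refine Eq.trans ?_ h1
    simp [PunctureDisc.polar]
  let m : FundamentalGroupoid ↥(Pᶜ) := ⟨⟨d.toFun (1 : Circle), d.notMem 1⟩⟩
  have hm2 : τ.basePt₀ (hG.mt t (i + 2)) = m.as := by
    refine Subtype.ext ?_
    have h1 := hd1 0
    simp only [mixPt, ClosedTriangle.mix_zero] at h1
    refine h1.symm.trans ?_
    simp [m]
  have hm1 : τ.basePt₀ (hG.mt t (i + 1)) = m.as :=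
    (hG.eq_of_sideStep (hG.sideStep_mt e n)).trans hm2
  have hloop : hG.sg (x := m) (y := m) (hG.mt t (i + 2)) (hG.mt t (i + 1)) rfl hm2 hm1 =
      pathHom d.loop := by
    unfold IsGlued.sg pathHom
    congr 1
    ext s
    exact (hd1 s).symm
  have e1 := hG.sg_comp_sg_eq_cross (x := m) e n (a := hG.mt t (i + 1)) (a' := hG.mt t (i + 2)) rfl
    rfl (hG.sideStep_mt e n) hm1 hm2
  have e2 := hG.sg_comp_sg_eq_cross (x := m) e' n' (a := hG.mt t (i + 2)) (a' := hG.mt t (i + 1))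
    rfl rfl (hG.sideStep_mt e' n') hm2 hm1
  have key := comp_eq_comp_of_involutive (CategoryTheory.Quotient.functor (orbHomRel P))
    (hG.sg (x := hG.bary t) (y := m) (hG.bt t) (hG.mt t (i + 2)) rfl rfl hm2)
    (hG.sg (x := hG.bary t) (y := m) (hG.bt t) (hG.mt t (i + 1)) rfl rfl hm1)
    (hG.sg (x := m) (y := hG.bary t) (hG.mt t (i + 2)) (hG.bt t) rfl hm2 rfl)
    (hG.sg (x := m) (y := hG.bary t) (hG.mt t (i + 1)) (hG.bt t) rfl hm1 rfl)
    (pathHom d.loop) (pathHom d.loop.symm) (by rw [← hloop]; exact hG.sg_comp _ _ _ _ _ _ _ _)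
    (by rw [← hloop]; exact hG.sg_comp _ _ _ _ _ _ _ _) (Groupoid.comp_inv _)
    (CategoryTheory.Quotient.sound _ (OrbRel.around d))
  rw [← e1, ← e2]
  exact key

theorem isOver_orb : (orbCrossings hS hτ).IsOver τ.pair id where
  involutive := τ.pair_pair
  involutive' := τ.pair_pair
  pair_over e := e
  ne_over _ n := n
  fold_pair {v v₁ i j} e ht _ := by
    obtain rfl : v₁ = v := ht
    rw [← e, τ.pair_pair]
  fold_cr {v v₁ i j} e n e' n' ht hij := by
    obtain rfl : v₁ = v := ht
    obtain ⟨k, hki, hkj, -⟩ := SideMatch.triangleVertex hij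
    rcases Fin.eq_or_of_three k i with rfl | rfl | rfl
    · exact absurd rfl hki
    · obtain rfl : j = k + 2 := by
        rcases Fin.eq_or_of_three k j with rfl | rfl | rfl
        exacts [absurd rfl hkj, absurd rfl hij, rfl]
      exact quotient_cross_eq hS hτ e e n e' n'
    · obtain rfl : j = k + 1 := by
        rcases Fin.eq_or_of_three k j with rfl | rfl | rfl
        exacts [absurd rfl hkj, rfl, absurd rfl hij]
      exact (quotient_cross_eq hS hτ e' e' n' e n).symm

theorem orbHol_injective {x y : OrbGroupoid P} {f g : x ⟶ y}
    (h : orbHol hS hτ f = orbHol hS hτ g) : f = g := by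
  refine (isOver_orb hS hτ).injective (L := orbHol hS hτ) (orbHol_id hS hτ)
    (orbHol_comp hS hτ) (fun {v v₁ i j} e n => ?_) (fun x => ?_) h
  -- The potential is 1 at barycentres, so the holonomy of a crossing is exactly its label.
  · refine ((baseHol hS hτ).map_cross (isPotential_potential hS) e n).trans ?_
    rw [potential_bary hS, potential_bary hS, one_mul, inv_one, mul_one]
    rfl
  · obtain ⟨v, p, hp⟩ := (isGlued_base hS hτ).exists_gen x.as
    refine ⟨v, (CategoryTheory.Quotient.functor (orbHomRel P)).map p, fun f => ?_⟩
    obtain ⟨f', rfl⟩ := (CategoryTheory.Quotient.functor (orbHomRel P)).map_surjective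
      (X := x.as) (Y := x.as) f
    have h1 := (hp f').map (CategoryTheory.Quotient.functor (orbHomRel P))
    rw [CategoryTheory.Functor.map_comp, CategoryTheory.Functor.map_comp,
      Groupoid.inv_eq_inv, CategoryTheory.Functor.map_inv, ← Groupoid.inv_eq_inv] at h1
    exact h1

end IdealTriangulation

/-! ## Connectedness of the cover, lifting of paths and the sheet exchange -/

namespace IdealTriangulation

variable {S : Type*} [TopologicalSpace S] [ChartedSpace (EuclideanHalfSpace 2) S] {M P : Set S}
  {τ : IdealTriangulation M P} (hS : IsMarkedSurface M P) (hτ : τ.IsSkewedGentle)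

/-- Two triangles share a side. -/
def Adjacent (τ : IdealTriangulation M P) (t t' : τ.Tri) : Prop :=
  ∃ i j, τ.pair (t, i) = (t', j)

theorem Adjacent.symm {t t' : τ.Tri} (h : τ.Adjacent t t') : τ.Adjacent t' t := by
  obtain ⟨i, j, h⟩ := h
  exact ⟨j, i, by rw [← h, τ.pair_pair]⟩

include hS in
-- The triangles reachable from `t` cover a clopen subset of the connected space `S`.
theorem reflTransGen_adjacent (t t' : τ.Tri) : Relation.ReflTransGen τ.Adjacent t t' := by
  have := hS.t2
  have := hS.connected
  have := τ.finite_tri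
  set C : Set τ.Tri := {u | Relation.ReflTransGen τ.Adjacent t u}
  have hC : ∀ a b : TriPoint τ.Tri, τ.basePt a = τ.basePt b → (a.1 ∈ C ↔ b.1 ∈ C) := fun a b h =>
    eqvGen_iff_of_glue (p := fun a => a.1 ∈ C) (fun a b ⟨i, j, e, _⟩ =>
      ⟨fun ha => ha.tail ⟨i, j, e⟩, fun hb => hb.tail (Adjacent.symm ⟨i, j, e⟩)⟩)
      ((τ.basePt_eq_iff a b).1 h)
  have hq := isQuotientMap_basePt (τ := τ) hS
  have hcl : IsClopen (τ.basePt '' {a | a.1 ∈ C}) := by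
    rw [← hq.isClopen_preimage]
    have : τ.basePt ⁻¹' (τ.basePt '' {a | a.1 ∈ C}) = {a | a.1 ∈ C} := by
      refine Set.Subset.antisymm ?_ (Set.subset_preimage_image _ _)
      rintro a ⟨b, hb, e⟩
      exact (hC b a e).1 hb
    rw [this]
    constructor
    · rw [isClosed_sigma_iff]
      intro u
      by_cases hu : u ∈ C
      · convert isClosed_univ; ext x; simp [hu]
      · convert isClosed_empty; ext x; simp [hu]
    · rw [isOpen_sigma_iff]
      intro u
      by_cases hu : u ∈ C
      · convert isOpen_univ; ext x; simp [hu]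
      · convert isOpen_empty; ext x; simp [hu]
  have huniv := hcl.eq_univ ⟨τ.basePt ⟨t, ClosedTriangle.bary⟩, ⟨t, ClosedTriangle.bary⟩, .refl, rfl⟩
  have hmem : τ.basePt ⟨t', ClosedTriangle.bary⟩ ∈ τ.basePt '' {a | a.1 ∈ C} := by
    rw [huniv]; trivial
  obtain ⟨b, hb, e⟩ := hmem
  exact (hC b _ e).1 hb

/-- The barycentres of two triangles of the cover are joined by a path. -/
def Joined (τ : IdealTriangulation M P) (v v' : τ.Tri × Bool) : Prop :=
  Nonempty ((isGlued_cover (τ := τ)).bary v ⟶ (isGlued_cover (τ := τ)).bary v')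

theorem Joined.symm {v v' : τ.Tri × Bool} (h : τ.Joined v v') : τ.Joined v' v :=
  h.map fun f => Groupoid.inv f

theorem Joined.trans {v v' v'' : τ.Tri × Bool} (h : τ.Joined v v') (h' : τ.Joined v' v'') :
    τ.Joined v v'' := h.map2 (fun f g => f ≫ g) h'

theorem joined_doublePair (v : τ.Tri × Bool) (i : Fin 3) :
    τ.Joined v (doublePair τ.pair (v, i)).1 := by
  by_cases n : (v, i) = doublePair τ.pair (v, i)
  · rw [← n]; exact ⟨𝟙 _⟩
  · exact ⟨isGlued_cover.cross (Prod.mk.eta).symm n⟩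

include hS in
-- A chain of adjacent triangles lifts to both sheets at once; the two lifts stay in opposite
-- sheets.
theorem exists_joined (t t' : τ.Tri) (s : Bool) :
    ∃ s', τ.Joined (t, s) (t', s') ∧ τ.Joined (t, !s) (t', !s') := by
  induction reflTransGen_adjacent hS t t' with
  | refl => exact ⟨s, ⟨𝟙 _⟩, ⟨𝟙 _⟩⟩
  | @tail u u' _ h ih =>
    obtain ⟨s', h1, h2⟩ := ih
    obtain ⟨i, j, e⟩ := h
    have h3 := joined_doublePair (τ := τ) (u, s') i
    have h4 := joined_doublePair (τ := τ) (u, !s') i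
    simp only [doublePair, e] at h3 h4
    by_cases hf : FoldedSide τ.pair (u, i)
    · rw [if_pos hf] at h3 h4
      exact ⟨_, h1.trans h3, h2.trans h4⟩
    · rw [if_neg hf] at h3 h4
      exact ⟨_, h1.trans h3, h2.trans h4⟩

include hS hτ in
theorem joined (v v' : τ.Tri × Bool) : τ.Joined v v' := by
  obtain ⟨p, hp⟩ := hS.punctures_nonempty
  obtain ⟨t₀, i, h, -⟩ := hτ.puncture_enclosed p hp
  have hf : FoldedSide τ.pair (t₀, i + 1) := by
    rw [FoldedSide, h]
    exact ⟨rfl, fun e => Fin.add_one_ne_add_two i (congrArg Prod.snd e).symm⟩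
  -- Crossing the fold of a self-folded triangle changes the sheet. Such a triangle exists because
  -- there is a puncture, and so the cover is connected.
  have h0 : ∀ s, τ.Joined (t₀, s) (t₀, !s) := fun s => by
    have h1 := joined_doublePair (τ := τ) (t₀, s) (i + 1)
    simp only [doublePair, if_pos hf, h] at h1
    exact h1
  have h1 : ∀ t s, τ.Joined (t, s) (t, !s) := fun t s => by
    obtain ⟨s', h2, h3⟩ := exists_joined hS t t₀ s
    exact h2.trans ((h0 s').trans h3.symm)
  obtain ⟨t, s⟩ := v
  obtain ⟨t', s'⟩ := v'
  obtain ⟨s'', h2, -⟩ := exists_joined hS t t' s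
  by_cases e : s'' = s'
  · rwa [e] at h2
  · have h3 := h1 t' s''
    rw [show (!s'') = s' by cases s'' <;> cases s' <;> simp_all] at h3
    exact h2.trans h3

include hS hτ in
theorem nonempty_hom (x y : FundamentalGroupoid τ.Cover) : Nonempty (x ⟶ y) := by
  obtain ⟨a, ha⟩ := (isGlued_cover (τ := τ)).isQuotientMap.surjective x.as
  obtain ⟨b, hb⟩ := (isGlued_cover (τ := τ)).isQuotientMap.surjective y.as
  obtain ⟨f⟩ := joined hS hτ a.1.1 b.1.1
  exact ⟨isGlued_cover.sg (y := isGlued_cover.bary a.1.1) a (isGlued_cover.bt a.1.1) rfl ha rfl ≫ f ≫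
    isGlued_cover.sg (x := isGlued_cover.bary b.1.1) (isGlued_cover.bt b.1.1) b rfl rfl hb⟩

include hS hτ in
-- Crossings pass through midpoints of sides, which do not lie over punctures.
theorem exists_fill_eq_of_gen {v v' : τ.Tri × Bool} 
    {f : (isGlued_cover (τ := τ)).crossings.B v ⟶ (isGlued_cover (τ := τ)).crossings.B v'}
    (hf : (isGlued_cover (τ := τ)).crossings.Gen f) :
    ∃ g : (isGlued_puncturedCover hS hτ).bary v ⟶ (isGlued_puncturedCover hS hτ).bary v',
      τ.fill.map g = f := by
  induction hf with
  | nil v => exact ⟨𝟙 _, τ.fill.map_id _⟩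
  | @cons v v₁ v' i j e n f _ ih =>
    obtain ⟨g, hg⟩ := ih
    refine ⟨(isGlued_puncturedCover hS hτ).cross e n ≫ g, ?_⟩
    have h1 : τ.fill.map ((isGlued_puncturedCover hS hτ).cross e n) = isGlued_cover.cross e n :=
      (τ.fill.map_comp _ _).trans (congrArg₂ (· ≫ ·) (fill_sg hS hτ _ _ _ _ _)
        (fill_sg hS hτ _ _ _ _ _))
    exact (τ.fill.map_comp _ _).trans (congrArg₂ (· ≫ ·) h1 hg)

include hS hτ in
/-- Every path of the cover is homotopic to a path that avoids the points over punctures. -/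
theorem exists_fill_eq {x y : FundamentalGroupoid τ.PuncturedCover}
    (f : τ.fill.obj x ⟶ τ.fill.obj y) : ∃ g : x ⟶ y, τ.fill.map g = f := by
  have hG := isGlued_puncturedCover hS hτ
  obtain ⟨a, ha⟩ := hG.isQuotientMap.surjective x.as
  obtain ⟨b, hb⟩ := hG.isQuotientMap.surjective y.as
  have h1 := (isGlued_cover (τ := τ)).gen_of_hom f ⟨a.1, id⟩ ⟨b.1, id⟩ (congrArg Subtype.val ha)
    (congrArg Subtype.val hb)
  obtain ⟨g, hg⟩ := exists_fill_eq_of_gen hS hτ h1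
  have h2 := fill_sg hS hτ (x := x) (y := hG.bary a.1.1) a (hG.bt a.1.1) rfl ha rfl
  have h3 := fill_sg hS hτ (x := hG.bary b.1.1) (y := y) (hG.bt b.1.1) b rfl rfl hb
  refine ⟨hG.sg (x := x) (y := hG.bary a.1.1) a (hG.bt a.1.1) rfl ha rfl ≫ g ≫
    hG.sg (x := hG.bary b.1.1) (y := y) (hG.bt b.1.1) b rfl rfl hb, ?_⟩
  have key : ∀ {C : Type _} [Category C] {u v w z : C} {p : u ⟶ v} {p' : v ⟶ u} {f : u ⟶ w}
      {q' : w ⟶ z} {q : z ⟶ w}, p ≫ p' = 𝟙 u → q' ≫ q = 𝟙 w → p ≫ (p' ≫ f ≫ q') ≫ q = f := by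
    intro C _ u v w z p p' f q' q h h'
    simp only [Category.assoc, h', Category.comp_id]
    rw [← Category.assoc, h, Category.id_comp]
  refine (τ.fill.map_comp _ _).trans ((congrArg₂ (· ≫ ·) h2 ((τ.fill.map_comp _ _).trans
    (congrArg₂ (· ≫ ·) hg h3))).trans (key ?_ ?_))
  · exact isGlued_cover.sg_comp_sg_symm _ _ _ _ _
  · exact isGlued_cover.sg_comp_sg_symm _ _ _ _ _

/-! ### The fibres of the projection -/

theorem exists_coverPt_eq {a b : TriPoint τ.Tri} (h : τ.basePt a = τ.basePt b) (s : Bool) :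
    ∃ s', τ.coverPt ⟨(a.1, s), a.2⟩ = τ.coverPt ⟨(b.1, s'), b.2⟩ := by
  replace h := reflTransGen_of_eqvGen τ.pair_pair ((τ.basePt_eq_iff a b).1 h)
  induction h with
  | refl => exact ⟨s, rfl⟩
  | @tail c d _ hcd ih =>
    obtain ⟨s', hs⟩ := ih
    obtain ⟨i, j, e, n, hm⟩ := hcd
    classical
    refine ⟨if FoldedSide τ.pair (c.1, i) then !s' else s', hs.trans ((τ.coverPt_eq_iff _ _).2
      (.rel _ _ ⟨i, j, doublePair_eq_iff.2 ⟨e, rfl⟩, fun h => n ?_, hm⟩))⟩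
    obtain ⟨h1, rfl⟩ := Prod.ext_iff.1 h
    exact Prod.ext (Prod.ext_iff.1 h1).1 rfl

/-- The exchange of the sheets of the punctured cover. -/
def swap₀ (τ : IdealTriangulation M P) (x : τ.PuncturedCover) : τ.PuncturedCover :=
  ⟨τ.swap x.1, by
    obtain ⟨x, hx⟩ := x
    induction x using Quot.ind
    exact hx⟩

theorem puncturedProj_swap₀ (x : τ.PuncturedCover) :
    τ.puncturedProj (τ.swap₀ x) = τ.puncturedProj x := by
  obtain ⟨x, hx⟩ := x
  induction x using Quot.ind
  rfl

theorem eq_or_eq_swap₀ {x y : τ.PuncturedCover} (h : τ.puncturedProj x = τ.puncturedProj y) :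
    y = x ∨ y = τ.swap₀ x := by
  obtain ⟨x, hx⟩ := x
  obtain ⟨y, hy⟩ := y
  induction x using Quot.ind with | _ a
  induction y using Quot.ind with | _ b
  obtain ⟨⟨t, s⟩, a⟩ := a
  obtain ⟨⟨t', s'⟩, b⟩ := b
  obtain ⟨s'', e⟩ := exists_coverPt_eq (a := ⟨t', b⟩) (b := ⟨t, a⟩) (congrArg Subtype.val h).symm s'
  by_cases hs : s'' = s
  · left
    rw [hs] at e
    exact Subtype.ext e
  · right
    rw [show s'' = !s by cases s'' <;> cases s <;> simp_all] at e
    exact Subtype.ext e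

/-- Segments lift to the sheet dictated by the starting point, with the same holonomy, and segments
generate. -/
theorem exists_lift {x y : FundamentalGroupoid ↥(Pᶜ)} (f : x ⟶ y)
    (z : FundamentalGroupoid τ.PuncturedCover) (hz : τ.puncturedProj z.as = x.as) :
    ∃ (w : FundamentalGroupoid τ.PuncturedCover) (g : z ⟶ w), τ.puncturedProj w.as = y.as ∧
      (coverHol hS hτ).toFun (τ.fill.map g) = (baseHol hS hτ).toFun f := by
  have hG := isGlued_puncturedCover hS hτ
  induction (isGlued_base hS hτ).segGen f generalizing z with
  | id x =>
    exact ⟨z, 𝟙 z, hz, (congrArg (coverHol hS hτ).toFun (τ.fill.map_id z)).trans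
      (((coverHol hS hτ).map_id _).trans ((baseHol hS hτ).map_id _).symm)⟩
  | comp f g _ _ ih1 ih2 =>
    obtain ⟨w, f', hw, hf⟩ := ih1 z hz
    obtain ⟨w', g', hw', hg⟩ := ih2 w hw
    refine ⟨w', f' ≫ g', hw', ?_⟩
    rw [(baseHol hS hτ).map_comp, τ.fill.map_comp, (coverHol hS hτ).map_comp, hf, hg]
  | @sg x y a b h hx hy =>
    obtain ⟨c, hc⟩ := hG.isQuotientMap.surjective z.as
    obtain ⟨⟨t, a⟩, ha⟩ := a
    obtain ⟨⟨t', b⟩, hb⟩ := b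
    obtain rfl : t = t' := h
    have h1 : τ.basePt ⟨c.1.1.1, c.1.2⟩ = τ.basePt ⟨t, a⟩ := by
      have h2 : τ.puncturedProj (τ.coverPt₀ c) = τ.basePt₀ ⟨⟨t, a⟩, ha⟩ := by rw [hc, hz, hx]
      exact congrArg Subtype.val h2
    obtain ⟨s, hs⟩ := exists_coverPt_eq h1 c.1.1.2
    refine ⟨⟨τ.coverPt₀ ⟨⟨(t, s), b⟩, hb⟩⟩, hG.sg (x := z) (y := ⟨τ.coverPt₀ ⟨⟨(t, s), b⟩, hb⟩⟩)
      ⟨⟨(t, s), a⟩, ha⟩ ⟨⟨(t, s), b⟩, hb⟩ rfl ((Subtype.ext hs.symm).trans hc) rfl, hy, ?_⟩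
    refine (coverHol_fill hS hτ _).trans ((congrArg (baseHol hS hτ).toFun
      (puncturedProj_sg hS hτ _ _ _ _ _)).trans (((baseHol hS hτ).map_sg _ _ _ _ _).trans
      ((baseHol hS hτ).map_sg _ _ _ _ _).symm))

/-! ### Sheets -/

theorem right_sheetElt_mul {A : Type} (s : Bool) (g : SwapGroup A) (h : g.right = 1) :
    (sheetElt s * g * sheetElt s).right = 1 := by
  rw [SemidirectProduct.mul_right, SemidirectProduct.mul_right, h, mul_one,
    ← SemidirectProduct.mul_right, sheetElt_mul_self]
  rfl

theorem right_doubleLabel (σ : (τ.Tri × Bool) × Fin 3) :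
    (doubleLabel τ.pair σ).right = 1 := by
  obtain ⟨⟨t, s⟩, i⟩ := σ
  unfold doubleLabel doublePair sideLabel
  dsimp only
  by_cases hf : FoldedSide τ.pair (t, i)
  · rw [if_pos hf, if_pos hf, sheetElt_not, mul_assoc, ← mul_assoc theta, theta_mul_self, one_mul,
      sheetElt_mul_self]
    rfl
  · rw [if_neg hf, if_neg hf]
    exact right_sheetElt_mul _ _ rfl

include hτ in
/-- The component in the group of order two of the potential of the cover. -/
noncomputable def sheet (x : τ.Cover) : Subgroup.zpowers (flipAut (τ.Tri × Fin 3)) :=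
  Quot.lift (fun a => (coverPotential hS a).right) (fun a b hab => by
    rw [τ.coverGlue_eq] at hab
    obtain ⟨i, j, hs⟩ := hab
    rw [isPotential_coverPotential hS hτ i j a b id hs, SemidirectProduct.mul_right,
      right_doubleLabel, mul_one]) x

/-- The order-two component of the potential is constant on glued points, so on holonomies it is a
coboundary and vanishes on loops. -/
theorem right_coverHol {x y : FundamentalGroupoid τ.Cover} (f : x ⟶ y) :
    ((coverHol hS hτ).toFun f).right = sheet hS hτ x.as * (sheet hS hτ y.as)⁻¹ := by
  induction isGlued_cover.segGen f with
  | id x => rw [(coverHol hS hτ).map_id, mul_inv_cancel]; rfl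
  | comp f g _ _ h1 h2 =>
    rw [(coverHol hS hτ).map_comp, SemidirectProduct.mul_right, h1, h2]; group
  | sg a b h hx hy =>
    rw [(coverHol hS hτ).map_sg, SemidirectProduct.mul_right, SemidirectProduct.inv_right,
      ← hx, ← hy]
    rfl

theorem sheet_swap₀ (x : τ.PuncturedCover) :
    sheet hS hτ (τ.swap₀ x).1 = sheet hS hτ x.1 * flipGen := by
  obtain ⟨x, hx⟩ := x
  induction x using Quot.ind with | _ a
  obtain ⟨⟨t, s⟩, a⟩ := a
  have ha : (⟨t, a⟩ : TriPoint τ.Tri) ∉ τ.deleted := not_not.2 hx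
  change (coverPotential hS ⟨(t, !s), a⟩).right = (coverPotential hS ⟨(t, s), a⟩).right * flipGen
  unfold coverPotential doublePotential
  dsimp only
  rw [if_neg ha, if_neg ha, SemidirectProduct.mul_right, SemidirectProduct.mul_right, mul_assoc]
  cases s
  · simp [sheetElt, theta]
  · simp [sheetElt, theta, flipGen_mul_self]

/-- The exchange moves a segment to the other sheet, and away from the punctures ratios of
potentials do not depend on the sheet. -/
theorem coverHol_swap {x y : FundamentalGroupoid τ.PuncturedCover} (f : x ⟶ y) :
    (coverHol hS hτ).toFun ((FundamentalGroupoid.map τ.swap).map (τ.fill.map f)) =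
      (coverHol hS hτ).toFun (τ.fill.map f) := by
  have hG := isGlued_puncturedCover hS hτ
  induction hG.segGen f with
  | id x =>
    rw [CategoryTheory.Functor.map_id]
    refine Eq.trans (congrArg (coverHol hS hτ).toFun (CategoryTheory.Functor.map_id _ _)) ?_
    exact ((coverHol hS hτ).map_id _).trans ((coverHol hS hτ).map_id _).symm
  | comp f g _ _ h1 h2 =>
    rw [CategoryTheory.Functor.map_comp, CategoryTheory.Functor.map_comp, (coverHol hS hτ).map_comp,
      (coverHol hS hτ).map_comp, h1, h2]
  | @sg x y a b h hx hy =>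
    have h1 := fill_sg hS hτ a b h hx hy
    have h2 := (isGlued_cover (τ := τ)).map_sg (isGlued_cover (τ := τ)) τ.swap
      (fun v => (v.1, !v.2)) (fun _ _ => id) (fun _ => rfl) (x := τ.fill.obj x) (y := τ.fill.obj y)
      ⟨a.1, id⟩ ⟨b.1, id⟩ h (congrArg Subtype.val hx) (congrArg Subtype.val hy)
    refine (congrArg (coverHol hS hτ).toFun ((congrArg _ h1).trans h2)).trans
      (((coverHol hS hτ).map_sg _ _ _ _ _).trans (Eq.trans ?_ ((congrArg (coverHol hS hτ).toFun
        h1).trans ((coverHol hS hτ).map_sg _ _ _ _ _)).symm))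
    refine (coverPotential_ratio hS (a := ⟨(a.1.1.1, !a.1.1.2), a.1.2⟩)
      (b := ⟨(b.1.1.1, !b.1.1.2), b.1.2⟩) a.2 b.2
      (congrArg (fun v : τ.Tri × Bool => (v.1, !v.2)) h)).trans
      (coverPotential_ratio hS a.2 b.2 h).symm

end IdealTriangulation

/-! ## Classes of elements of an orbifold pair -/

/-- The quotient maps `p` and `q` onto conjugacy classes in `H` and `G`, an embedding `φ` of `H`
onto the index two subgroup of an orbifold pair, the induced map `Ψ` on classes and the action `σ` of
the complement of the subgroup on classes in `H`. -/
structure IsOrbifoldCover {H G A B : Type*} [Group H] [Group G] (φ : H →* G) (p : H → A) (q : G → B)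
    (Ψ : A → B) (σ : A → A) : Prop where
  pair : IsOrbifoldPair φ.range
  inj : Function.Injective φ
  p_surj : Function.Surjective p
  p_eq : ∀ {x y}, p x = p y ↔ ∃ h, h * x * h⁻¹ = y
  q_eq : ∀ {x y}, q x = q y ↔ ∃ g, g * x * g⁻¹ = y
  map : ∀ x, Ψ (p x) = q (φ x)
  swap : ∀ {x y}, σ (p x) = p y ↔ ∃ g ∉ φ.range, g * φ x * g⁻¹ = φ y

namespace IsOrbifoldCover

variable {H G A B : Type*} [Group H] [Group G] {φ : H →* G} {p : H → A} {q : G → B}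
    {Ψ : A → B} {σ : A → A} (h : IsOrbifoldCover φ p q Ψ σ)
include h

theorem isPrimitiveElt_iff {x : H} : IsPrimitiveElt x ↔ PrimIn φ.range (φ x) := by
  have hz : ∀ {x y : H}, x ∈ Subgroup.zpowers y ↔ φ x ∈ Subgroup.zpowers (φ y) := fun {x y} => by
    simp only [Subgroup.mem_zpowers_iff, ← map_zpow, h.inj.eq_iff]
  rw [IsPrimitiveElt, PrimIn, h.inj.isOfFinOrder_iff]
  simp only [Subgroup.zpowers_le]
  constructor
  · rintro ⟨h1, h2⟩
    refine ⟨⟨x, rfl⟩, h1, ?_⟩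
    rintro _ ⟨y, rfl⟩ hy
    exact hz.1 (h2 y (hz.2 hy))
  · rintro ⟨-, h1, h2⟩
    exact ⟨h1, fun y hy => hz.2 (h2 (φ y) ⟨y, rfl⟩ (hz.1 hy))⟩

theorem mem_range_iff {g : G} : q g ∈ Set.range Ψ ↔ g ∈ φ.range := by
  constructor
  · rintro ⟨a, ha⟩
    obtain ⟨x, rfl⟩ := h.p_surj a
    rw [h.map, h.q_eq] at ha
    obtain ⟨k, rfl⟩ := ha
    exact h.pair.conj_mem ⟨x, rfl⟩ k
  · rintro ⟨x, rfl⟩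
    exact ⟨p x, h.map x⟩

theorem exists_sq_eq {x : H} (hx : IsPrimitiveElt x) (hs : σ (p x) = p x) :
    ∃ α, IsPrimitiveElt α ∧ α ∉ φ.range ∧ α ^ 2 = φ x := by
  obtain ⟨g, hg, e⟩ := h.swap.1 hs
  obtain ⟨α, h1, h2, h3⟩ := h.pair.exists_sq_eq (h.isPrimitiveElt_iff.1 hx) hg
    (mul_inv_eq_iff_eq_mul.1 e)
  exact ⟨α, primIn_top_iff.1 h2, h1, h3⟩

theorem swap_eq_inv_iff {x : H} : σ (p x) = p x⁻¹ ↔ q (φ x) = q (φ x)⁻¹ := by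
  rw [h.swap, h.q_eq, map_inv]
  exact h.pair.exists_conj_eq_inv_iff ⟨x, rfl⟩

theorem isPrimitiveElt_iff_of_swap_eq_inv {x : H} (hs : σ (p x) = p x⁻¹) :
    IsPrimitiveElt x ↔ IsPrimitiveElt (φ x) := by
  obtain ⟨g, hg, e⟩ := h.swap.1 hs
  rw [map_inv] at e
  rw [h.isPrimitiveElt_iff, ← primIn_top_iff]
  exact h.pair.primIn_iff_of_conj_eq_inv ⟨x, rfl⟩ hg e

/-- The element γ commutes with its square, so conjugation by γ itself shows that the class of γ² is
fixed by σ. -/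
theorem exists_of_notMem {γ : G} (hγ : IsPrimitiveElt γ) (hn : γ ∉ φ.range) :
    ∃ x, IsPrimitiveElt x ∧ σ (p x) = p x ∧ γ ^ 2 = φ x := by
  obtain ⟨x, hx⟩ : γ ^ 2 ∈ φ.range := pow_two γ ▸ h.pair.sq_mem γ
  refine ⟨x, ?_, h.swap.2 ⟨γ, hn, ?_⟩, hx.symm⟩
  · rw [h.isPrimitiveElt_iff, hx]
    exact h.pair.primIn_sq (primIn_top_iff.2 hγ) hn
  · rw [hx]; group

theorem notMem_of_sq {γ : G} {x : H} (hx : IsPrimitiveElt x) (e : q (γ ^ 2) = Ψ (p x)) :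
    γ ∉ φ.range := by
  rw [h.map, h.q_eq] at e
  obtain ⟨g, e⟩ := e
  have h1 := h.isPrimitiveElt_iff.1 hx
  rw [← e, ← conj_pow] at h1
  exact fun hγ => notMem_of_primIn_sq h1 (h.pair.conj_mem hγ g)

theorem notMem_range_iff {γ : G} (hγ : IsPrimitiveElt γ) : q γ ∉ Set.range Ψ ↔
    ∃ x, IsPrimitiveElt x ∧ σ (p x) = p x ∧ q (γ ^ 2) = Ψ (p x) := by
  rw [h.mem_range_iff]
  constructor
  · intro hn
    obtain ⟨x, h1, h2, h3⟩ := h.exists_of_notMem hγ hn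
    exact ⟨x, h1, h2, by rw [h.map, h3]⟩
  · rintro ⟨x, h1, -, h3⟩
    exact h.notMem_of_sq h1 h3

theorem exists_of_eq_inv {γ : G} (hγ : IsPrimitiveElt γ) (hi : q γ = q γ⁻¹) :
    ∃ x, φ x = γ ∧ σ (p x) = p x⁻¹ := by
  obtain ⟨g, e⟩ := h.q_eq.1 hi
  obtain ⟨⟨x, rfl⟩, hg⟩ := h.pair.mem_of_conj_eq_inv hγ.1 e
  exact ⟨x, rfl, h.swap.2 ⟨g, hg, by rw [e, map_inv]⟩⟩

/-- Conjugacy in `G` splits according to whether the conjugator lies in the subgroup, giving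
equality, or outside, giving σ. So the fibres of Ψ are the σ-orbits. -/
theorem eq_or_eq_of_map_eq {a b : A} : Ψ a = Ψ b ↔ b = a ∨ b = σ a := by
  obtain ⟨x, rfl⟩ := h.p_surj a
  obtain ⟨y, rfl⟩ := h.p_surj b
  rw [h.map, h.map, h.q_eq, eq_comm, eq_comm (b := σ _), h.p_eq, h.swap]
  constructor
  · rintro ⟨g, e⟩
    by_cases hg : g ∈ φ.range
    · obtain ⟨k, rfl⟩ := hg
      exact Or.inl ⟨k, h.inj (by simpa using e)⟩
    · exact Or.inr ⟨g, hg, e⟩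
  · rintro (⟨k, e⟩ | ⟨g, -, e⟩)
    · exact ⟨φ k, by rw [← e]; simp⟩
    · exact ⟨g, e⟩

theorem swap_swap (a : A) : σ (σ a) = a := by
  obtain ⟨x, rfl⟩ := h.p_surj a
  obtain ⟨y, e⟩ := h.p_surj (σ (p x))
  obtain ⟨g, hg, e'⟩ := h.swap.1 e.symm
  rw [← e, h.swap]
  exact ⟨g⁻¹, by simpa using hg, by rw [← e']; group⟩

/-- Fibres of Ψ are σ-orbits, so any condition on classes whose image under Ψ is exactly `D` yields
a bijection from orbits. -/
theorem exists_equiv_pairs {N : Set (Set A)} (Q : A → Prop)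
    (hN : ∀ s, s ∈ N ↔ ∃ a, Q a ∧ s = {a, σ a}) (D : Set B) (h1 : ∀ a, Q a → Ψ a ∈ D)
    (h2 : ∀ d ∈ D, ∃ a, Q a ∧ Ψ a = d) :
    ∃ e : N ≃ D, ∀ s, ∀ a ∈ s.1, (e s).1 = Ψ a := by
  have hσ : ∀ a, Ψ (σ a) = Ψ a := fun a => ((h.eq_or_eq_of_map_eq).2 (Or.inr rfl)).symm
  choose f hf hs using fun s : N => (hN s.1).1 s.2
  have hval : ∀ s, ∀ a ∈ s.1, Ψ (f s) = Ψ a := by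
    intro s a ha
    rw [hs s] at ha
    rcases ha with rfl | rfl
    · rfl
    · exact (hσ _).symm
  refine ⟨Equiv.ofBijective (fun s => ⟨Ψ (f s), h1 _ (hf s)⟩) ⟨fun s s' e => ?_, fun d => ?_⟩,
    fun s a ha => hval s a ha⟩
  · refine Subtype.ext ?_
    rw [hs s, hs s']
    rcases h.eq_or_eq_of_map_eq.1 (congrArg Subtype.val e : Ψ (f s) = Ψ (f s')) with e | e
    · rw [e]
    · rw [e, h.swap_swap, Set.pair_comm]
  · obtain ⟨a, ha, e⟩ := h2 d.1 d.2
    refine ⟨⟨{a, σ a}, (hN _).2 ⟨a, ha, rfl⟩⟩, Subtype.ext ?_⟩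
    rw [← e]
    exact hval ⟨{a, σ a}, (hN _).2 ⟨a, ha, rfl⟩⟩ a (Or.inl rfl)

variable {primA : A → Prop} {invA : A → A} {primB : B → Prop} {invB sqB : B → B}
  (hpA : ∀ a : A, primA a ↔ ∃ x, IsPrimitiveElt x ∧ p x = a)
  (hpB : ∀ b : B, primB b ↔ ∃ x, IsPrimitiveElt x ∧ q x = b)
  (hiA : ∀ x, invA (p x) = p x⁻¹) (hiB : ∀ x, invB (q x) = q x⁻¹)
  (hsB : ∀ x, sqB (q x) = q (x ^ 2))

include hpA hpB hiA hiB in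
theorem exists_equiv_generic :
    ∃ e : {s : Set A | ∃ a, primA a ∧ σ a ≠ a ∧ σ a ≠ invA a ∧ s = {a, σ a}} ≃
      {d : B | primB d ∧ d ∈ Set.range Ψ ∧ d ≠ invB d}, ∀ s, ∀ a ∈ s.1, (e s).1 = Ψ a := by
  refine h.exists_equiv_pairs (fun a => primA a ∧ σ a ≠ a ∧ σ a ≠ invA a)
    (fun s => by simp only [Set.mem_ofPred_eq, and_assoc]) _ ?_ ?_
  · rintro a ⟨ha, h1, h2⟩
    obtain ⟨x, hx, rfl⟩ := (hpA a).1 ha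
    have hp : PrimIn ⊤ (φ x) := primIn_top_of_forall_conj_ne (h.isPrimitiveElt_iff.1 hx)
      fun g hg e => h1 (h.swap.2 ⟨g, hg, e⟩)
    rw [hiA, Ne, h.swap_eq_inv_iff] at h2
    refine ⟨(hpB _).2 ⟨φ x, primIn_top_iff.1 hp, (h.map x).symm⟩, ⟨_, rfl⟩, ?_⟩
    rw [h.map, hiB]
    exact h2
  · rintro d ⟨hd, hr, hi⟩
    obtain ⟨γ, hγ, rfl⟩ := (hpB d).1 hd
    obtain ⟨x, rfl⟩ := h.mem_range_iff.1 hr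
    rw [hiB] at hi
    have hp := primIn_top_iff.2 hγ
    refine ⟨p x, ⟨(hpA _).2 ⟨x, h.isPrimitiveElt_iff.2 (primIn_of_primIn_top hp ⟨x, rfl⟩), rfl⟩,
      fun e => ?_, ?_⟩, h.map x⟩
    · obtain ⟨g, hg, e⟩ := h.swap.1 e
      exact h.pair.conj_ne_of_primIn_top hp ⟨x, rfl⟩ hg e
    · rw [hiA, Ne, h.swap_eq_inv_iff]; exact hi

include hpA hpB hiA hiB in
theorem exists_equiv_inv :
    ∃ e : {s : Set A | ∃ a, primA a ∧ σ a = invA a ∧ s = {a, σ a}} ≃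
      {d : B | primB d ∧ d = invB d}, ∀ s, ∀ a ∈ s.1, (e s).1 = Ψ a := by
  refine h.exists_equiv_pairs (fun a => primA a ∧ σ a = invA a)
    (fun s => by simp only [Set.mem_ofPred_eq, and_assoc]) _ ?_ ?_
  · rintro a ⟨ha, h1⟩
    obtain ⟨x, hx, rfl⟩ := (hpA a).1 ha
    rw [hiA] at h1
    have h2 := h.swap_eq_inv_iff.1 h1
    refine ⟨(hpB _).2 ⟨φ x, (h.isPrimitiveElt_iff_of_swap_eq_inv h1).1 hx, (h.map x).symm⟩, ?_⟩
    rw [h.map, hiB]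
    exact h2
  · rintro d ⟨hd, hi⟩
    obtain ⟨γ, hγ, rfl⟩ := (hpB d).1 hd
    rw [hiB] at hi
    obtain ⟨x, rfl, hx⟩ := h.exists_of_eq_inv hγ hi
    exact ⟨p x, ⟨(hpA _).2 ⟨x, (h.isPrimitiveElt_iff_of_swap_eq_inv hx).2 hγ, rfl⟩,
      by rw [hiA, hx]⟩, h.map x⟩

include hpA hpB hsB in
-- Square roots give the map. It is injective because the square determines the σ-orbit, here a
-- single class, and surjective because an outside square root of a primitive element is unique.
theorem exists_equiv_sq :
    ∃ e : {a : A | primA a ∧ σ a = a} ≃ {d : B | d ∉ Set.range Ψ ∧ primB d},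
      ∀ a, sqB (e a).1 = Ψ a := by
  have hex : ∀ a : {a : A | primA a ∧ σ a = a},
      ∃ d : {d : B | d ∉ Set.range Ψ ∧ primB d}, sqB d.1 = Ψ a := by
    rintro ⟨a, ha, hs⟩
    obtain ⟨x, hx, rfl⟩ := (hpA a).1 ha
    obtain ⟨α, h1, h2, h3⟩ := h.exists_sq_eq hx hs
    exact ⟨⟨q α, mt h.mem_range_iff.1 h2, (hpB _).2 ⟨α, h1, rfl⟩⟩, by rw [hsB, h3, h.map]⟩
  choose f hf using hex
  refine ⟨Equiv.ofBijective f ⟨?_, ?_⟩, hf⟩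
  · rintro a b e
    have h1 := hf a
    rw [e, hf b] at h1
    rcases h.eq_or_eq_of_map_eq.1 h1 with e | e
    · exact Subtype.ext e
    · exact Subtype.ext (e.trans b.2.2)
  · rintro ⟨d, hn, hd⟩
    obtain ⟨α, hα, rfl⟩ := (hpB d).1 hd
    have hn := mt h.mem_range_iff.2 hn
    obtain ⟨x, h1, h2, h3⟩ := h.exists_of_notMem hα hn
    refine ⟨⟨p x, (hpA _).2 ⟨x, h1, rfl⟩, h2⟩, Subtype.ext ?_⟩
    have h4 := hf ⟨p x, (hpA _).2 ⟨x, h1, rfl⟩, h2⟩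
    generalize f ⟨p x, (hpA _).2 ⟨x, h1, rfl⟩, h2⟩ = d' at h4 ⊢
    obtain ⟨d', hn', hd'⟩ := d'
    obtain ⟨β, hβ, rfl⟩ := (hpB d').1 hd'
    have hn' := mt h.mem_range_iff.2 hn'
    dsimp only at h4 ⊢
    rw [hsB, h.map, ← h3] at h4
    obtain ⟨g, e⟩ := h.q_eq.1 h4
    refine h.q_eq.2 ⟨g, ?_⟩
    have := h.pair.normal
    rw [← conj_pow] at e
    -- After conjugating β by `g`, both elements lie outside the subgroup and have the same
    -- primitive square.
    refine h.pair.eq_of_sq_eq (fun hm => hn' ?_) hn e ?_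
    · have := h.pair.conj_mem hm g⁻¹
      simpa [mul_assoc] using this
    · rw [e]; exact h.pair.primIn_sq (primIn_top_iff.2 hα) hn

end IsOrbifoldCover

/-- Choosing signs of square roots parametrizes the units by their squares. -/
theorem bijective_sqrt {k : Type*} [Field k] (hk : ringChar k ≠ 2) (r : kˣ → kˣ)
    (hr : ∀ u, r u ^ 2 = u) :
    Function.Bijective fun z : kˣ × ZMod 2 => if z.2 = 0 then r z.1 else - r z.1 := by
  have hne : ∀ v : kˣ, v ≠ -v := fun v e => by
    have h1 : (v : k) = -v := congrArg Units.val e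
    have h2 : (2 : k) * v = 0 := by linear_combination h1
    rcases mul_eq_zero.1 h2 with h3 | h3
    · exact Ring.two_ne_zero hk h3
    · exact v.ne_zero h3
  have h01 : ∀ ε : ZMod 2, ε ≠ 0 → ε = 1 := by decide
  constructor
  · rintro ⟨u, ε⟩ ⟨v, δ⟩ e
    dsimp only at e
    have hsq : u = v := by
      have := congrArg (· ^ 2) e
      split_ifs at this <;> simpa [hr] using this
    subst hsq
    by_cases h1 : ε = 0 <;> by_cases h2 : δ = 0
    · rw [h1, h2]
    · rw [if_pos h1, if_neg h2] at e; exact absurd e (hne _)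
    · rw [if_neg h1, if_pos h2] at e; exact absurd e.symm (hne _)
    · rw [h01 _ h1, h01 _ h2]
  · intro v
    have h1 : r (v ^ 2) = v ∨ r (v ^ 2) = -v := by
      have := hr (v ^ 2)
      have h2 : (r (v ^ 2) : k) ^ 2 = (v : k) ^ 2 := by exact_mod_cast congrArg Units.val this
      rcases sq_eq_sq_iff_eq_or_eq_neg.1 h2 with h3 | h3
      · exact Or.inl (Units.ext h3)
      · exact Or.inr (Units.ext h3)
    rcases h1 with h1 | h1
    · exact ⟨(v ^ 2, 0), by simp [h1]⟩
    · exact ⟨(v ^ 2, 1), by simp [h1]⟩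

/-! ## Free classes of loops at a base point -/

namespace FreeClass

variable {C : Type*} [Groupoid C]

theorem mk_eq_mk_iff {x y : C} {a : End x} {b : End y} :
    mk a = mk b ↔ ∃ γ : x ⟶ y, (a : x ⟶ x) ≫ γ = γ ≫ (b : y ⟶ y) := by
  have heq : Equivalence (GroupoidLoop.IsConj (C := C)) :=
    { refl := fun a => ⟨𝟙 _, (Category.comp_id (a.2 : a.1 ⟶ a.1)).trans
        (Category.id_comp (a.2 : a.1 ⟶ a.1)).symm⟩
      symm := fun {a b} ⟨γ, h⟩ => ⟨Groupoid.inv γ, by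
        rw [← cancel_epi γ, ← Category.assoc, ← h]; simp⟩
      trans := fun {a b c} ⟨γ, h⟩ ⟨δ, h'⟩ => ⟨γ ≫ δ, by
        rw [← Category.assoc, h, Category.assoc, h', Category.assoc]⟩ }
  exact heq.quot_mk_eq_iff _ _

theorem mk_eq_mk_iff_conj {x : C} {a b : End x} : mk a = mk b ↔ ∃ g : End x, g * a * g⁻¹ = b := by
  rw [mk_eq_mk_iff]
  refine exists_congr fun g => ?_
  rw [mul_inv_eq_iff_eq_mul]
  rfl

theorem mk_surjective (x : C) (h : ∀ y : C, Nonempty (x ⟶ y)) :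
    Function.Surjective (mk : End x → FreeClass C) := by
  rintro ⟨⟨y, b⟩⟩
  obtain ⟨γ⟩ := h y
  refine ⟨γ ≫ (b : y ⟶ y) ≫ Groupoid.inv γ, mk_eq_mk_iff.2 ⟨γ, ?_⟩⟩
  simp

/-- Conjugation by a morphism between two objects. -/
def endEquiv {x y : C} (γ : x ⟶ y) : End x ≃* End y where
  toFun a := Groupoid.inv γ ≫ (a : x ⟶ x) ≫ γ
  invFun b := γ ≫ (b : y ⟶ y) ≫ Groupoid.inv γ
  left_inv a := by simp
  right_inv b := by simp
  map_mul' a b := by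
    change Groupoid.inv γ ≫ ((b : x ⟶ x) ≫ (a : x ⟶ x)) ≫ γ =
      (Groupoid.inv γ ≫ (b : x ⟶ x) ≫ γ) ≫ (Groupoid.inv γ ≫ (a : x ⟶ x) ≫ γ)
    simp

theorem _root_.IsPrimitiveElt.map {G H : Type*} [Group G] [Group H] (e : G ≃* H) {g : G}
    (h : IsPrimitiveElt g) : IsPrimitiveElt (e g) := by
  refine ⟨fun hf => h.1 ((Function.Injective.isOfFinOrder_iff (f := e.toMonoidHom) e.injective).1 hf), fun y hy => ?_⟩
  have hz : ∀ {x y : G}, x ∈ Subgroup.zpowers y ↔ e x ∈ Subgroup.zpowers (e y) := fun {x y} => by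
    simp only [Subgroup.mem_zpowers_iff, ← map_zpow, e.injective.eq_iff]
  obtain ⟨x, rfl⟩ := e.surjective y
  rw [Subgroup.zpowers_le, ← hz, ← Subgroup.zpowers_le]
  exact h.2 x (hz.2 hy)

theorem isPrimitive_iff (x : C) (h : ∀ y : C, Nonempty (x ⟶ y)) (c : FreeClass C) :
    c.IsPrimitive ↔ ∃ a : End x, IsPrimitiveElt a ∧ mk a = c := by
  constructor
  · rintro ⟨y, b, hb, rfl⟩
    obtain ⟨γ⟩ := h y
    refine ⟨(endEquiv γ).symm b, hb.map (endEquiv γ).symm, mk_eq_mk_iff.2 ⟨γ, ?_⟩⟩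
    change (γ ≫ (b : y ⟶ y) ≫ Groupoid.inv γ) ≫ γ = _
    simp
  · rintro ⟨a, ha, rfl⟩
    exact ⟨x, a, ha, rfl⟩

end FreeClass

/-! ### The induced maps and the exchange of sheets -/

namespace IdealTriangulation

variable {S : Type*} [TopologicalSpace S] [ChartedSpace (EuclideanHalfSpace 2) S] {M P : Set S}
  {τ : IdealTriangulation M P} (hS : IsMarkedSurface M P) (hτ : τ.IsSkewedGentle)

include hS hτ

/-- Equal paths in the cover have equal holonomy there, hence equal orbifold holonomy below, which
is faithful. -/
theorem down_map_eq {x y : FundamentalGroupoid τ.PuncturedCover} {f g : x ⟶ y}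
    (h : τ.fill.map f = τ.fill.map g) : τ.down.map f = τ.down.map g :=
  orbHol_injective hS hτ (by rw [orbHol_down, orbHol_down, h])

/-- The functor induced by the projection. -/
noncomputable def inducedFunctor (x y : FundamentalGroupoid τ.PuncturedCover)
    (f : τ.fill.obj x ⟶ τ.fill.obj y) : τ.down.obj x ⟶ τ.down.obj y :=
  τ.down.map (exists_fill_eq hS hτ f).choose

theorem inducedFunctor_fill {x y : FundamentalGroupoid τ.PuncturedCover} (g : x ⟶ y) :
    inducedFunctor hS hτ x y (τ.fill.map g) = τ.down.map g :=
  down_map_eq hS hτ (exists_fill_eq hS hτ (τ.fill.map g)).choose_spec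

theorem isInducedFunctor : τ.IsInducedFunctor (inducedFunctor hS hτ) where
  map_id x := by
    have h := inducedFunctor_fill hS hτ (𝟙 x)
    rwa [CategoryTheory.Functor.map_id, CategoryTheory.Functor.map_id] at h
  map_comp x y z f g := by
    obtain ⟨f, rfl⟩ := exists_fill_eq hS hτ f
    obtain ⟨g, rfl⟩ := exists_fill_eq hS hτ g
    rw [← CategoryTheory.Functor.map_comp, inducedFunctor_fill, inducedFunctor_fill,
      inducedFunctor_fill, CategoryTheory.Functor.map_comp]
  map_fill x y g := inducedFunctor_fill hS hτ g

theorem nonempty_hom_punctured (x y : FundamentalGroupoid τ.PuncturedCover) : Nonempty (x ⟶ y) := by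
  obtain ⟨f⟩ := nonempty_hom hS hτ (τ.fill.obj x) (τ.fill.obj y)
  exact ⟨(exists_fill_eq hS hτ f).choose⟩

theorem exists_mk_fill (x : FundamentalGroupoid τ.PuncturedCover)
    (c : FreeClass (FundamentalGroupoid τ.Cover)) :
    ∃ g : End x, FreeClass.mk (x := τ.fill.obj x) (τ.fill.map g) = c := by
  obtain ⟨f, rfl⟩ := FreeClass.mk_surjective (τ.fill.obj x) (nonempty_hom hS hτ _) c
  obtain ⟨g, hg⟩ := exists_fill_eq hS hτ (x := x) (y := x) f
  exact ⟨g, congrArg FreeClass.mk hg⟩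

/-- Every free class has a representative at one fixed base point that avoids the points over
punctures, and so do the conjugating paths. -/
theorem existsUnique_inducedFree : ∃! Ψ : FreeClass (FundamentalGroupoid τ.Cover) →
    FreeClass (OrbGroupoid P), τ.IsInducedFree Ψ := by
  have hne : Nonempty τ.PuncturedCover := by
    obtain ⟨p, hp⟩ := hS.punctures_nonempty
    obtain ⟨t, -⟩ := hτ.puncture_enclosed p hp
    exact ⟨((isGlued_puncturedCover hS hτ).bary (t, true)).as⟩
  obtain ⟨x₀⟩ := hne
  choose f hf using exists_mk_fill hS hτ ⟨x₀⟩
  refine ⟨fun c => FreeClass.mk (x := τ.down.obj ⟨x₀⟩) (τ.down.map (f c)), fun x g => ?_,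
    fun Ψ hΨ => ?_⟩
  · obtain ⟨γ, hγ⟩ := FreeClass.mk_eq_mk_iff.1
      (hf (FreeClass.mk (x := τ.fill.obj x) (τ.fill.map g)))
    obtain ⟨γ, rfl⟩ := exists_fill_eq hS hτ γ
    refine FreeClass.mk_eq_mk_iff.2 ⟨τ.down.map γ, ?_⟩
    have h1 := down_map_eq hS hτ ((τ.fill.map_comp _ _).trans
      (hγ.trans (τ.fill.map_comp γ g).symm))
    exact (τ.down.map_comp _ _).symm.trans (h1.trans (τ.down.map_comp γ g))
  · funext c
    conv_lhs => rw [← hf c]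
    exact hΨ ⟨x₀⟩ (f c)

theorem nonempty_hom_orb (x y : OrbGroupoid P) : Nonempty (x ⟶ y) := by
  have hlift : ∀ x : OrbGroupoid P, ∃ z : FundamentalGroupoid τ.PuncturedCover,
      τ.down.obj z = x := by
    rintro ⟨⟨x⟩⟩
    obtain ⟨a, ha⟩ := (isGlued_base hS hτ).isQuotientMap.surjective x
    refine ⟨⟨τ.coverPt₀ ⟨⟨(a.1.1, true), a.1.2⟩, a.2⟩⟩, ?_⟩
    rw [← ha]
    rfl
  obtain ⟨z, rfl⟩ := hlift x
  obtain ⟨w, rfl⟩ := hlift y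
  exact (nonempty_hom_punctured hS hτ z w).map τ.down.map

variable (x₀ : FundamentalGroupoid τ.PuncturedCover)

/-- The homomorphism of vertex groups induced by the projection. -/
noncomputable def inducedHom : End (τ.fill.obj x₀) →* End (τ.down.obj x₀) where
  toFun := inducedFunctor hS hτ x₀ x₀
  map_one' := (isInducedFunctor hS hτ).map_id x₀
  map_mul' f g := (isInducedFunctor hS hτ).map_comp x₀ x₀ x₀ g f

theorem orbHol_inducedHom (γ : End (τ.fill.obj x₀)) :
    orbHol hS hτ (inducedHom hS hτ x₀ γ) = (coverHol hS hτ).toFun γ := by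
  obtain ⟨g, hg⟩ := exists_fill_eq hS hτ (x := x₀) (y := x₀) γ
  rw [← hg]
  exact (congrArg (orbHol hS hτ) (inducedFunctor_fill hS hτ g)).trans (orbHol_down hS hτ g)

/-- The holonomy of the vertex group. -/
noncomputable def orbHom (x : OrbGroupoid P) : End x →* SwapGroup (τ.Tri × Fin 3) where
  -- Multiplication in `End` reverses composition, so the inverse of the holonomy is the
  -- homomorphism.
  toFun g := (orbHol hS hτ g)⁻¹
  map_one' := by
    rw [inv_eq_one]; exact orbHol_id hS hτ x
  map_mul' f g := by
    rw [← mul_inv_rev]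
    exact congrArg _ (orbHol_comp hS hτ (g : x ⟶ x) (f : x ⟶ x))

theorem orbHom_injective (x : OrbGroupoid P) : Function.Injective (orbHom hS hτ x) :=
  fun _ _ h => orbHol_injective hS hτ (inv_injective h)

theorem inducedHom_injective : Function.Injective (inducedHom hS hτ x₀) := fun a b h => by
  have := congrArg (orbHol hS hτ) h
  rw [orbHol_inducedHom, orbHol_inducedHom] at this
  exact coverHol_injective hS hτ this

/-- Loops of the orbifold groupoid lift to the punctured cover, starting in any sheet. -/
theorem exists_lift_orb {z : FundamentalGroupoid τ.PuncturedCover}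
    (hz : τ.puncturedProj z.as = τ.puncturedProj x₀.as) (g : End (τ.down.obj x₀)) :
    ∃ (w : FundamentalGroupoid τ.PuncturedCover) (f : z ⟶ w), (w.as = x₀.as ∨ w.as = τ.swap₀ x₀.as) ∧
      (coverHol hS hτ).toFun (τ.fill.map f) = orbHol hS hτ g := by
  obtain ⟨g', hg⟩ := (CategoryTheory.Quotient.functor (orbHomRel P)).map_surjective
    (X := (FundamentalGroupoid.map τ.puncturedProj).obj x₀)
    (Y := (FundamentalGroupoid.map τ.puncturedProj).obj x₀) g
  obtain ⟨w, f, hw, hf⟩ := exists_lift hS hτ g' z hz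
  exact ⟨w, f, eq_or_eq_swap₀ hw.symm, by rw [hf, ← hg]; rfl⟩

omit x₀ in
theorem right_coverHol_ne_one {z w : FundamentalGroupoid τ.PuncturedCover} (f : z ⟶ w)
    (h : w.as = τ.swap₀ z.as ∨ z.as = τ.swap₀ w.as) :
    ((coverHol hS hτ).toFun (τ.fill.map f)).right ≠ 1 := by
  have hne : Nonempty τ.Tri := by
    obtain ⟨p, hp⟩ := hS.punctures_nonempty
    obtain ⟨t, -⟩ := hτ.puncture_enclosed p hp
    exact ⟨t⟩
  have hz : (τ.fill.obj z).as = z.as.1 := rfl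
  have hw : (τ.fill.obj w).as = w.as.1 := rfl
  rw [right_coverHol, hz, hw, Ne, mul_inv_eq_one]
  rcases h with h | h
  · rw [h, sheet_swap₀, left_eq_mul]
    exact flipGen_ne_one
  · rw [h, sheet_swap₀, mul_eq_left]
    exact flipGen_ne_one

omit x₀ in
theorem right_coverHol_eq_one {z w : FundamentalGroupoid τ.PuncturedCover} (f : z ⟶ w)
    (h : w.as = z.as) : ((coverHol hS hτ).toFun (τ.fill.map f)).right = 1 := by
  obtain rfl : w = z := by cases w; cases z; cases h; rfl
  rw [right_coverHol, mul_inv_cancel]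

/-- A loop below lies in the image exactly when its lift closes up, and the order-two component
tells whether the lift ends at the base point or at its exchange. -/
theorem mem_range_inducedHom {g : End (τ.down.obj x₀)} :
    g ∈ (inducedHom hS hτ x₀).range ↔ (orbHol hS hτ g).right = 1 := by
  constructor
  · rintro ⟨γ, rfl⟩
    rw [orbHol_inducedHom, right_coverHol, mul_inv_cancel]
  · intro h
    obtain ⟨w, f, hw, hf⟩ := exists_lift_orb hS hτ x₀ rfl g
    rw [← hf] at h
    have hwx : w.as = x₀.as :=
      hw.resolve_right fun e => right_coverHol_ne_one hS hτ f (Or.inl e) h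
    obtain rfl : w = x₀ := by cases w; cases x₀; cases hwx; rfl
    refine ⟨τ.fill.map f, orbHol_injective hS hτ ?_⟩
    rw [orbHol_inducedHom, hf]

omit x₀ hS hτ in
theorem down_obj_swap (x : FundamentalGroupoid τ.PuncturedCover) :
    τ.down.obj ⟨τ.swap₀ x.as⟩ = τ.down.obj x :=
  congrArg (fun y => (⟨⟨y⟩⟩ : OrbGroupoid P)) (puncturedProj_swap₀ x.as)

omit x₀ in
theorem orbHol_eqToHom {x y : OrbGroupoid P} (h : x = y) : orbHol hS hτ (eqToHom h) = 1 := by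
  subst h; exact orbHol_id hS hτ x

omit hS hτ x₀ in
-- All axioms are inherited from `SwapGroup` along an embedding under which `K` is the preimage of
-- the free part.
theorem _root_.IsOrbifoldPair.of_injective {A : Type} {G : Type*} [Group G] {K : Subgroup G}
    (ρ : G →* SwapGroup A) (hρ : Function.Injective ρ) (hK : ∀ g, g ∈ K ↔ (ρ g).right = 1)
    (hne : ∃ g, g ∉ K) : IsOrbifoldPair K where
  mul_mem x hx y hy := by
    rw [hK] at hx hy ⊢
    rw [map_mul]
    exact right_mul_of_ne hx hy
  exists_notMem := hne
  pow_inj x hx y hy n hn h := hρ (SwapGroup.eq_of_pow_eq ((hK x).1 hx) ((hK y).1 hy) hn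
    (by rw [← map_pow, ← map_pow, h]))
  common_root x hx y hy h := by
    obtain ⟨u, hu, h1, h2⟩ := SwapGroup.exists_mem_zpowers_of_commute ((hK x).1 hx) ((hK y).1 hy)
      (by rw [← map_mul, ← map_mul, h])
    rw [← Set.image_pair, ← MonoidHom.map_closure] at hu
    obtain ⟨v, hv, rfl⟩ := hu
    have hz : ∀ {x : G}, ρ x ∈ Subgroup.zpowers (ρ v) → x ∈ Subgroup.zpowers v := fun {x} => by
      simp only [Subgroup.mem_zpowers_iff, ← map_zpow, hρ.eq_iff, imp_self]
    refine ⟨v, (Subgroup.closure_le K).2 ?_ hv, hz h1, hz h2⟩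
    rintro _ (rfl | rfl)
    exacts [hx, hy]
  involution t ht htt f hf h := hρ (by
    rw [map_one]
    exact SwapGroup.eq_one_of_commute (mt (hK t).2 ht) (by rw [← map_mul, htt, map_one])
      ((hK f).1 hf) (by rw [← map_mul, ← map_mul, h]))

theorem isOrbifoldPair : IsOrbifoldPair (inducedHom hS hτ x₀).range := by
  refine .of_injective (orbHom hS hτ _) (orbHom_injective hS hτ _) (fun g => ?_) ?_
  · rw [mem_range_inducedHom]
    change _ ↔ ((orbHol hS hτ g)⁻¹).right = 1
    rw [SemidirectProduct.inv_right, inv_eq_one]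
  · obtain ⟨f⟩ := nonempty_hom_punctured hS hτ x₀ ⟨τ.swap₀ x₀.as⟩
    refine ⟨τ.down.map f ≫ eqToHom (down_obj_swap x₀), ?_⟩
    rw [mem_range_inducedHom, orbHol_comp, orbHol_eqToHom, mul_one, orbHol_down]
    exact right_coverHol_ne_one hS hτ f (Or.inl rfl)

/-- A path from the exchanged base point to `x₀` projects to a loop that does not lift to a loop,
and every such loop arises this way. Since the exchange preserves holonomy, conjugating along the
path above is conjugating by the loop below. -/
theorem swapFree_mk_eq_iff {γ δ : End (τ.fill.obj x₀)} :
    τ.swapFree (FreeClass.mk γ) = FreeClass.mk δ ↔ ∃ g ∉ (inducedHom hS hτ x₀).range,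
      g * inducedHom hS hτ x₀ γ * g⁻¹ = inducedHom hS hτ x₀ δ := by
  have hswap : (coverHol hS hτ).toFun ((FundamentalGroupoid.map τ.swap).map γ) =
      (coverHol hS hτ).toFun γ := by
    obtain ⟨γ', rfl⟩ := exists_fill_eq hS hτ (x := x₀) (y := x₀) γ
    exact coverHol_swap hS hτ γ'
  have h0 : τ.swapFree (FreeClass.mk γ) = FreeClass.mk (x := (FundamentalGroupoid.map τ.swap).obj
    (τ.fill.obj x₀)) ((FundamentalGroupoid.map τ.swap).map γ) := rfl
  rw [h0, FreeClass.mk_eq_mk_iff]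
  have hmul : ∀ {g : End (τ.down.obj x₀)}, g * inducedHom hS hτ x₀ γ * g⁻¹ =
      inducedHom hS hτ x₀ δ ↔ (coverHol hS hτ).toFun γ * orbHol hS hτ g =
        orbHol hS hτ g * (coverHol hS hτ).toFun δ := fun {g} => by
    rw [mul_inv_eq_iff_eq_mul, ← orbHol_inducedHom hS hτ x₀ γ, ← orbHol_inducedHom hS hτ x₀ δ,
      ← orbHol_comp, ← orbHol_comp]
    exact ⟨fun h => congrArg (orbHol hS hτ) h, fun h => orbHol_injective hS hτ h⟩
  constructor
  · rintro ⟨c, hc⟩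
    obtain ⟨c, rfl⟩ := exists_fill_eq hS hτ (x := ⟨τ.swap₀ x₀.as⟩) (y := x₀) c
    have hg : orbHol hS hτ (eqToHom (down_obj_swap x₀).symm ≫ τ.down.map c) =
        (coverHol hS hτ).toFun (τ.fill.map c) := by
      rw [orbHol_comp, orbHol_eqToHom, one_mul, orbHol_down]
    refine ⟨eqToHom (down_obj_swap x₀).symm ≫ τ.down.map c, ?_, ?_⟩
    · rw [mem_range_inducedHom, hg]
      exact right_coverHol_ne_one hS hτ c (Or.inr rfl)
    · rw [hmul, hg, ← hswap]
      exact ((coverHol hS hτ).map_comp _ _).symm.trans ((congrArg (coverHol hS hτ).toFun hc).trans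
        ((coverHol hS hτ).map_comp _ _))
  · rintro ⟨g, hg, h⟩
    rw [mem_range_inducedHom] at hg
    rw [hmul] at h
    obtain ⟨w, f, hw, hf⟩ := exists_lift_orb hS hτ x₀ (z := ⟨τ.swap₀ x₀.as⟩)
      (puncturedProj_swap₀ x₀.as) g
    have hwx : w.as = x₀.as := by
      refine hw.resolve_right fun e => hg ?_
      rw [← hf]
      exact right_coverHol_eq_one hS hτ f e
    obtain rfl : w = x₀ := by cases w; cases x₀; cases hwx; rfl
    refine ⟨τ.fill.map f, coverHol_injective hS hτ ?_⟩
    rw [← hf, ← hswap] at h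
    exact ((coverHol hS hτ).map_comp _ _).trans (h.trans ((coverHol hS hτ).map_comp _ _).symm)

theorem isOrbifoldCover {Ψ : FreeClass (FundamentalGroupoid τ.Cover) → FreeClass (OrbGroupoid P)}
    (hΨ : τ.IsInducedFree Ψ) : IsOrbifoldCover (inducedHom hS hτ x₀)
      (FreeClass.mk : End (τ.fill.obj x₀) → _) (FreeClass.mk : End (τ.down.obj x₀) → _) Ψ
      τ.swapFree where
  pair := isOrbifoldPair hS hτ x₀
  inj := inducedHom_injective hS hτ x₀
  p_surj := FreeClass.mk_surjective _ (nonempty_hom hS hτ _)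
  p_eq := FreeClass.mk_eq_mk_iff_conj
  q_eq := FreeClass.mk_eq_mk_iff_conj
  map γ := by
    obtain ⟨g, hg⟩ := exists_fill_eq hS hτ (x := x₀) (y := x₀) γ
    rw [← hg]
    exact (hΨ x₀ g).trans (congrArg FreeClass.mk (inducedFunctor_fill hS hτ g).symm)
  swap := swapFree_mk_eq_iff hS hτ x₀

end IdealTriangulation

theorem mainTheorem9 {S : Type*} [TopologicalSpace S] [ChartedSpace (EuclideanHalfSpace 2) S]
    (M P : Set S) (hS : IsMarkedSurface M P)
    (τ : IdealTriangulation M P) (hτ : τ.IsSkewedGentle)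
    (k : Type*) [Field k] [IsAlgClosed k] (hk : ringChar k ≠ 2) :
    (∃! Φ : (∀ x y : FundamentalGroupoid τ.PuncturedCover,
        (τ.fill.obj x ⟶ τ.fill.obj y) → (τ.down.obj x ⟶ τ.down.obj y)), τ.IsInducedFunctor Φ) ∧
    (∃! Ψ : FreeClass (FundamentalGroupoid τ.Cover) → FreeClass (OrbGroupoid P),
      τ.IsInducedFree Ψ) ∧
    ∀ (Φ : ∀ x y : FundamentalGroupoid τ.PuncturedCover,
        (τ.fill.obj x ⟶ τ.fill.obj y) → (τ.down.obj x ⟶ τ.down.obj y))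
      (Ψ : FreeClass (FundamentalGroupoid τ.Cover) → FreeClass (OrbGroupoid P)),
      τ.IsInducedFunctor Φ → τ.IsInducedFree Ψ →
      (∀ x₀ : FundamentalGroupoid τ.PuncturedCover,
        -- (1)
        (∀ γ : End (τ.fill.obj x₀), IsPrimitiveElt γ →
          τ.swapFree (FreeClass.mk γ) = FreeClass.mk γ →
          ∃ α : End (τ.down.obj x₀), IsPrimitiveElt α ∧
            Ψ (FreeClass.mk γ) = FreeClass.mk (α ^ 2)) ∧
        -- (2)
        (∀ γ : End (τ.fill.obj x₀), ∀ φ : End (τ.down.obj x₀), φ = Φ x₀ x₀ γ →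
          (τ.swapFree (FreeClass.mk γ) = FreeClass.mk γ⁻¹ ↔
            FreeClass.mk φ = FreeClass.mk φ⁻¹) ∧
          (τ.swapFree (FreeClass.mk γ) = FreeClass.mk γ⁻¹ →
            (IsPrimitiveElt γ ↔ IsPrimitiveElt φ))) ∧
        -- (3)
        (∀ γ : End (τ.down.obj x₀), IsPrimitiveElt γ →
          (FreeClass.mk γ ∉ Set.range Ψ ↔
            ∃ δ : End (τ.fill.obj x₀), IsPrimitiveElt δ ∧
              τ.swapFree (FreeClass.mk δ) = FreeClass.mk δ ∧
              FreeClass.mk (γ ^ 2) = Ψ (FreeClass.mk δ))) ∧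
        -- (4)
        (∀ γ : End (τ.down.obj x₀), IsPrimitiveElt γ → FreeClass.mk γ = FreeClass.mk γ⁻¹ →
          ∃ δ : End (τ.fill.obj x₀), FreeClass.mk γ = Ψ (FreeClass.mk δ) ∧
            τ.swapFree (FreeClass.mk δ) = FreeClass.mk δ⁻¹)) ∧
      -- first bijection, induced by `Ψ`
      (∃ e : {s : Set (FreeClass (FundamentalGroupoid τ.Cover)) |
            ∃ c, c.IsPrimitive ∧ τ.swapFree c ≠ c ∧ τ.swapFree c ≠ c.inv ∧
              s = {c, τ.swapFree c}} ≃
          {d : FreeClass (OrbGroupoid P) | d.IsPrimitive ∧ d ∈ Set.range Ψ ∧ d ≠ d.inv},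
        ∀ s, ∀ c ∈ s.1, (e s).1 = Ψ c) ∧
      -- second bijection, induced by `Ψ`
      (∃ e : {s : Set (FreeClass (FundamentalGroupoid τ.Cover)) |
            ∃ c, c.IsPrimitive ∧ τ.swapFree c = c.inv ∧ s = {c, τ.swapFree c}} ≃
          {d : FreeClass (OrbGroupoid P) | d.IsPrimitive ∧ d = d.inv},
        ∀ s, ∀ c ∈ s.1, (e s).1 = Ψ c) ∧
      -- third bijection, for every choice `r` of square roots
      (∀ r : kˣ → kˣ, (∀ u, r u ^ 2 = u) →
        ∃ e : {c : FreeClass (FundamentalGroupoid τ.Cover) |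
              c.IsPrimitive ∧ τ.swapFree c = c} × kˣ × ZMod 2 ≃
            {d : FreeClass (OrbGroupoid P) | d ∉ Set.range Ψ ∧ d.IsPrimitive} × kˣ,
          ∀ c u ε, (e (c, u, ε)).1.1.sq = Ψ c.1 ∧
            (e (c, u, ε)).2 = if ε = 0 then r u else - r u) := by
  have hΦ := IdealTriangulation.isInducedFunctor hS hτ
  have huniq : ∀ Φ, τ.IsInducedFunctor Φ → Φ = IdealTriangulation.inducedFunctor hS hτ := by
    intro Φ h
    funext x y f
    obtain ⟨g, rfl⟩ := IdealTriangulation.exists_fill_eq hS hτ f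
    rw [h.map_fill, IdealTriangulation.inducedFunctor_fill]
  refine ⟨⟨_, hΦ, huniq⟩, IdealTriangulation.existsUnique_inducedFree hS hτ, fun Φ Ψ h hΨ => ?_⟩
  obtain rfl := huniq Φ h
  have hC := fun x₀ => IdealTriangulation.isOrbifoldCover hS hτ x₀ hΨ
  obtain ⟨p, hp⟩ := hS.punctures_nonempty
  obtain ⟨t, -⟩ := hτ.puncture_enclosed p hp
  -- The bijections concern free classes only, so any base point serves; both groupoids are
  -- connected.
  have x₁ : FundamentalGroupoid τ.PuncturedCover :=
    (IdealTriangulation.isGlued_puncturedCover hS hτ).bary (t, true)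
  have hpA := FreeClass.isPrimitive_iff (τ.fill.obj x₁) (IdealTriangulation.nonempty_hom hS hτ _)
  have hpB := FreeClass.isPrimitive_iff (τ.down.obj x₁)
    (IdealTriangulation.nonempty_hom_orb hS hτ _)
  refine ⟨fun x₀ => ⟨fun γ hγ hs => ?_, fun γ φ hφ => ?_, fun γ hγ => (hC x₀).notMem_range_iff hγ,
    fun γ hγ hi => ?_⟩, (hC x₁).exists_equiv_generic hpA hpB (fun _ => rfl) (fun _ => rfl),
    (hC x₁).exists_equiv_inv hpA hpB (fun _ => rfl) (fun _ => rfl), fun r hr => ?_⟩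
  · obtain ⟨α, h1, -, h2⟩ := (hC x₀).exists_sq_eq hγ hs
    exact ⟨α, h1, by rw [h2]; exact (hC x₀).map γ⟩
  · subst hφ
    exact ⟨(hC x₀).swap_eq_inv_iff, (hC x₀).isPrimitiveElt_iff_of_swap_eq_inv⟩
  · obtain ⟨δ, h1, h2⟩ := (hC x₀).exists_of_eq_inv hγ hi
    exact ⟨δ, by rw [← h1]; exact ((hC x₀).map δ).symm, h2⟩
  · obtain ⟨e, he⟩ := (hC x₁).exists_equiv_sq hpA hpB (sqB := FreeClass.sq) (fun _ => rfl)
    exact ⟨e.prodCongr (Equiv.ofBijective _ (bijective_sqrt hk r hr)),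
      fun c u ε => ⟨he c, rfl⟩⟩
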